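/- Let $n,t,d\ge 2$, let $\boldsymbol x=(x_1,\dots,x_n)$ be unknowns, $\boldsymbol y=(y_1,\dots,y_t)$ parameters, and $\mathbb K=\mathbb Q(\boldsymbol y)$. Let $\boldsymbol f=(f_1,\dots,f_e)\subset\mathbb Q[\boldsymbol y][\boldsymbol x]$ be polynomials of total degree (in $\boldsymbol x,\boldsymbol y$) at most $d$ such that: (R) $\boldsymbol f$ is an affine regular sequence in $\mathbb K[\boldsymbol x]$: writing $f_i^H$ for the homogeneous component of largest degree of $f_i\in\mathbb K[\boldsymbol x]$, each $f_i^H$ is a nonzerodivisor in $\mathbb K[\boldsymbol x]/\langle f_1^H,\dots,f_{i-1}^H\rangle$; (A1) there is a nonempty Zariski open $\mathcal O\subseteq\mathbb C^t$ such that for every $\eta\in\mathcal O$ the system $\boldsymbol f(\eta,\cdot)=0$ has at least one and only finitely many solutions in $\mathbb C^n$; (A2) every element $p$ of the reduced Gröbner basis $\mathscr G$ of $\langle\boldsymbol f\rangle\subset\mathbb Q[\boldsymbol y,\boldsymbol x]$ for the elimination ordering $\mathrm{grevlex}(\boldsymbol x)\succ\mathrm{grevlex}(\boldsymbol y)$ satisfies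 $\deg p=\deg_{\boldsymbol x}p$. Let $\mathscr B=(b_1,\dots,b_\delta)$ be the monomials in $\boldsymbol x$ that are not divisible by the leading monomial (for $\mathrm{grevlex}(\boldsymbol x)$ over $\mathbb K$) of any element of $\mathscr G$; they form a basis of $\mathcal A=\mathbb K[\boldsymbol x]/\langle\boldsymbol f\rangle$. For $q\in\mathbb Q[\boldsymbol y][\boldsymbol x]$ let $L_q$ be the multiplication by $q$ in $\mathcal A$, identified with its matrix in the basis $\mathscr B$, and let $\mathcal H_q=(\operatorname{tr}L_{q b_ib_j})_{1\le i,j\le\delta}$ be the parametric Hermite matrix of $(\boldsymbol f,q)$. Put $\lambda=n(d-1)$, $\mathscr T_{a,b,c}=\binom{a+b+c}{a}$, $\mathscr M_{a,b}=\binom{a+b}{a}$, and let $2<\omega\le3$ be an admissible exponent for matrix multiplication over $\mathbb Q$ ($m\times m$ matrices can be multiplied in $O(m^\omega)$ operations). Let $g=g'h\neq0$ with $g',h\in\mathbb Q[\boldsymbol y][\boldsymbol x]$, $\deg h\le d$ and $\deg g\le d_g$. (This is how the Hermite matrices occur in the classification algorithm: in its main loop, each new $\mathcal H_g$ has $g=g'h$,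 where $h$ is one of the input inequality polynomials and $\mathcal H_{g'}$ and $L_h$ are already known.) Then $\mathcal H_g$, $\mathcal H_{g'}$ and $L_h$ have entries in $\mathbb Q[\boldsymbol y]$, of degree at most $d_g+2\lambda$, $d_g+2\lambda$ and $d+\lambda$ respectively, and every minor of $\mathcal H_g$ has degree at most $(d_g+\lambda)d^n$. From the coefficients of the entries of $\mathcal H_{g'}$ and $L_h$: (i) all coefficients of the entries of $\mathcal H_g$ can be computed within $$\widetilde O\Bigl(\mathscr T_{t,d_g,2\lambda}\bigl(d^{2n}\,\mathscr T_{t,d_g,2\lambda}+d^{\omega n}\bigr)\Bigr)$$ arithmetic operations in $\mathbb Q$; (ii) all coefficients of any given minor of $\mathcal H_g$ can be computed within $$\widetilde O\Bigl(\mathscr M_{t,(d_g+\lambda)d^n}\bigl(d^{2n}\,\mathscr T_{t,d_g,2\lambda}+d^{\omega n}\bigr)\Bigr)$$ arithmetic operations in $\mathbb Q$. Here $\widetilde O(X)$ means at most $C\,X\log^\kappa X$ with constants $C,\kappa$ depending only on $\omega$. The algorithms are algebraic computation trees over $\mathbb Q$ (operations $+,-,\times,/$ and tests for zero, each of cost one,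 and rational constants), chosen depending only on $n,t,d,d_g,\delta$ (and, for a minor, on its rows and columns), and the same for all $\boldsymbol f,g',h$ as above. -/

import Mathlib

namespace ParamHermite

open MvPolynomial

/-! ### Monomial orderings -/

/-- The partial sums `(a₁ + ⋯ + aₙ, a₁ + ⋯ + aₙ₋₁, …, a₁)` of an exponent vector. -/
def partialSums (n : ℕ) : (Fin n →₀ ℕ) →+ Lex (Fin n → ℕ) where
  toFun a := toLex fun i => ∑ j ∈ Finset.univ.filter (fun j : Fin n => j ≤ Fin.rev i), a j
  map_zero' := by
    apply ofLex.injective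
    funext i
    simp only [Finsupp.coe_zero, Pi.zero_apply, Finset.sum_const_zero]
    rfl
  map_add' a b := by
    apply ofLex.injective
    funext i
    simp only [Finsupp.coe_add, Pi.add_apply, Finset.sum_add_distrib]
    rfl

lemma partialSums_apply {n : ℕ} (a : Fin n →₀ ℕ) (i : Fin n) :
    ofLex (partialSums n a) (Fin.rev i) = ∑ j ∈ Finset.Iic i, a j := by
  have h : ofLex (partialSums n a) (Fin.rev i)
      = ∑ j ∈ Finset.univ.filter (fun j : Fin n => j ≤ Fin.rev (Fin.rev i)), a j := rfl
  rw [h, Fin.rev_rev]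
  congr 1
  ext j
  simp

lemma partialSums_monotone (n : ℕ) : Monotone (partialSums n) := by
  intro a b h
  exact Pi.toLex_monotone fun i => Finset.sum_le_sum fun j _ => h j

lemma sum_Iic_eq_of_lt {n : ℕ} (a : Fin n →₀ ℕ) (i : Fin n) :
    ∑ j ∈ Finset.Iic i, a j = ∑ j ∈ Finset.Iio i, a j + a i := by
  rw [← Finset.Iio_insert, Finset.sum_insert (by simp), add_comm]

lemma partialSums_injective (n : ℕ) : Function.Injective (partialSums n) := by
  intro a b h
  have key : ∀ i : Fin n, ∑ j ∈ Finset.Iic i, a j = ∑ j ∈ Finset.Iic i, b j := fun i => by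
    rw [← partialSums_apply, ← partialSums_apply, h]
  ext i
  induction i using WellFoundedLT.induction with
  | ind i ih =>
    have hi := key i
    rw [sum_Iic_eq_of_lt, sum_Iic_eq_of_lt,
      Finset.sum_congr rfl fun j hj => ih j (Finset.mem_Iio.1 hj)] at hi
    exact Nat.add_left_cancel hi

/-- The exponent vectors, identified with the submonoid of their partial sums. -/
noncomputable def partialSumsEquiv (n : ℕ) :
    (Fin n →₀ ℕ) ≃+ AddMonoidHom.mrange (partialSums n) :=
  AddEquiv.ofBijective (partialSums n).mrangeRestrict
    ⟨fun _ _ h => partialSums_injective n (congrArg Subtype.val h),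
      (partialSums n).mrangeRestrict_surjective⟩

/-- The graded reverse lexicographic ordering on monomials in `x₁ ≻ ⋯ ≻ xₙ`, obtained by comparing
the partial sums lexicographically; `grevlex_lt_iff` gives the usual description. -/
noncomputable def grevlex (n : ℕ) : MonomialOrder.{0, 0} (Fin n) where
  syn := AddMonoidHom.mrange (partialSums n)
  wellFoundedLT_syn := ⟨InvImage.wf Subtype.val (wellFounded_lt (α := Lex (Fin n → ℕ)))⟩
  toSyn := partialSumsEquiv n
  toSyn_monotone := fun _ _ h => partialSums_monotone n h

/-- `a ≺ b` in the graded reverse lexicographic ordering iff `deg a < deg b`, or `deg a = deg b`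
and `a k > b k` at the last index `k` where `a` and `b` differ. -/
lemma grevlex_lt_iff {n : ℕ} (a b : Fin n →₀ ℕ) :
    (grevlex n).toSyn a < (grevlex n).toSyn b ↔
      a.degree < b.degree ∨
        a.degree = b.degree ∧ ∃ k, b k < a k ∧ ∀ j, k < j → a j = b j := by
  have hlt : (grevlex n).toSyn a < (grevlex n).toSyn b ↔ partialSums n a < partialSums n b :=
    Iff.rfl
  have hlex : partialSums n a < partialSums n b ↔
      ∃ i : Fin n, (∀ j, i < j → ∑ l ∈ Finset.Iic j, a l = ∑ l ∈ Finset.Iic j, b l) ∧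
        ∑ l ∈ Finset.Iic i, a l < ∑ l ∈ Finset.Iic i, b l := by
    simp only [← partialSums_apply]
    constructor
    · rintro ⟨i, h1, h2⟩
      refine ⟨Fin.rev i, fun j hj => h1 _ ?_, by simpa using h2⟩
      change Fin.rev j < i
      rw [← Fin.rev_lt_rev]
      simpa using hj
    · rintro ⟨i, h1, h2⟩
      refine ⟨Fin.rev i, fun j hj => ?_, h2⟩
      have := h1 (Fin.rev j) (by rw [← Fin.rev_lt_rev]; simpa using hj)
      simpa using this
  rw [hlt, hlex]
  cases n with
  | zero =>
    have : a = b := Subsingleton.elim _ _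
    subst this
    simp
  | succ n =>
    have hdeg : ∀ c : Fin (n + 1) →₀ ℕ, c.degree = ∑ l ∈ Finset.Iic (Fin.last n), c l := by
      intro c
      rw [Finsupp.degree_eq_sum]
      congr 1
      ext j
      simp [Fin.le_last]
    -- the sum up to `k` plus the entries after `k` make up the whole sum
    have hsplit : ∀ (c : Fin (n + 1) →₀ ℕ) (k : Fin (n + 1)),
        c.degree = ∑ l ∈ Finset.Iic k, c l + ∑ l ∈ Finset.Ioi k, c l := by
      intro c k
      rw [Finsupp.degree_eq_sum, ← Finset.sum_union]
      · congr 1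
        ext j
        simp [le_or_gt]
      · rw [Finset.disjoint_left]
        intro j hj hj'
        simp only [Finset.mem_Iic, Finset.mem_Ioi] at hj hj'
        omega
    constructor
    · rintro ⟨i, h1, h2⟩
      by_cases hi : i = Fin.last n
      · left
        subst hi
        rwa [hdeg, hdeg]
      · right
        have hil : i < Fin.last n := lt_of_le_of_ne (Fin.le_last i) hi
        have hd : a.degree = b.degree := by rw [hdeg, hdeg, h1 _ hil]
        have hiv : i.val < n := hil
        refine ⟨hd, ⟨i.val + 1, by omega⟩, ?_, fun j hj => ?_⟩
        · have h3 := h1 ⟨i.val + 1, by omega⟩ (by simp [Fin.lt_def])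
          rw [sum_Iic_eq_of_lt, sum_Iic_eq_of_lt] at h3
          have h4 : Finset.Iio (⟨i.val + 1, by omega⟩ : Fin (n + 1)) = Finset.Iic i := by
            ext l
            simp only [Finset.mem_Iio, Finset.mem_Iic, Fin.lt_def, Fin.le_def]
            omega
          rw [h4] at h3
          omega
        · have hj' : i.val + 1 < j.val := hj
          have h3 := h1 j (by rw [Fin.lt_def]; omega)
          have h5 := h1 ⟨j.val - 1, by omega⟩ (by rw [Fin.lt_def]; simp only; omega)
          have h4 : Finset.Iio j = Finset.Iic (⟨j.val - 1, by omega⟩ : Fin (n + 1)) := by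
            ext l
            simp only [Finset.mem_Iio, Finset.mem_Iic, Fin.lt_def, Fin.le_def]
            omega
          rw [sum_Iic_eq_of_lt, sum_Iic_eq_of_lt, h4] at h3
          omega
    · rintro (h | ⟨hd, k, hk, hj⟩)
      · refine ⟨Fin.last n, fun j hj => absurd hj (not_lt.2 (Fin.le_last j)), ?_⟩
        rwa [← hdeg, ← hdeg]
      · have htail : ∀ i : Fin (n + 1), k ≤ i →
            ∑ l ∈ Finset.Iic i, a l = ∑ l ∈ Finset.Iic i, b l := by
          intro i hi
          have h1 := hsplit a i
          have h2 := hsplit b i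
          have h3 : ∑ l ∈ Finset.Ioi i, a l = ∑ l ∈ Finset.Ioi i, b l :=
            Finset.sum_congr rfl fun l hl => hj l (lt_of_le_of_lt hi (Finset.mem_Ioi.1 hl))
          omega
        have hk' := htail k le_rfl
        rw [sum_Iic_eq_of_lt, sum_Iic_eq_of_lt] at hk'
        have hk0 : k.val ≠ 0 := by
          intro h0
          have h4 : Finset.Iio k = ∅ := by
            ext l
            simp only [Finset.mem_Iio, Fin.lt_def, Finset.notMem_empty, iff_false]
            omega
          rw [h4] at hk'
          simp at hk'
          omega
        have h4 : Finset.Iio k = Finset.Iic (⟨k.val - 1, by omega⟩ : Fin (n + 1)) := by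
          ext l
          simp only [Finset.mem_Iio, Finset.mem_Iic, Fin.lt_def, Fin.le_def]
          omega
        rw [h4] at hk'
        refine ⟨⟨k.val - 1, by omega⟩, fun j hj => htail j ?_, by omega⟩
        rw [Fin.lt_def] at hj
        rw [Fin.le_def]
        simp only at hj
        omega

/-- The elimination (block) ordering: compare the first blocks of variables with `m₁`, and break
ties with `m₂` on the second blocks. -/
noncomputable def elimOrder {σ τ : Type} (m₁ : MonomialOrder.{0, 0} σ)
    (m₂ : MonomialOrder.{0, 0} τ) : MonomialOrder.{0, 0} (σ ⊕ τ) where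
  syn := m₁.syn ×ₗ m₂.syn
  toSyn := (Finsupp.sumFinsuppAddEquivProdFinsupp.trans
    (AddEquiv.prodCongr m₁.toSyn m₂.toSyn)).trans (toLexAddEquiv (m₁.syn × m₂.syn))
  toSyn_monotone := by
    intro a b h
    refine Prod.Lex.toLex_mono ⟨m₁.toSyn_monotone fun i => ?_, m₂.toSyn_monotone fun i => ?_⟩
    · exact h (Sum.inl i)
    · exact h (Sum.inr i)

/-- Reduced Gröbner bases of an ideal `I` with respect to a monomial order `m`. -/
structure IsReducedGroebnerBasis {σ k : Type} [Field k] (m : MonomialOrder.{0, 0} σ)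
    (I : Ideal (MvPolynomial σ k)) (G : Set (MvPolynomial σ k)) : Prop where
  finite : G.Finite
  subset : ∀ p ∈ G, p ∈ I
  monic : ∀ p ∈ G, m.leadingCoeff p = 1
  exists_degree_le : ∀ q ∈ I, q ≠ 0 → ∃ p ∈ G, m.degree p ≤ m.degree q
  reduced : ∀ p ∈ G, ∀ p' ∈ G, p' ≠ p → ∀ a ∈ p.support, ¬ m.degree p' ≤ a

/-! ### Parametric polynomial systems -/

/-- `ℚ[y][x]`, with unknowns `x = (x₁, …, xₙ)` and parameters `y = (y₁, …, yₜ)`. Its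
`MvPolynomial.totalDegree` is the total degree in `x` and `y` together. -/
abbrev PolyXY (n t : ℕ) : Type := MvPolynomial (Fin n ⊕ Fin t) ℚ

/-- The field `𝕂 = ℚ(y)` of rational functions in the parameters. -/
abbrev ParamField (t : ℕ) : Type := FractionRing (MvPolynomial (Fin t) ℚ)

/-- The inclusion of `ℚ[y][x]` in `𝕂[x]`. -/
noncomputable def toKx (n t : ℕ) : PolyXY n t →ₐ[ℚ] MvPolynomial (Fin n) (ParamField t) :=
  aeval (Sum.elim X fun j => C (algebraMap (MvPolynomial (Fin t) ℚ) (ParamField t) (X j)))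

/-- The degree with respect to the unknowns `x`. -/
def degX {n t : ℕ} (p : PolyXY n t) : ℕ :=
  p.support.sup fun a => ∑ i : Fin n, a (Sum.inl i)

/-- The elimination ordering `grevlex(x) ≻ grevlex(y)`. -/
noncomputable def elimGrevlex (n t : ℕ) : MonomialOrder.{0, 0} (Fin n ⊕ Fin t) :=
  elimOrder (grevlex n) (grevlex t)

/-- The leading monomial of `p`, seen in `𝕂[x]`, for the ordering `grevlex(x)`. -/
noncomputable def lmX {n t : ℕ} (p : PolyXY n t) : Fin n →₀ ℕ :=
  (grevlex n).degree (toKx n t p)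

/-- The homogeneous component of largest degree. -/
noncomputable def topForm {σ k : Type} [Field k] (q : MvPolynomial σ k) : MvPolynomial σ k :=
  homogeneousComponent q.totalDegree q

/-- Affine regular sequences: the homogeneous components of largest degree form a regular
sequence, each being a nonzerodivisor modulo the previous ones. -/
def IsAffineRegular {σ k : Type} [Field k] {e : ℕ} (q : Fin e → MvPolynomial σ k) : Prop :=
  RingTheory.Sequence.IsWeaklyRegular (MvPolynomial σ k) (List.ofFn fun i => topForm (q i))

/-- The set of complex solutions of `f(η, ·) = 0`. -/
def fiber {n t e : ℕ} (f : Fin e → PolyXY n t) (η : Fin t → ℂ) : Set (Fin n → ℂ) :=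
  {x | ∀ i, aeval (Sum.elim x η) (f i) = 0}

/-- Zariski open subsets of `ℂᵗ`. -/
def IsZariskiOpen {t : ℕ} (O : Set (Fin t → ℂ)) : Prop :=
  ∃ S : Set (MvPolynomial (Fin t) ℂ), Oᶜ = {η | ∀ q ∈ S, eval η q = 0}

/-- For generic parameters the specialized system has finitely many and at least one complex
solution. -/
def GenericallyFinite {n t e : ℕ} (f : Fin e → PolyXY n t) : Prop :=
  ∃ O : Set (Fin t → ℂ), IsZariskiOpen O ∧ O.Nonempty ∧
    ∀ η ∈ O, (fiber f η).Nonempty ∧ (fiber f η).Finite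

/-- The standing assumptions. `f` is a sequence of polynomials of degree at most `d`, affine
regular in `𝕂[x]`, with generically finite nonempty fibres. `G` is the reduced Gröbner basis of
`⟨f⟩ ⊆ ℚ[y, x]` for the elimination ordering; all its elements satisfy `deg p = deg_x p`. The
family `b = (b₁, …, b_δ)` enumerates the monomials in `x` which are divisible by no leading
monomial of `G`. -/
structure IsRegularSystem {n t e δ : ℕ} (d : ℕ) (f : Fin e → PolyXY n t)
    (G : Set (PolyXY n t)) (b : Fin δ → Fin n →₀ ℕ) : Prop where
  degree_le : ∀ i, (f i).totalDegree ≤ d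
  regular : IsAffineRegular fun i => toKx n t (f i)
  genericallyFinite : GenericallyFinite f
  groebner : IsReducedGroebnerBasis (elimGrevlex n t) (Ideal.span (Set.range f)) G
  degree_eq_degX : ∀ p ∈ G, p.totalDegree = degX p
  injective : Function.Injective b
  range_eq : Set.range b = {a | ∀ p ∈ G, ¬ lmX p ≤ a}

/-! ### Parametric Hermite matrices -/

/-- The quotient algebra `𝒜 = 𝕂[x] / ⟨f⟩`. -/
abbrev QuotAlg {n t e : ℕ} (f : Fin e → PolyXY n t) : Type :=
  MvPolynomial (Fin n) (ParamField t) ⧸ Ideal.span (Set.range fun i => toKx n t (f i))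

/-- The class in `𝒜` of a polynomial of `ℚ[y][x]`. -/
noncomputable def cls {n t e : ℕ} (f : Fin e → PolyXY n t) (p : PolyXY n t) : QuotAlg f :=
  Ideal.Quotient.mk _ (toKx n t p)

/-- The class in `𝒜` of a monomial in `x`. -/
noncomputable def clsMon {n t e : ℕ} (f : Fin e → PolyXY n t) (a : Fin n →₀ ℕ) : QuotAlg f :=
  Ideal.Quotient.mk _ (monomial a 1)

/-- The Hermite matrix associated to `(f, g)` with respect to `b`, with entries
`tr (L_{g bᵢ bⱼ})`, where `L_q` is the multiplication by `q` in `𝒜`. -/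
noncomputable def hermiteMatrix {n t e δ : ℕ} (f : Fin e → PolyXY n t) (b : Fin δ → Fin n →₀ ℕ)
    (g : PolyXY n t) : Matrix (Fin δ) (Fin δ) (ParamField t) :=
  Matrix.of fun i j =>
    Algebra.trace (ParamField t) (QuotAlg f) (cls f g * clsMon f (b i) * clsMon f (b j))

/-- A matrix of polynomials in the parameters, seen over `𝕂 = ℚ(y)`. -/
noncomputable def overK {t δ : ℕ} (M : Matrix (Fin δ) (Fin δ) (MvPolynomial (Fin t) ℚ)) :
    Matrix (Fin δ) (Fin δ) (ParamField t) :=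
  M.map (algebraMap (MvPolynomial (Fin t) ℚ) (ParamField t))

/-! ### Arithmetic complexity -/

/-- The four arithmetic operations. -/
inductive ArithOp : Type
  | add | sub | mul | div

/-- The result of an operation on rational numbers. Division by zero gives zero; this does not
add power, up to a constant factor in the cost, because programs can test for zero. -/
def ArithOp.eval : ArithOp → ℚ → ℚ → ℚ
  | add, x, y => x + y
  | sub, x, y => x - y
  | mul, x, y => x * y
  | div, x, y => x / y

/-- Operands: an input variable, a rational constant, or the result of the `k`-th arithmetic
operation that was performed (counted from `0`). -/
inductive Operand (ι : Type) : Type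
  | input (i : ι)
  | const (q : ℚ)
  | reg (k : ℕ)

/-- The value of an operand for the input `v`, after operations with the results `l`. -/
def Operand.eval {ι : Type} (v : ι → ℚ) (l : List ℚ) : Operand ι → ℚ
  | input i => v i
  | const q => q
  | reg k => l.getD k 0

/-- Algebraic computation trees over `ℚ`, with inputs indexed by `ι` and outputs indexed by `κ`:
arithmetic operations, branchings according to whether a value is zero, and leaves that name the
outputs. -/
inductive CompTree (ι κ : Type) : Type
  | output (out : κ → Operand ι)
  | step (op : ArithOp) (x y : Operand ι) (next : CompTree ι κ)
  | branch (x : Operand ι) (ifZero ifNonzero : CompTree ι κ)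

namespace CompTree

variable {ι κ : Type}

/-- The outputs of a tree on input `v`, if the operations performed so far have the results `l`. -/
def runFrom (v : ι → ℚ) : CompTree ι κ → List ℚ → κ → ℚ
  | output out, l => fun o => (out o).eval v l
  | step op x y next, l => next.runFrom v (l ++ [op.eval (x.eval v l) (y.eval v l)])
  | branch x p q, l => if x.eval v l = 0 then p.runFrom v l else q.runFrom v l

/-- The outputs of a tree on input `v`. -/
def run (P : CompTree ι κ) (v : ι → ℚ) : κ → ℚ :=
  P.runFrom v []

/-- The largest number of arithmetic operations and zero tests along a path of the tree. -/
def cost : CompTree ι κ → ℕ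
  | output _ => 0
  | step _ _ _ next => next.cost + 1
  | branch _ p q => max p.cost q.cost + 1

end CompTree

/-- `ω` is an admissible exponent for matrix multiplication over `ℚ`: two `m × m` matrices can be
multiplied with `O(m ^ ω)` operations. -/
def IsAdmissibleExponent (ω : ℝ) : Prop :=
  ∃ C : ℝ, ∀ m : ℕ, ∃ P : CompTree ((Fin m × Fin m) ⊕ (Fin m × Fin m)) (Fin m × Fin m),
    (P.cost : ℝ) ≤ C * (m : ℝ) ^ ω ∧
    ∀ A B : Matrix (Fin m) (Fin m) ℚ,
      P.run (Sum.elim (fun x => A x.1 x.2) (fun x => B x.1 x.2)) = fun x => (A * B) x.1 x.2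

/-- Monomials in `y₁, …, yₜ` of degree at most `D`, the index set of the dense representation of
polynomials of degree at most `D`. -/
abbrev Mon (t D : ℕ) : Type := {a : Fin t →₀ ℕ // a.degree ≤ D}

/-- Index set of the dense representation of `δ × δ` matrices whose entries are polynomials of
degree at most `D`. -/
abbrev MatIdx (δ t D : ℕ) : Type := Fin δ × Fin δ × Mon t D

/-- The dense representation of a polynomial. -/
noncomputable def densePoly {t : ℕ} (D : ℕ) (p : MvPolynomial (Fin t) ℚ) : Mon t D → ℚ :=
  fun a => p.coeff a.1

/-- The dense representation of a matrix of polynomials. -/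
noncomputable def denseMat {δ t : ℕ} (D : ℕ)
    (M : Matrix (Fin δ) (Fin δ) (MvPolynomial (Fin t) ℚ)) : MatIdx δ t D → ℚ :=
  fun x => densePoly D (M x.1 x.2.1) x.2.2

/-- `𝒯_{a,b,c}`. -/
def trinom (a b c : ℕ) : ℕ := (a + b + c).choose a

/-- `ℳ_{a,b}`. -/
def binom (a b : ℕ) : ℕ := (a + b).choose a

/-- `λ = n (d - 1)`. -/
def lam (n d : ℕ) : ℕ := n * (d - 1)

/-- `𝒯_{t,d_g,2λ} (d^{2n} 𝒯_{t,d_g,2λ} + d^{ωn})`. -/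
noncomputable def matrixBound (ω : ℝ) (n t d dg : ℕ) : ℝ :=
  trinom t dg (2 * lam n d) *
    ((d : ℝ) ^ (2 * n) * trinom t dg (2 * lam n d) + (d : ℝ) ^ (ω * n))

/-- `ℳ_{t,(d_g+λ)dⁿ} (d^{2n} 𝒯_{t,d_g,2λ} + d^{ωn})`. -/
noncomputable def minorBound (ω : ℝ) (n t d dg : ℕ) : ℝ :=
  binom t ((dg + lam n d) * d ^ n) *
    ((d : ℝ) ^ (2 * n) * trinom t dg (2 * lam n d) + (d : ℝ) ^ (ω * n))

end ParamHermite

open ParamHermite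

namespace ParamHermite
open MvPolynomial

/-! The whole computation rests on `H_g = H_{g'} L_h`. Expanding `h b_j` in the basis and using
linearity of the trace gives this identity (`hermiteMatrix_mul`). So the program evaluates `H_{g'}`
and `L_h` at points, multiplies rational matrices, takes determinants if a minor is wanted, and
interpolates.

Polynomiality and degrees come from (A2). A Gröbner basis element `p` with `deg p = deg_x p` is
monic with a leading monomial in `x` alone, of degree `deg p` (`leading_of_degree_eq`). Hence
division by `G` needs no denominators and never raises the total degree in `x` and `y`
(`monomial_mem_normalForms`). In the normal form of `q`, the coefficient of `b_j` therefore has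
degree at most `deg q - deg b_j`. This bounds the entries of `L_q` by `deg q + deg b_j`, the trace
of `L_q` by `deg q`, and the `(i, j)` entry of `H_q` by `deg q + deg b_i + deg b_j`.

For minors one needs the sum of the degrees of the `b_j`. The exact sequences attached to a regular
sequence, filtered by degree (`IsTopIdeal.hilb_sup`), give `∏ (1 - X^{d_i}) = (1 - X)^n ∑ X^{deg
b_j}`, where `d_i` is the degree of `f_i` in `x`. If `δ > 0`, comparing the order of vanishing, the
value and the derivative at `1`, and the degrees, yields `e = n`, `δ = ∏ d_i`, `2 ∑ deg b_j = δ ∑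
(d_i - 1)` and `deg b_j ≤ ∑ (d_i - 1)` (`numerics_of_hilbert_series`).

The interpolation nodes are the `a ∈ ℕᵗ` with `|a| ≤ D`, exactly as many as there are coefficients.
Divided differences, then the change from Newton to monomial basis, are applied one variable at a
time, with all intermediate data indexed by the same simplex (`mixed_insert`). This costs `O(t D)`
operations per node.

Determinants in `O(m ^ ω)` operations need a recursion that also works for singular blocks. Over
`ℚ`, `MᵀM` has the same kernel as `M`, so Schur complements of Gram matrices with respect to
generalized inverses are again Gram matrices (`schur_gram`). They yield generalized inverses and
pivot columns. With the pivots known, a Cauchy matrix prescribes a unipotent column operation that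
makes the upper left block invertible whenever the whole matrix is
(`det_ne_zero_of_top_surjective`), and then `det_succ` splits the determinant into two of half the
size. -/

/-! ### Sequential composition of computation trees -/

/-- The operand `o` of a program that is run after `off` operations of another program, its inputs
being given by `g`. -/
def Operand.subst {ι ι' : Type} (g : ι → Operand ι') (off : ℕ) : Operand ι → Operand ι'
  | .input i => g i
  | .const q => .const q
  | .reg k => .reg (k + off)

/-- Replaces results of operations that have not been performed by the constant `0`. -/
def Operand.norm {ι : Type} (len : ℕ) : Operand ι → Operand ι
  | .input i => .input i
  | .const q => .const q
  | .reg k => if k < len then .reg k else .const 0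

/-- The operand `o` has the value `q` after the results `l` and any further ones. -/
def Operand.Stable {ι : Type} (v : ι → ℚ) (l : List ℚ) (o : Operand ι) (q : ℚ) : Prop :=
  ∀ ext, o.eval v (l ++ ext) = q

/-- A register that is not yet filled reads as `0`, but would change its value once further results
are appended; replacing it by the constant `0` removes this dependence. -/
lemma Operand.stable_norm {ι : Type} (v : ι → ℚ) (l : List ℚ) (o : Operand ι) :
    (o.norm l.length).Stable v l (o.eval v l) := by
  intro ext
  cases o with
  | input i => rfl
  | const q => rfl
  | reg k =>
    by_cases hk : k < l.length
    · simp only [Operand.norm, if_pos hk, Operand.eval]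
      exact List.getD_append _ _ _ _ hk
    · simp [Operand.norm, Operand.eval, hk]

lemma Operand.eval_subst {ι ι' : Type} {g : ι → Operand ι'} {v : ι → ℚ} {v' : ι' → ℚ}
    {l₀ l₁ : List ℚ} (hg : ∀ i, (g i).Stable v' l₀ (v i)) (o : Operand ι) :
    (o.subst g l₀.length).eval v' (l₀ ++ l₁) = o.eval v l₁ := by
  cases o with
  | input i => exact hg i l₁
  | const q => rfl
  | reg k =>
    simp only [Operand.subst, Operand.eval]
    rw [List.getD_append_right _ _ _ _ (by omega)]
    simp

namespace CompTree

/-- Runs a tree, with inputs given by `g`, after `off` operations, and then the continuation `k`;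
`len` is the number of operations performed so far. -/
def graft {ι ι' κ μ : Type} (g : ι → Operand ι') (off : ℕ)
    (k : (κ → Operand ι') → ℕ → CompTree ι' μ) : CompTree ι κ → ℕ → CompTree ι' μ
  | output out, len => k (fun o => ((out o).subst g off).norm len) len
  | step op x y next, len => step op (x.subst g off) (y.subst g off) (next.graft g off k (len + 1))
  | branch x p q, len => branch (x.subst g off) (p.graft g off k len) (q.graft g off k len)

lemma cost_graft {ι ι' κ μ : Type} (g : ι → Operand ι') (off : ℕ)
    (k : (κ → Operand ι') → ℕ → CompTree ι' μ) {c : ℕ} (hk : ∀ out len, (k out len).cost ≤ c)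
    (P : CompTree ι κ) (len : ℕ) : (P.graft g off k len).cost ≤ P.cost + c := by
  induction P generalizing len with
  | output out => simpa [graft, cost] using hk _ _
  | step op x y next ih =>
    have := ih (len + 1)
    simp only [graft, cost]; omega
  | branch x p q ihp ihq =>
    have h1 := ihp len
    have h2 := ihq len
    simp only [graft, cost]
    omega

/-- The invariant is that the registers `l₁` of the inner program sit behind the `l₀` of the outer
one. The operands handed to the continuation are existential because the leaf reached depends on the
input. -/
lemma runFrom_graft {ι ι' κ μ : Type} {g : ι → Operand ι'} {v : ι → ℚ} {v' : ι' → ℚ}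
    {l₀ : List ℚ} (hg : ∀ i, (g i).Stable v' l₀ (v i))
    (k : (κ → Operand ι') → ℕ → CompTree ι' μ) (P : CompTree ι κ) (l₁ : List ℚ) :
    ∃ (out : κ → Operand ι') (l₂ : List ℚ),
      (∀ o, (out o).Stable v' (l₀ ++ l₂) (P.runFrom v l₁ o)) ∧
      (P.graft g l₀.length k (l₀ ++ l₁).length).runFrom v' (l₀ ++ l₁) =
        (k out (l₀ ++ l₂).length).runFrom v' (l₀ ++ l₂) := by
  induction P generalizing l₁ with
  | output out =>
    refine ⟨_, l₁, fun o => ?_, rfl⟩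
    have h := Operand.stable_norm v' (l₀ ++ l₁) ((out o).subst g l₀.length)
    rwa [Operand.eval_subst hg] at h
  | step op x y next ih =>
    obtain ⟨out, l₂, h1, h2⟩ := ih (l₁ ++ [op.eval (x.eval v l₁) (y.eval v l₁)])
    refine ⟨out, l₂, h1, ?_⟩
    rw [← h2]
    simp only [graft, runFrom, Operand.eval_subst hg]
    rw [← List.append_assoc]
    simp [add_assoc]
  | branch x p q ihp ihq =>
    simp only [graft, runFrom, Operand.eval_subst hg]
    by_cases h : x.eval v l₁ = 0
    · simpa [h] using ihp l₁
    · simpa [h] using ihq l₁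

end CompTree

/-! ### Computable families of functions -/

/-- From the values of the functions in `K` one can compute the values of those in `T` with at most
`c` operations. -/
def Reach {Ω : Type} (K T : Set (Ω → ℚ)) (c : ℝ) : Prop :=
  ∃ P : CompTree K T, (P.cost : ℝ) ≤ c ∧ ∀ ω, P.run (fun k => k.1 ω) = fun x => x.1 ω

namespace Reach

variable {Ω : Type} {K K₁ K₂ T T₁ T₂ : Set (Ω → ℚ)} {c c₁ c₂ : ℝ}

lemma le (h : Reach K T c₁) (hc : c₁ ≤ c₂) : Reach K T c₂ := by
  obtain ⟨P, h1, h2⟩ := h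
  exact ⟨P, h1.trans hc, h2⟩

lemma of_subset (h : T ⊆ K) : Reach K T 0 :=
  ⟨.output fun x => .input ⟨x.1, h x.2⟩, by simp [CompTree.cost], fun _ => rfl⟩

/-- Subroutines: a program with inputs `ι` and outputs `κ` may be applied to known values. -/
lemma call {ι κ : Type} (P : CompTree ι κ) (a : ι → Ω → ℚ) (b : κ → Ω → ℚ) (ha : ∀ i, a i ∈ K)
    (hP : ∀ ω, P.run (fun i => a i ω) = fun k => b k ω) : Reach K (Set.range b) P.cost := by
  classical
  let k : (κ → Operand K) → ℕ → CompTree K (Set.range b) :=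
    fun out _ => .output fun x => out x.2.choose
  refine ⟨P.graft (fun i => .input ⟨a i, ha i⟩) 0 k 0, ?_, fun ω => ?_⟩
  · have := CompTree.cost_graft (fun i => .input ⟨a i, ha i⟩) 0 k (c := 0)
      (fun out len => le_of_eq rfl) P 0
    exact_mod_cast this
  · obtain ⟨out, l₂, h1, h2⟩ := CompTree.runFrom_graft (g := fun i => .input ⟨a i, ha i⟩)
      (v := fun i => a i ω) (v' := fun k : K => k.1 ω) (l₀ := []) (fun i ext => rfl) k P []
    have h2' : (P.graft (fun i => .input ⟨a i, ha i⟩) 0 k 0).run (fun k : K => k.1 ω) =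
      (k out l₂.length).runFrom (fun k : K => k.1 ω) l₂ := h2
    rw [h2']
    funext x
    have h3 := h1 x.2.choose []
    rw [List.append_nil] at h3
    change (out x.2.choose).eval _ l₂ = _
    have h4 := congrFun (hP ω) x.2.choose
    rw [List.nil_append] at h3
    rw [h3]
    exact h4.trans (congrFun x.2.choose_spec ω)

/-- The second tree is grafted onto every leaf of the first. Its inputs are original inputs where
possible, otherwise outputs of the first tree. -/
lemma bind (h₁ : Reach K T₁ c₁) (h₂ : Reach (K ∪ T₁) T c₂) : Reach K T (c₁ + c₂) := by
  classical
  obtain ⟨P, hP, hP'⟩ := h₁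
  obtain ⟨Q, hQ, hQ'⟩ := h₂
  let g : (T₁ → Operand K) → (K ∪ T₁ : Set _) → Operand K := fun out x =>
    if hx : x.1 ∈ K then .input ⟨x.1, hx⟩ else out ⟨x.1, x.2.resolve_left hx⟩
  let k : (T₁ → Operand K) → ℕ → CompTree K T := fun out len =>
    Q.graft (g out) len (fun out' _ => .output out') len
  refine ⟨P.graft .input 0 k 0, ?_, fun ω => ?_⟩
  · have h := CompTree.cost_graft Operand.input 0 k (c := Q.cost)
      (fun out len => CompTree.cost_graft (g out) len (fun out' _ => .output out') (c := 0)
        (fun _ _ => le_of_eq rfl) Q len) P 0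
    have h' : ((P.graft .input 0 k 0).cost : ℝ) ≤ P.cost + Q.cost := by exact_mod_cast h
    linarith
  · obtain ⟨out, l₂, h1, h2⟩ := CompTree.runFrom_graft (g := Operand.input)
      (v := fun k : K => k.1 ω) (v' := fun k : K => k.1 ω) (l₀ := []) (fun i ext => rfl) k P []
    have h2' : (P.graft .input 0 k 0).run (fun k : K => k.1 ω) =
      (k out l₂.length).runFrom (fun k : K => k.1 ω) l₂ := h2
    rw [h2']
    have hg : ∀ i, (g out i).Stable (fun k : K => k.1 ω) l₂ (i.1 ω) := by
      intro i
      by_cases hi : i.1 ∈ K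
      · simp only [g, hi, dif_pos]; exact fun _ => rfl
      · simp only [g, hi, dif_neg, not_false_eq_true]
        have h3 := h1 ⟨i.1, i.2.resolve_left hi⟩
        have h4 := congrFun (hP' ω) ⟨i.1, i.2.resolve_left hi⟩
        change P.runFrom _ [] _ = _ at h4
        rw [h4] at h3
        exact h3
    obtain ⟨out', l₃, h5, h6⟩ := CompTree.runFrom_graft (g := g out)
      (v := fun k : (K ∪ T₁ : Set _) => k.1 ω) (v' := fun k : K => k.1 ω) (l₀ := l₂) hg
      (fun out' _ => .output out') Q []
    rw [List.append_nil] at h6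
    refine h6.trans ?_
    funext x
    have h7 := h5 x []
    rw [List.append_nil] at h7
    change (out' x).eval _ (l₂ ++ l₃) = _
    rw [h7]
    exact congrFun (hQ' ω) x

lemma mono (h : Reach K T c) (hK : K ⊆ K₁) (hT : T₁ ⊆ T) : Reach K₁ T₁ c := by
  have h1 : Reach K T₁ (c + 0) := h.bind (of_subset (hT.trans Set.subset_union_right))
  have h2 : Reach K₁ T₁ (0 + (c + 0)) := (of_subset hK).bind (by
    obtain ⟨P, hP, hP'⟩ := h1
    have h3 := Reach.call (K := K₁ ∪ K) P (fun k ω => k.1 ω) (fun x ω => x.1 ω)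
      (fun k => Or.inr k.2) hP'
    rw [show Set.range (fun (x : T₁) ω => x.1 ω) = T₁ from Subtype.range_coe] at h3
    exact h3.le hP)
  exact h2.le (by simp)

lemma union (h₁ : Reach K T₁ c₁) (h₂ : Reach K T₂ c₂) : Reach K (T₁ ∪ T₂) (c₁ + c₂) := by
  have h : Reach (K ∪ T₁) (T₁ ∪ T₂) (c₂ + 0) :=
    (h₂.mono Set.subset_union_left subset_rfl).bind (of_subset (by
      rintro x (hx | hx)
      · exact Or.inl (Or.inr hx)
      · exact Or.inr hx))
  exact (h₁.bind h).le (by simp)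

lemma biUnion_finset {J : Type*} (s : Finset J) (T : J → Set (Ω → ℚ)) (c : ℝ)
    (h : ∀ j ∈ s, Reach K (T j) c) : Reach K (⋃ j ∈ s, T j) (s.card * c) := by
  classical
  induction s using Finset.induction_on with
  | empty => exact (of_subset (by simp)).le (by simp)
  | insert a s ha ih =>
    rw [Finset.set_biUnion_insert]
    refine ((h a (by simp)).union (ih fun j hj => h j (by simp [hj]))).le (le_of_eq ?_)
    rw [Finset.card_insert_of_notMem ha]; push_cast; ring

lemma iUnion {J : Type*} [Fintype J] (T : J → Set (Ω → ℚ)) (c : ℝ)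
    (h : ∀ j, Reach K (T j) c) : Reach K (⋃ j, T j) (Fintype.card J * c) := by
  have := biUnion_finset Finset.univ T c fun j _ => h j
  simpa using this

lemma range {J : Type*} [Fintype J] (F : J → Ω → ℚ) (c : ℝ)
    (h : ∀ j, Reach K {F j} c) : Reach K (Set.range F) (Fintype.card J * c) := by
  have := iUnion (fun j => {F j}) c h
  rwa [Set.iUnion_singleton_eq_range] at this

lemma of_mem {f : Ω → ℚ} (h : f ∈ K) : Reach K {f} 0 := of_subset (by simpa using h)

lemma const (q : ℚ) : Reach K {fun _ => q} 0 :=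
  ⟨.output fun _ => .const q, by simp [CompTree.cost], fun ω => funext fun x => by
    rw [show x.1 = fun _ => q from x.2]; rfl⟩

lemma op {f g : Ω → ℚ} (o : ArithOp) (hf : Reach K {f} c₁) (hg : Reach K {g} c₂) :
    Reach K {fun ω => o.eval (f ω) (g ω)} (c₁ + c₂ + 1) := by
  have h1 : Reach (K ∪ ({f} ∪ {g})) {fun ω => o.eval (f ω) (g ω)} 1 := by
    refine ⟨.step o (.input ⟨f, by simp⟩) (.input ⟨g, by simp⟩) (.output fun _ => .reg 0), ?_,
      fun ω => funext fun x => ?_⟩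
    · simp [CompTree.cost]
    · rw [show x.1 = fun ω => o.eval (f ω) (g ω) from x.2]
      rfl
  exact (hf.union hg).bind h1

lemma add {f g : Ω → ℚ} (hf : Reach K {f} c₁) (hg : Reach K {g} c₂) :
    Reach K {fun ω => f ω + g ω} (c₁ + c₂ + 1) := op .add hf hg

lemma sub {f g : Ω → ℚ} (hf : Reach K {f} c₁) (hg : Reach K {g} c₂) :
    Reach K {fun ω => f ω - g ω} (c₁ + c₂ + 1) := op .sub hf hg

lemma mul {f g : Ω → ℚ} (hf : Reach K {f} c₁) (hg : Reach K {g} c₂) :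
    Reach K {fun ω => f ω * g ω} (c₁ + c₂ + 1) := op .mul hf hg

lemma div {f g : Ω → ℚ} (hf : Reach K {f} c₁) (hg : Reach K {g} c₂) :
    Reach K {fun ω => f ω / g ω} (c₁ + c₂ + 1) := op .div hf hg

/-- Linear combinations of known quantities. -/
lemma linComb {J : Type*} (s : Finset J) (q : J → ℚ) (f : J → Ω → ℚ) (hf : ∀ j ∈ s, f j ∈ K) :
    Reach K {fun ω => ∑ j ∈ s, q j * f j ω} (2 * s.card) := by
  classical
  induction s using Finset.induction_on with
  | empty => simpa using const (K := K) 0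
  | insert a s ha ih =>
    simp only [Finset.sum_insert ha]
    have h1 := ((const (K := K) (q a)).mul (of_mem (hf a (by simp)))).add
      (ih fun j hj => hf j (by simp [hj]))
    refine h1.le (le_of_eq ?_)
    rw [Finset.card_insert_of_notMem ha]; push_cast; ring

/-- A program for indexed inputs and outputs. -/
lemma exists_tree {ι κ : Type} {a : ι → Ω → ℚ} {b : κ → Ω → ℚ}
    (h : Reach (Set.range a) (Set.range b) c) :
    ∃ P : CompTree ι κ, (P.cost : ℝ) ≤ c ∧ ∀ ω, P.run (fun i => a i ω) = fun k => b k ω := by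
  obtain ⟨P, hP, hP'⟩ := h
  let g : Set.range a → Operand ι := fun x => .input x.2.choose
  let k : (Set.range b → Operand ι) → ℕ → CompTree ι κ :=
    fun out _ => .output fun x => out ⟨b x, x, rfl⟩
  refine ⟨P.graft g 0 k 0, ?_, fun ω => ?_⟩
  · have := CompTree.cost_graft g 0 k (c := 0) (fun out len => le_of_eq rfl) P 0
    exact le_trans (by exact_mod_cast this) hP
  · obtain ⟨out, l₂, h1, h2⟩ := CompTree.runFrom_graft (g := g)
      (v := fun x => x.1 ω) (v' := fun i => a i ω) (l₀ := [])
      (fun i ext => congrFun i.2.choose_spec ω) k P []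
    have h2' : (P.graft g 0 k 0).run (fun i => a i ω) =
      (k out l₂.length).runFrom (fun i => a i ω) l₂ := h2
    rw [h2']
    funext x
    have h3 := h1 ⟨b x, x, rfl⟩ []
    rw [List.append_nil, List.nil_append] at h3
    change (out ⟨b x, x, rfl⟩).eval (fun i => a i ω) l₂ = _
    rw [h3]
    exact congrFun (hP' ω) ⟨b x, x, rfl⟩

end Reach

/-! ### Gram matrices: generalized inverses and pivots -/

/-- Index types with `2 ^ k` elements. -/
def Idx : ℕ → Type
  | 0 => Unit
  | k + 1 => Idx k ⊕ Idx k

noncomputable instance Idx.instFintype : ∀ k, Fintype (Idx k)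
  | 0 => inferInstanceAs (Fintype Unit)
  | k + 1 => by
    have := Idx.instFintype k
    exact inferInstanceAs (Fintype (Idx k ⊕ Idx k))

instance Idx.instDecidableEq : ∀ k, DecidableEq (Idx k)
  | 0 => inferInstanceAs (DecidableEq Unit)
  | k + 1 => by
    have := Idx.instDecidableEq k
    exact inferInstanceAs (DecidableEq (Idx k ⊕ Idx k))

lemma Idx.card (k : ℕ) : Fintype.card (Idx k) = 2 ^ k := by
  induction k with
  | zero => exact Fintype.card_unit
  | succ k ih =>
    have : Fintype.card (Idx (k + 1)) = Fintype.card (Idx k ⊕ Idx k) := rfl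
    rw [this, Fintype.card_sum, ih, pow_succ]; ring

instance : Subsingleton (Idx 0) := ⟨fun _ _ => rfl⟩

/-- Square matrices of size `2 ^ k`. -/
abbrev SqMat (k : ℕ) : Type := Matrix (Idx k) (Idx k) ℚ

namespace SqMat

/-- The upper left block. -/
def b11 {k : ℕ} (A : SqMat (k + 1)) : SqMat k := fun i j => A (Sum.inl i) (Sum.inl j)
/-- The upper right block. -/
def b12 {k : ℕ} (A : SqMat (k + 1)) : SqMat k := fun i j => A (Sum.inl i) (Sum.inr j)
/-- The lower left block. -/
def b21 {k : ℕ} (A : SqMat (k + 1)) : SqMat k := fun i j => A (Sum.inr i) (Sum.inl j)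
/-- The lower right block. -/
def b22 {k : ℕ} (A : SqMat (k + 1)) : SqMat k := fun i j => A (Sum.inr i) (Sum.inr j)

/-- The matrix with the given blocks. -/
def blocks {k : ℕ} (A B C D : SqMat k) : SqMat (k + 1) := Matrix.fromBlocks A B C D

lemma eq_blocks {k : ℕ} (A : SqMat (k + 1)) : A = blocks A.b11 A.b12 A.b21 A.b22 :=
  (Matrix.fromBlocks_toBlocks A).symm

lemma blocks_mul {k : ℕ} (A B C D A' B' C' D' : SqMat k) :
    blocks A B C D * blocks A' B' C' D' =
      blocks (A * A' + B * C') (A * B' + B * D') (C * A' + D * C') (C * B' + D * D') :=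
  Matrix.fromBlocks_multiply A B C D A' B' C' D'

lemma blocks_one {k : ℕ} : (blocks 1 0 0 1 : SqMat (k + 1)) = 1 := Matrix.fromBlocks_one

lemma transpose_blocks {k : ℕ} (A B C D : SqMat k) :
    (blocks A B C D).transpose = blocks A.transpose C.transpose B.transpose D.transpose :=
  Matrix.fromBlocks_transpose A B C D

/-- The Schur complement with respect to a generalized inverse `X` of the upper left block. -/
noncomputable def schur {k : ℕ} (G : SqMat (k + 1)) (X : SqMat k) : SqMat k := G.b22 - G.b21 * (X * G.b12)

/-- A symmetric generalized inverse of a Gram matrix. -/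
noncomputable def ginv : ∀ k, SqMat k → SqMat k
  -- The convention `1 / 0 = 0` gives the right generalized inverse of the zero matrix.
  | 0, G => fun i j => 1 / G i j
  | k + 1, G =>
    let A := ginv k G.b11
    let B := ginv k (G.schur A)
    blocks (A + A * G.b12 * B * (G.b21 * A)) (0 - A * G.b12 * B) (0 - B * (G.b21 * A)) B

/-- The indicator of the pivot columns of a matrix, in terms of its Gram matrix. -/
noncomputable def pivots : ∀ k, SqMat k → Idx k → ℚ
  -- With `0 / 0 = 0` this is `1` for a nonzero column and `0` for a zero one, without a test.
  | 0, G => fun i => G i i / G i i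
  | k + 1, G => Sum.elim (pivots k G.b11) (pivots k (G.schur (ginv k G.b11)))

variable {r : Type*} [Fintype r]

/-- The difference `E` of the two sides is killed by `Mᵀ`. Its columns are combinations of those of
`M`, so `EᵀE = 0`, and over `ℚ` this forces `E = 0`. -/
lemma mul_genInv_mul {m : Type*} [Fintype m] (M : Matrix r m ℚ) (X : Matrix m m ℚ)
    (h : M.transpose * M * X * (M.transpose * M) = M.transpose * M) :
    M * X * (M.transpose * M) = M := by
  have h1 : (M * X * (M.transpose * M) - M).transpose * (M * X * (M.transpose * M) - M) = 0 := by
    have h2 : M.transpose * (M * X * (M.transpose * M) - M) = 0 := by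
      rw [Matrix.mul_sub, sub_eq_zero]
      simpa only [Matrix.mul_assoc] using h
    rw [Matrix.transpose_sub, Matrix.sub_mul, h2, sub_zero, Matrix.mul_assoc M X,
      Matrix.transpose_mul M, Matrix.mul_assoc _ M.transpose, ← Matrix.mul_assoc M X, h2,
      Matrix.mul_zero]
  have h4 := Matrix.conjTranspose_mul_self_eq_zero.1
    (show (M * X * (M.transpose * M) - M).conjTranspose * (M * X * (M.transpose * M) - M) = 0 by
      rwa [Matrix.conjTranspose_eq_transpose_of_trivial])
  exact sub_eq_zero.1 h4

/-- The left half of the columns. -/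
def cl {k : ℕ} (M : Matrix r (Idx (k + 1)) ℚ) : Matrix r (Idx k) ℚ := fun i j => M i (Sum.inl j)
/-- The right half of the columns. -/
def cr {k : ℕ} (M : Matrix r (Idx (k + 1)) ℚ) : Matrix r (Idx k) ℚ := fun i j => M i (Sum.inr j)

lemma b11_gram {k : ℕ} (M : Matrix r (Idx (k + 1)) ℚ) :
    b11 (M.transpose * M) = (cl M).transpose * cl M := rfl
lemma b12_gram {k : ℕ} (M : Matrix r (Idx (k + 1)) ℚ) :
    b12 (M.transpose * M) = (cl M).transpose * cr M := rfl
lemma b21_gram {k : ℕ} (M : Matrix r (Idx (k + 1)) ℚ) :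
    b21 (M.transpose * M) = (cr M).transpose * cl M := rfl
lemma b22_gram {k : ℕ} (M : Matrix r (Idx (k + 1)) ℚ) :
    b22 (M.transpose * M) = (cr M).transpose * cr M := rfl

/-- The Schur complement is the Gram matrix of the orthogonal projections of the right columns. -/
lemma schur_gram {k : ℕ} (M : Matrix r (Idx (k + 1)) ℚ) (X : SqMat k) (hX : X.transpose = X)
    (h : (cl M).transpose * cl M * X * ((cl M).transpose * cl M) = (cl M).transpose * cl M) :
    schur (M.transpose * M) X =
      (cr M - cl M * X * ((cl M).transpose * cr M)).transpose *
        (cr M - cl M * X * ((cl M).transpose * cr M)) := by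
  have h1 := mul_genInv_mul (cl M) X h
  have h2 : (cl M).transpose * (cl M * X * (cl M).transpose) = (cl M).transpose := by
    have := congrArg Matrix.transpose h1
    simp only [Matrix.transpose_mul, Matrix.transpose_transpose, hX] at this
    simpa only [Matrix.mul_assoc] using this
  have h3 : (cl M).transpose * (cr M - cl M * X * ((cl M).transpose * cr M)) = 0 := by
    rw [Matrix.mul_sub, sub_eq_zero, ← Matrix.mul_assoc (cl M * X), ← Matrix.mul_assoc, h2]
  rw [Matrix.transpose_sub, Matrix.sub_mul, Matrix.mul_assoc (cl M), Matrix.transpose_mul,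
    Matrix.mul_assoc (X * _).transpose, ← Matrix.mul_assoc (cl M) X, h3, Matrix.mul_zero, sub_zero,
    Matrix.mul_sub, schur, b22_gram, b21_gram, b12_gram]
  simp only [Matrix.mul_assoc]

/-- Block elimination: `G = L diag(G₁₁, S) U` and `ginv G = U⁻¹ diag(A, B) L⁻¹`, so the generalized
inverse property reduces to the diagonal blocks. The factorization needs `G₁₁ A G₁₂ = G₁₂` and its
transpose, which come from `mul_genInv_mul`. The induction closes because `S` is a Gram matrix, by
`schur_gram`. -/
theorem ginv_spec (k : ℕ) (M : Matrix r (Idx k) ℚ) :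
    (ginv k (M.transpose * M)).transpose = ginv k (M.transpose * M) ∧
    M.transpose * M * ginv k (M.transpose * M) * (M.transpose * M) = M.transpose * M := by
  induction k with
  | zero =>
    have hs : ∀ i j : Idx 0, i = j := fun _ _ => rfl
    constructor
    · ext i j; rw [hs i j]; rfl
    · ext i j
      obtain rfl := hs i j
      have hsum : ∀ A B : SqMat 0, (A * B) i i = A i i * B i i := fun A B =>
        Fintype.sum_subsingleton (fun x => A i x * B x i) i
      rw [hsum, hsum _ (ginv 0 _)]
      simp only [ginv]
      by_cases h0 : (M.transpose * M) i i = 0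
      · simp [h0]
      · field_simp
  | succ k ih =>
    obtain ⟨hA1, hA2⟩ := ih (cl M)
    set G : SqMat (k + 1) := M.transpose * M with hG
    have hS := schur_gram M _ hA1 hA2
    obtain ⟨hB1, hB2⟩ := ih (cr M - cl M * ginv k ((cl M).transpose * cl M) *
      ((cl M).transpose * cr M))
    rw [← hS] at hB1 hB2
    have h1 := mul_genInv_mul (cl M) _ hA2
    rw [← b11_gram, ← hG] at hA1 hA2 hB1 hB2 h1
    set A := ginv k G.b11 with hA
    set B := ginv k (G.schur A) with hB
    have hGG : ginv (k + 1) G = blocks (A + A * G.b12 * B * (G.b21 * A)) (0 - A * G.b12 * B)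
      (0 - B * (G.b21 * A)) B := rfl
    have ht : G.b21 = G.b12.transpose := by
      rw [hG, b21_gram, b12_gram, Matrix.transpose_mul, Matrix.transpose_transpose]
    have h12 : G.b11 * A * G.b12 = G.b12 := by
      have := congrArg Matrix.transpose h1
      simp only [Matrix.transpose_mul, hA1] at this
      rw [show G.b12 = (cl M).transpose * cr M from rfl]
      rw [← Matrix.mul_assoc]
      congr 1
      rw [show G.b11.transpose = G.b11 from by
        rw [hG, b11_gram, Matrix.transpose_mul, Matrix.transpose_transpose]] at this
      rw [Matrix.mul_assoc]; exact this
    have h21 : G.b21 * A * G.b11 = G.b21 := by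
      have := congrArg Matrix.transpose h12
      rw [Matrix.transpose_mul, Matrix.transpose_mul, hA1, ← ht,
        show G.b11.transpose = G.b11 from by
        rw [hG, b11_gram, Matrix.transpose_mul, Matrix.transpose_transpose]] at this
      rw [Matrix.mul_assoc]; exact this
    constructor
    · rw [hGG]
      rw [transpose_blocks]
      congr 1
      · simp only [Matrix.transpose_add, Matrix.transpose_mul, ht, Matrix.transpose_transpose, hA1,
          hB1, Matrix.mul_assoc]
      · simp only [Matrix.transpose_sub, Matrix.transpose_mul, ht, Matrix.transpose_transpose, hA1,
          hB1, Matrix.mul_assoc, Matrix.transpose_zero]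
      · simp only [Matrix.transpose_sub, Matrix.transpose_mul, ht, hA1, hB1, Matrix.mul_assoc,
          Matrix.transpose_zero]
    · -- block elimination
      have hL : G = blocks 1 0 (G.b21 * A) 1 * blocks G.b11 0 0 (G.schur A) *
          blocks 1 (A * G.b12) 0 1 := by
        conv_lhs => rw [eq_blocks G]
        rw [blocks_mul, blocks_mul]
        congr 1
        · simp
        · simp [← Matrix.mul_assoc, h12]
        · simp [h21]
        · simp only [schur, Matrix.mul_zero, add_zero, zero_add, Matrix.mul_one,
            Matrix.one_mul, h21]
          abel
      have hI : ginv (k + 1) G = blocks 1 (0 - A * G.b12) 0 1 * blocks A 0 0 B *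
          blocks 1 0 (0 - G.b21 * A) 1 := by
        rw [hGG, blocks_mul, blocks_mul]
        congr 1
        · simp only [Matrix.one_mul, Matrix.mul_one, Matrix.mul_zero, add_zero, zero_add, zero_sub,
            Matrix.neg_mul, Matrix.mul_neg, neg_neg]
        all_goals simp
      have h11 : (blocks 1 (A * G.b12) 0 1 : SqMat (k + 1)) * blocks 1 (0 - A * G.b12) 0 1 = 1 := by
        rw [blocks_mul]
        simp [blocks_one]
      have h22 : (blocks 1 0 (0 - G.b21 * A) 1 : SqMat (k + 1)) * blocks 1 0 (G.b21 * A) 1 = 1 := by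
        rw [blocks_mul]
        simp [blocks_one]
      rw [hI]
      set L := (blocks 1 0 (G.b21 * A) 1 : SqMat (k + 1))
      set U := (blocks 1 (A * G.b12) 0 1 : SqMat (k + 1))
      set L' := (blocks 1 0 (0 - G.b21 * A) 1 : SqMat (k + 1))
      set U' := (blocks 1 (0 - A * G.b12) 0 1 : SqMat (k + 1))
      calc G * (U' * blocks A 0 0 B * L') * G
          = L * blocks G.b11 0 0 (G.schur A) * (U * U') * blocks A 0 0 B * (L' * L) *
            blocks G.b11 0 0 (G.schur A) * U := by
              conv_lhs => rw [hL]
              simp only [Matrix.mul_assoc]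
        _ = L * (blocks G.b11 0 0 (G.schur A) * blocks A 0 0 B *
            blocks G.b11 0 0 (G.schur A)) * U := by
              rw [h11, h22, Matrix.mul_one, Matrix.mul_one]
              simp only [Matrix.mul_assoc]
        _ = G := by
              rw [blocks_mul, blocks_mul]
              simp only [Matrix.zero_mul, Matrix.mul_zero, add_zero, zero_add]
              rw [hA2, hB2, ← hL]

lemma mulVec_succ {r : Type*} {k : ℕ} (M : Matrix r (Idx (k + 1)) ℚ) (v : Idx (k + 1) → ℚ) :
    M.mulVec v = (cl M).mulVec (fun i => v (Sum.inl i)) + (cr M).mulVec (fun i => v (Sum.inr i)) := by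
  ext i
  exact Fintype.sum_sum_type (fun j : Idx k ⊕ Idx k => M i j * v j)

/-- The pivot columns form a basis of the column space: first those of the left half, then those of
the right half after orthogonal projection away from the left columns. The Schur complement is the
Gram matrix of these projections. -/
theorem pivots_spec (k : ℕ) (M : Matrix r (Idx k) ℚ) :
    (∀ i, pivots k (M.transpose * M) i = 0 ∨ pivots k (M.transpose * M) i = 1) ∧
    (∀ v : Idx k → ℚ, M.mulVec (fun i => pivots k (M.transpose * M) i * v i) = 0 →
      ∀ i, pivots k (M.transpose * M) i * v i = 0) ∧
    (∀ v : Idx k → ℚ, ∃ w : Idx k → ℚ,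
      M.mulVec v = M.mulVec (fun i => pivots k (M.transpose * M) i * w i)) := by
  induction k with
  | zero =>
    have hs : ∀ i j : Idx 0, i = j := fun _ _ => rfl
    have hv : ∀ (v : Idx 0 → ℚ) j i, M.mulVec v j = M j i * v i := fun v j i =>
      Fintype.sum_subsingleton (fun x => M j x * v x) i
    by_cases h : M.transpose * M = 0
    · have hM : M = 0 := Matrix.conjTranspose_mul_self_eq_zero.1 (by
        rwa [Matrix.conjTranspose_eq_transpose_of_trivial])
      refine ⟨fun i => Or.inl ?_, fun v _ i => ?_, fun v => ⟨0, ?_⟩⟩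
      · simp [pivots, h]
      · simp [pivots, h]
      · simp [hM]
    · have hp : ∀ i, pivots 0 (M.transpose * M) i = 1 := by
        intro i
        refine div_self fun h0 => h ?_
        ext a b
        rw [hs a i, hs b i, h0]; rfl
      refine ⟨fun i => Or.inr (hp i), fun v hv0 i => ?_, fun v => ⟨v, by simp [hp]⟩⟩
      by_contra hvi
      refine h ?_
      have : M = 0 := by
        ext a b
        have := congrFun hv0 a
        rw [hv _ _ i] at this
        rw [hs b i]
        exact (mul_eq_zero.1 this).resolve_right hvi
      rw [this, Matrix.mul_zero]
  | succ k ih =>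
    obtain ⟨hA1, hA2⟩ := ginv_spec k (cl M)
    have hS := schur_gram M _ hA1 hA2
    have h1 := mul_genInv_mul (cl M) _ hA2
    obtain ⟨z1, i1, s1⟩ := ih (cl M)
    obtain ⟨z2, i2, s2⟩ := ih (cr M - cl M * ginv k ((cl M).transpose * cl M) *
      ((cl M).transpose * cr M))
    rw [← hS] at z2 i2 s2
    set A := ginv k ((cl M).transpose * cl M) with hA
    have hp : pivots (k + 1) (M.transpose * M) = Sum.elim (pivots k ((cl M).transpose * cl M))
      (pivots k (schur (M.transpose * M) A)) := rfl
    rw [hp]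
    set e₁ := pivots k ((cl M).transpose * cl M)
    set e₂ := pivots k (schur (M.transpose * M) A)
    have hproj : ∀ v, (cr M - cl M * A * ((cl M).transpose * cr M)).mulVec v =
        (cr M).mulVec v - (cl M).mulVec (A.mulVec ((cl M).transpose.mulVec ((cr M).mulVec v))) := by
      intro v
      simp only [Matrix.sub_mulVec, Matrix.mulVec_mulVec, Matrix.mul_assoc]
    refine ⟨?_, fun v hv => ?_, fun v => ?_⟩
    · rintro (i | i)
      · exact z1 i
      · exact z2 i
    · rw [mulVec_succ] at hv
      simp only [Sum.elim_inl, Sum.elim_inr] at hv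
      -- Projecting the relation kills its left part, leaving a relation among projected right
      -- pivots.
      have hz2 := i2 (fun i => v (Sum.inr i)) (by
        rw [hproj, eq_neg_of_add_eq_zero_right hv]
        have : (cl M).mulVec (A.mulVec ((cl M).transpose.mulVec ((cl M).mulVec
          (fun i => e₁ i * v (Sum.inl i))))) = (cl M).mulVec (fun i => e₁ i * v (Sum.inl i)) := by
          conv_rhs => rw [← h1]
          simp only [Matrix.mulVec_mulVec, Matrix.mul_assoc]
        rw [Matrix.mulVec_neg, Matrix.mulVec_neg, Matrix.mulVec_neg, this]
        simp)
      have hz1 := i1 (fun i => v (Sum.inl i)) (by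
        have : (fun i => e₂ i * v (Sum.inr i)) = 0 := funext hz2
        rwa [this, Matrix.mulVec_zero, add_zero] at hv)
      rintro (i | i)
      · exact hz1 i
      · exact hz2 i
    · obtain ⟨w₂, hw₂⟩ := s2 (fun i => v (Sum.inr i))
      rw [hproj, hproj] at hw₂
      -- Reducing the right half to its pivots introduces an error in the span of the left columns;
      -- its coefficients are added to the left half before that is reduced too.
      obtain ⟨w₁, hw₁⟩ := s1 ((fun i => v (Sum.inl i)) +
        A.mulVec ((cl M).transpose.mulVec ((cr M).mulVec fun i => v (Sum.inr i))) -
        A.mulVec ((cl M).transpose.mulVec ((cr M).mulVec fun i => e₂ i * w₂ i)))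
      refine ⟨Sum.elim w₁ w₂, ?_⟩
      rw [mulVec_succ, mulVec_succ]
      simp only [Sum.elim_inl, Sum.elim_inr]
      rw [← hw₁, Matrix.mulVec_sub, Matrix.mulVec_add]
      linear_combination hw₂

end SqMat

/-! ### Determinants by block elimination -/

/-- In a Cauchy matrix, a square submatrix has no kernel. -/
lemma cauchy_kernel {J R : Type*} (x : R → ℚ) (y : J → ℚ) (hx : Function.Injective x)
    (hy : Function.Injective y) (hxy : ∀ l j, x l + y j ≠ 0) (s : Finset J) (u : Finset R)
    (hsu : s.card ≤ u.card) (w : J → ℚ) (h : ∀ l ∈ u, ∑ j ∈ s, 1 / (x l + y j) * w j = 0) :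
    ∀ j ∈ s, w j = 0 := by
  classical
  -- This is the numerator of `∑ w j / (X + y j)`: its degree is below `s.card` and it vanishes at
  -- the `u.card` points `x l`.
  let p : Polynomial ℚ :=
    ∑ j ∈ s, Polynomial.C (w j) * ∏ i ∈ s.erase j, (Polynomial.X + Polynomial.C (y i))
  have hp : p = 0 := by
    by_cases hs : s = ∅
    · simp [p, hs]
    refine Polynomial.eq_zero_of_degree_lt_of_eval_finset_eq_zero (u.image x) ?_ ?_
    · rw [Finset.card_image_of_injective _ hx]
      refine lt_of_lt_of_le ?_ (Nat.cast_le.2 hsu)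
      refine (Polynomial.degree_sum_le _ _).trans_lt ?_
      rw [Finset.sup_lt_iff (by exact WithBot.bot_lt_coe _)]
      intro j hj
      refine lt_of_le_of_lt (b := (∏ i ∈ s.erase j,
        (Polynomial.X + Polynomial.C (y i))).degree) ?_ ?_
      · rw [Polynomial.degree_mul]
        exact (add_le_add_left Polynomial.degree_C_le _).trans_eq (zero_add _)
      rw [Polynomial.degree_prod]
      simp only [Polynomial.degree_X_add_C, Finset.sum_const, Finset.card_erase_of_mem hj]
      have : 0 < s.card := Finset.card_pos.2 ⟨j, hj⟩
      rw [nsmul_one]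
      exact_mod_cast Nat.sub_lt this one_pos
    · intro a ha
      obtain ⟨l, hl, rfl⟩ := Finset.mem_image.1 ha
      have h1 : p.eval (x l) = (∏ i ∈ s, (x l + y i)) * ∑ j ∈ s, 1 / (x l + y j) * w j := by
        simp only [p, Polynomial.eval_finsetSum, Polynomial.eval_mul, Polynomial.eval_C,
          Polynomial.eval_prod, Polynomial.eval_add, Polynomial.eval_X, Finset.mul_sum]
        refine Finset.sum_congr rfl fun j hj => ?_
        rw [← Finset.mul_prod_erase s _ hj]
        field_simp [hxy l j]
      rw [h1, h l hl, mul_zero]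
  intro j hj
  -- At the pole `-y j` only the `j`-th summand survives, so `p = 0` gives `w j = 0`.
  have h2 : p.eval (-y j) = w j * ∏ i ∈ s.erase j, (y i - y j) := by
    simp only [p, Polynomial.eval_finsetSum, Polynomial.eval_mul, Polynomial.eval_C,
      Polynomial.eval_prod, Polynomial.eval_add, Polynomial.eval_X]
    rw [Finset.sum_eq_single j]
    · congr 1
      exact Finset.prod_congr rfl fun i _ => by ring
    · intro i hi hij
      refine mul_eq_zero_of_right _ (Finset.prod_eq_zero (i := j) ?_ (by ring))
      exact Finset.mem_erase.2 ⟨hij.symm, hj⟩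
    · exact fun h => absurd hj h
  rw [hp, Polynomial.eval_zero] at h2
  refine (mul_eq_zero.1 h2.symm).resolve_right (Finset.prod_ne_zero_iff.2 fun i hi h0 => ?_)
  exact (Finset.mem_erase.1 hi).1 (hy (sub_eq_zero.1 h0))

namespace SqMat

/-- A numbering of the index set. -/
noncomputable def num {k : ℕ} (i : Idx k) : ℕ := (Fintype.equivFin (Idx k) i).1

lemma num_injective {k : ℕ} : Function.Injective (num (k := k)) := fun _ _ h =>
  (Fintype.equivFin (Idx k)).injective (Fin.ext h)

/-- A matrix all of whose square submatrices are invertible. -/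
noncomputable def cauchy (k : ℕ) : SqMat k := fun i j => 1 / (((num i : ℚ) + 1) + num j)

/-- Pairs the non-pivot columns of the left block with the pivot columns of the right block. -/
noncomputable def pairing (k : ℕ) (e : Idx (k + 1) → ℚ) : SqMat k := fun l j =>
  e (Sum.inr l) * (cauchy k l j * (1 - e (Sum.inl j)))

/-- A Gram matrix for the upper half of the rows. -/
noncomputable def topGram {k : ℕ} (A : SqMat (k + 1)) : SqMat (k + 1) :=
  blocks (A.b11.transpose * A.b11) (A.b11.transpose * A.b12) (A.b12.transpose * A.b11)
    (A.b12.transpose * A.b12)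

/-- The column operations that make the upper left block invertible. -/
noncomputable def mix {k : ℕ} (A : SqMat (k + 1)) : SqMat k :=
  pairing k (pivots (k + 1) (topGram A))

/-- The inverse of an invertible matrix. -/
noncomputable def gramInv {k : ℕ} (A : SqMat k) : SqMat k :=
  ginv k (A.transpose * A) * A.transpose

lemma gramInv_mul {k : ℕ} (A : SqMat k) (h : IsUnit A.det) : gramInv A * A = 1 := by
  have h1 := mul_genInv_mul A _ (ginv_spec k A).2
  rw [gramInv, Matrix.mul_assoc]
  have h2 : A⁻¹ * A = 1 := Matrix.nonsing_inv_mul A h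
  calc ginv k (A.transpose * A) * (A.transpose * A)
      = A⁻¹ * A * (ginv k (A.transpose * A) * (A.transpose * A)) := by rw [h2, Matrix.one_mul]
    _ = A⁻¹ * (A * ginv k (A.transpose * A) * (A.transpose * A)) := by
        simp only [Matrix.mul_assoc]
    _ = 1 := by rw [h1, h2]

/-- The upper rows have `2 ^ k` pivot columns, so the left half has no more non-pivots than the
right half has pivots. `mix` adds to each left non-pivot column a Cauchy combination of the right
pivot columns. For a kernel vector `v`, rewrite `A₁₁ v` in terms of left pivots; independence of the
pivots makes the Cauchy combinations vanish, so `v` is zero at the non-pivots by `cauchy_kernel`.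
Then `A₁₁ v = 0` with `v` supported on pivots, hence `v = 0`. -/
lemma det_ne_zero_of_top_surjective {k : ℕ} (A : SqMat (k + 1))
    (h : ∀ u : Idx k → ℚ, ∃ v₁ v₂ : Idx k → ℚ, A.b11.mulVec v₁ + A.b12.mulVec v₂ = u) :
    (A.b11 + A.b12 * mix A).det ≠ 0 := by
  classical
  let M : Matrix (Idx k) (Idx (k + 1)) ℚ := fun i j => A (Sum.inl i) j
  have hG : topGram A = M.transpose * M := (eq_blocks (M.transpose * M)).symm
  obtain ⟨z, indep, span⟩ := pivots_spec (k + 1) M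
  obtain ⟨z₁, indep₁, span₁⟩ := pivots_spec k A.b11
  rw [← hG] at z indep span
  set e := pivots (k + 1) (topGram A) with he
  have he₁ : ∀ i, e (Sum.inl i) = pivots k (A.b11.transpose * A.b11) i := fun i => rfl
  have hM : ∀ v : Idx (k + 1) → ℚ, M.mulVec v =
      A.b11.mulVec (fun i => v (Sum.inl i)) + A.b12.mulVec (fun i => v (Sum.inr i)) :=
    mulVec_succ M
  -- there are enough pivots
  let J : Finset (Idx (k + 1)) := Finset.univ.filter fun i => e i = 1
  have hJmem : ∀ i, i ∈ J ↔ e i = 1 := fun i => by simp [J]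
  have hJ : 2 ^ k ≤ J.card := by
    let φ : (J → ℚ) →ₗ[ℚ] (Idx k → ℚ) :=
      M.mulVecLin ∘ₗ Function.ExtendByZero.linearMap ℚ (Subtype.val : J → Idx (k + 1))
    have hφ : Function.Surjective φ := by
      intro u
      obtain ⟨v₁, v₂, hv⟩ := h u
      obtain ⟨w, hw⟩ := span (Sum.elim v₁ v₂)
      refine ⟨fun i => w i, ?_⟩
      rw [← hv]
      have h1 := hM (Sum.elim v₁ v₂)
      simp only [Sum.elim_inl, Sum.elim_inr] at h1
      rw [← h1, hw]
      change M.mulVec _ = _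
      congr 1
      funext i
      by_cases hi : e i = 1
      · have : i = ((⟨i, by simp [J, hi]⟩ : J) : Idx (k + 1)) := rfl
        rw [hi, one_mul]
        conv_lhs => rw [this]
        rw [Function.ExtendByZero.linearMap_apply]
        exact Subtype.val_injective.extend_apply _ _ _
      · rw [(z i).resolve_right hi, zero_mul]
        rw [Function.ExtendByZero.linearMap_apply]
        refine Function.extend_apply' _ _ _ ?_
        rintro ⟨j, rfl⟩
        exact hi (Finset.mem_filter.1 j.2).2
    have := LinearMap.finrank_le_finrank_of_surjective (f := φ) hφ
    simpa [Idx.card] using this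
  let s : Finset (Idx k) := Finset.univ.filter fun j => ¬ e (Sum.inl j) = 1
  let u : Finset (Idx k) := Finset.univ.filter fun l => e (Sum.inr l) = 1
  have hsu : s.card ≤ u.card := by
    have h1 : J.card = (Finset.univ.filter fun j : Idx k => e (Sum.inl j) = 1).card + u.card := by
      have h2 : J = (Finset.univ.filter fun j : Idx k => e (Sum.inl j) = 1).disjSum u := by
        refine Finset.ext fun i => ?_
        rcases i with i | i
        · exact (hJmem (Sum.inl i)).trans
            (Finset.inl_mem_disjSum.trans (by simp)).symm
        · exact (hJmem (Sum.inr i)).trans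
            (Finset.inr_mem_disjSum.trans (by simp [u])).symm
      exact (congrArg Finset.card h2).trans (Finset.card_disjSum _ _)
    have h2 := Finset.card_filter_add_card_filter_not (s := (Finset.univ : Finset (Idx k)))
      (fun j => e (Sum.inl j) = 1)
    rw [Finset.card_univ, Idx.card] at h2
    have : s.card = (Finset.univ.filter fun j : Idx k => ¬ e (Sum.inl j) = 1).card := rfl
    omega
  intro hdet
  obtain ⟨v, hv0, hv⟩ := Matrix.exists_mulVec_eq_zero_iff.2 hdet
  apply hv0
  obtain ⟨w, hw⟩ := span₁ v
  let c : Idx k → ℚ := fun l => ∑ j, cauchy k l j * (1 - e (Sum.inl j)) * v j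
  have hY : (mix A).mulVec v = fun l => e (Sum.inr l) * c l := by
    funext l
    simp only [mix, pairing, Matrix.mulVec, dotProduct, c, Finset.mul_sum]
    exact Finset.sum_congr rfl fun j _ => by ring
  rw [Matrix.add_mulVec, ← Matrix.mulVec_mulVec, hY, hw] at hv
  have h0 := indep (Sum.elim w c) (by rw [hM]; exact hv)
  have hz : ∀ l ∈ u, ∑ j ∈ s, 1 / (((num l : ℚ) + 1) + num j) * v j = 0 := by
    intro l hl
    have h1 := h0 (Sum.inr l)
    rw [show e (Sum.inr l) = 1 by simpa [u] using hl, one_mul] at h1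
    rw [← h1, Sum.elim_inr]
    simp only [c, s, Finset.sum_filter, cauchy]
    refine Finset.sum_congr rfl fun j _ => ?_
    rcases z (Sum.inl j) with hj | hj <;> simp [hj]
  have hs := cauchy_kernel (fun l : Idx k => (num l : ℚ) + 1) (fun j : Idx k => (num j : ℚ))
    (fun a b hab => num_injective (by simpa using hab))
    (fun a b hab => num_injective (by simpa using hab))
    (fun a b => by positivity) s u hsu v hz
  have hv' : v = fun i => pivots k (A.b11.transpose * A.b11) i * v i := by
    funext i
    rw [← he₁]
    by_cases hi : e (Sum.inl i) = 1
    · rw [hi, one_mul]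
    · rw [hs i (by simp [s, hi]), mul_zero]
  have h2 : A.b11.mulVec (fun i => pivots k (A.b11.transpose * A.b11) i * v i) = 0 := by
    rw [← hv', hw]
    have : (fun i => pivots k (A.b11.transpose * A.b11) i * w i) = 0 :=
      funext fun i => h0 (Sum.inl i)
    rw [this, Matrix.mulVec_zero]
  rw [hv']
  exact funext (indep₁ v h2)

/-- If the modified upper left block is invertible, this is a column operation of determinant one
followed by a Schur complement. If it is singular, so is `A` by the previous lemma, and both sides
are zero; hence the program needs no case distinction. -/
theorem det_succ {k : ℕ} (A : SqMat (k + 1)) :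
    A.det = (A.b11 + A.b12 * mix A).det *
      (A.b22 - (A.b21 + A.b22 * mix A) * (gramInv (A.b11 + A.b12 * mix A) * A.b12)).det := by
  classical
  set E := A.b11 + A.b12 * mix A with hE
  by_cases h : E.det = 0
  · rw [h, zero_mul]
    by_contra hA
    refine det_ne_zero_of_top_surjective A (fun u => ?_) h
    have hA' : IsUnit A := (Matrix.isUnit_iff_isUnit_det A).2 (isUnit_iff_ne_zero.2 hA)
    obtain ⟨v, hv⟩ := (Matrix.mulVec_surjective_iff_isUnit.2 hA') (Sum.elim u 0)
    refine ⟨fun i => v (Sum.inl i), fun i => v (Sum.inr i), ?_⟩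
    have h1 := mulVec_succ A v
    funext i
    have h2 := congrFun h1 (Sum.inl i)
    rw [hv] at h2
    exact h2.symm
  · have hu : IsUnit E.det := isUnit_iff_ne_zero.2 h
    have h1 : A * blocks 1 0 (mix A) 1 = blocks E A.b12 (A.b21 + A.b22 * mix A) A.b22 := by
      have h2 := blocks_mul A.b11 A.b12 A.b21 A.b22 1 0 (mix A) 1
      rw [← eq_blocks] at h2
      rw [h2]
      congr 1 <;> simp [hE]
    have h2 : (blocks 1 0 (mix A) 1 : SqMat (k + 1)).det = 1 := by
      refine (Matrix.det_fromBlocks_zero₁₂ (1 : SqMat k) (mix A) 1).trans ?_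
      simp
    have h3 := congrArg Matrix.det h1
    rw [Matrix.det_mul, h2, mul_one] at h3
    rw [h3]
    let _ : Invertible E := Matrix.invertibleOfIsUnitDet E hu
    refine (Matrix.det_fromBlocks₁₁ E A.b12 (A.b21 + A.b22 * mix A) A.b22).trans ?_
    congr 2
    rw [Matrix.mul_assoc, Matrix.invOf_eq_nonsing_inv,
      ← Matrix.inv_eq_left_inv (gramInv_mul E hu)]

end SqMat

/-! ### Programs for matrices -/

/-- The set of entries of a matrix of functions. -/
def entries {Ω m n : Type} (A : Ω → Matrix m n ℚ) : Set (Ω → ℚ) :=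
  Set.range fun x : m × n => fun ω => A ω x.1 x.2

/-- All entries of `A` belong to `K`. -/
def Known {Ω m n : Type} (K : Set (Ω → ℚ)) (A : Ω → Matrix m n ℚ) : Prop :=
  ∀ i j, (fun ω => A ω i j) ∈ K

section

variable {Ω m n p : Type} {K K₁ T : Set (Ω → ℚ)} {c c₁ c₂ : ℝ}

lemma Known.mono {A : Ω → Matrix m n ℚ} (h : Known K A) (hK : K ⊆ K₁) : Known K₁ A :=
  fun i j => hK (h i j)

lemma known_entries (A : Ω → Matrix m n ℚ) : Known (entries A) A := fun i j => ⟨(i, j), rfl⟩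

lemma Known.subset {A : Ω → Matrix m n ℚ} (h : Known K A) : entries A ⊆ K := by
  rintro _ ⟨x, rfl⟩; exact h x.1 x.2

lemma Known.transpose {A : Ω → Matrix m n ℚ} (h : Known K A) :
    Known K fun ω => (A ω).transpose := fun i j => h j i

/-- Computes a matrix and continues. -/
lemma Reach.bindMat {A : Ω → Matrix m n ℚ} (h : Reach K (entries A) c₁)
    (h' : ∀ K', K ⊆ K' → Known K' A → Reach K' T c₂) : Reach K T (c₁ + c₂) :=
  h.bind (h' _ Set.subset_union_left ((known_entries A).mono Set.subset_union_right))

lemma Reach.matrix [Fintype m] [Fintype n] {A : Ω → Matrix m n ℚ}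
    (h : ∀ i j, Reach K {fun ω => A ω i j} c) :
    Reach K (entries A) (Fintype.card m * Fintype.card n * c) := by
  have := Reach.range (fun x : m × n => fun ω => A ω x.1 x.2) c fun x => h x.1 x.2
  rw [Fintype.card_prod] at this
  exact_mod_cast this

lemma Known.reach {A : Ω → Matrix m n ℚ} (h : Known K A) (i : m) (j : n) :
    Reach K {fun ω => A ω i j} 0 := Reach.of_mem (h i j)

end

/-- `m × m` matrices can be multiplied with at most `c` operations. -/
def MulCost (m : Type) [Fintype m] (c : ℝ) : Prop :=
  ∀ (Ω : Type) (K : Set (Ω → ℚ)) (A B : Ω → Matrix m m ℚ), Known K A → Known K B →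
    Reach K (entries fun ω => A ω * B ω) c

lemma mulCost_fin {m : ℕ} {c : ℝ}
    (P : CompTree ((Fin m × Fin m) ⊕ (Fin m × Fin m)) (Fin m × Fin m)) (hc : (P.cost : ℝ) ≤ c)
    (hP : ∀ A B : Matrix (Fin m) (Fin m) ℚ,
      P.run (Sum.elim (fun x => A x.1 x.2) (fun x => B x.1 x.2)) = fun x => (A * B) x.1 x.2) :
    MulCost (Fin m) c := by
  intro Ω K A B hA hB
  refine (Reach.call P (Sum.elim (fun x ω => A ω x.1 x.2) (fun x ω => B ω x.1 x.2))
    (fun x ω => (A ω * B ω) x.1 x.2) ?_ fun ω => ?_).le hc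
  · rintro (x | x)
    · exact hA _ _
    · exact hB _ _
  · rw [← hP]
    congr 1
    funext x
    rcases x with x | x <;> rfl

lemma MulCost.equiv {m m' : Type} [Fintype m] [Fintype m'] {c : ℝ} (h : MulCost m c)
    (e : m' ≃ m) : MulCost m' c := by
  intro Ω K A B hA hB
  refine (h Ω K (fun ω => (A ω).submatrix e.symm e.symm) (fun ω => (B ω).submatrix e.symm e.symm)
    (fun i j => hA _ _) (fun i j => hB _ _)).mono subset_rfl ?_
  rintro _ ⟨x, rfl⟩
  refine ⟨(e x.1, e x.2), ?_⟩
  funext ω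
  simp [Matrix.submatrix_mul_equiv]

/-! ### Cost of the block recursions. -/

namespace SqMat

variable {Ω : Type} {K : Set (Ω → ℚ)} {k : ℕ}

lemma known_b11 {A : Ω → SqMat (k + 1)} (h : Known K A) : Known K fun ω => (A ω).b11 :=
  fun _ _ => h _ _
lemma known_b12 {A : Ω → SqMat (k + 1)} (h : Known K A) : Known K fun ω => (A ω).b12 :=
  fun _ _ => h _ _
lemma known_b21 {A : Ω → SqMat (k + 1)} (h : Known K A) : Known K fun ω => (A ω).b21 :=
  fun _ _ => h _ _
lemma known_b22 {A : Ω → SqMat (k + 1)} (h : Known K A) : Known K fun ω => (A ω).b22 :=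
  fun _ _ => h _ _

lemma known_blocks {A B C D : Ω → SqMat k} (hA : Known K A) (hB : Known K B) (hC : Known K C)
    (hD : Known K D) : Known K fun ω => blocks (A ω) (B ω) (C ω) (D ω) := by
  rintro (i | i) (j | j)
  · exact hA i j
  · exact hB i j
  · exact hC i j
  · exact hD i j

variable {q μ : ℝ}

lemma four_pow_le (hq : 4 ≤ q) (k : ℕ) : (4 : ℝ) ^ k ≤ q ^ k :=
  pow_le_pow_left₀ (by norm_num) hq k

/-- There are `4 ^ k` entries. In the application `q = 2 ^ ω`, so `4 ≤ q` expresses `2 ≤ ω` and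
entrywise work is never dominant. -/
lemma reach_entrywise (hq : 4 ≤ q) {A : Ω → SqMat k} {c : ℝ} (hc : 0 ≤ c)
    (h : ∀ i j, Reach K {fun ω => A ω i j} c) : Reach K (entries A) (c * q ^ k) := by
  refine (Reach.matrix h).le ?_
  rw [Idx.card]
  have h1 := four_pow_le hq k
  have h2 : ((2 ^ k : ℕ) : ℝ) * ((2 ^ k : ℕ) : ℝ) = 4 ^ k := by
    push_cast; rw [← mul_pow]; norm_num
  rw [h2, mul_comm]
  exact mul_le_mul_of_nonneg_left h1 hc

lemma reach_add (hq : 4 ≤ q) {A B : Ω → SqMat k} (hA : Known K A) (hB : Known K B) :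
    Reach K (entries fun ω => A ω + B ω) (q ^ k) := by
  have := reach_entrywise (K := K) (A := fun ω => A ω + B ω) hq zero_le_one fun i j =>
    ((hA.reach i j).add (hB.reach i j)).le (by simp)
  rwa [one_mul] at this

lemma reach_sub (hq : 4 ≤ q) {A B : Ω → SqMat k} (hA : Known K A) (hB : Known K B) :
    Reach K (entries fun ω => A ω - B ω) (q ^ k) := by
  have := reach_entrywise (K := K) (A := fun ω => A ω - B ω) hq zero_le_one fun i j =>
    ((hA.reach i j).sub (hB.reach i j)).le (by simp)
  rwa [one_mul] at this

lemma reach_neg (hq : 4 ≤ q) {A : Ω → SqMat k} (hA : Known K A) :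
    Reach K (entries fun ω => 0 - A ω) (q ^ k) := by
  have := reach_entrywise (K := K) (A := fun ω => 0 - A ω) hq zero_le_one fun i j =>
    ((Reach.const 0).sub (hA.reach i j)).le (by simp)
  rwa [one_mul] at this

lemma reach_schur (hq : 4 ≤ q) (hmul : ∀ k, MulCost (Idx k) (μ * q ^ k))
    {G : Ω → SqMat (k + 1)} {X : Ω → SqMat k} (hG : Known K G) (hX : Known K X) :
    Reach K (entries fun ω => (G ω).schur (X ω)) ((2 * μ + 1) * q ^ k) := by
  refine Reach.le (Reach.bindMat (hmul k Ω K X _ hX (known_b12 hG)) fun K₁ h₁ k₁ =>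
    Reach.bindMat (hmul k Ω K₁ _ _ (known_b21 (hG.mono h₁)) k₁) fun K₂ h₂ k₂ =>
    reach_sub hq (known_b22 (hG.mono (h₁.trans h₂))) k₂) (le_of_eq (by ring))

/-- Two recursive calls, seven products and four entrywise operations cost `(15 μ + 10) q ^ k`,
which is at most `4 (4 μ + 3) q ^ k`. -/
theorem reach_ginv (hq : 4 ≤ q) (hμ : 0 ≤ μ) (hmul : ∀ k, MulCost (Idx k) (μ * q ^ k)) (k : ℕ) :
    ∀ (Ω : Type) (K : Set (Ω → ℚ)) (G : Ω → SqMat k), Known K G →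
      Reach K (entries fun ω => ginv k (G ω)) ((4 * μ + 3) * q ^ k) := by
  induction k with
  | zero =>
    intro Ω K G hG
    refine reach_entrywise hq (by positivity) fun i j => ?_
    exact ((Reach.const 1).div (hG.reach i j)).le (by linarith)
  | succ k ih =>
    intro Ω K G hG
    have hqk : 0 ≤ q ^ k := by positivity
    refine Reach.le (c₁ := (4 * μ + 3) * q ^ k + ((2 * μ + 1) * q ^ k + ((4 * μ + 3) * q ^ k +
      (μ * q ^ k + (μ * q ^ k + (μ * q ^ k + (μ * q ^ k + (μ * q ^ k + (q ^ k + (q ^ k +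
        (q ^ k + 0))))))))))) ?_ ?_
    · refine Reach.bindMat (ih Ω K _ (known_b11 hG)) fun K₁ h₁ kA => ?_
      have hG₁ := hG.mono h₁
      refine Reach.bindMat (reach_schur hq hmul hG₁ kA) fun K₂ h₂ kS => ?_
      have kA₂ := kA.mono h₂
      have hG₂ := hG₁.mono h₂
      refine Reach.bindMat (ih Ω K₂ _ kS) fun K₃ h₃ kB => ?_
      have kA₃ := kA₂.mono h₃
      have hG₃ := hG₂.mono h₃
      refine Reach.bindMat (hmul k Ω K₃ _ _ kA₃ (known_b12 hG₃)) fun K₄ h₄ kU => ?_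
      have kA₄ := kA₃.mono h₄
      have kB₄ := kB.mono h₄
      have hG₄ := hG₃.mono h₄
      refine Reach.bindMat (hmul k Ω K₄ _ _ kU kB₄) fun K₅ h₅ kUB => ?_
      have kA₅ := kA₄.mono h₅
      have kB₅ := kB₄.mono h₅
      have hG₅ := hG₄.mono h₅
      refine Reach.bindMat (hmul k Ω K₅ _ _ (known_b21 hG₅) kA₅) fun K₆ h₆ kV => ?_
      refine Reach.bindMat (hmul k Ω K₆ _ _ (kUB.mono h₆) kV) fun K₇ h₇ kUBV => ?_
      refine Reach.bindMat (hmul k Ω K₇ _ _ (kB₅.mono (h₆.trans h₇)) (kV.mono h₇))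
        fun K₈ h₈ kBV => ?_
      refine Reach.bindMat (reach_add hq (kA₅.mono (h₆.trans (h₇.trans h₈))) (kUBV.mono h₈))
        fun K₉ h₉ k11 => ?_
      refine Reach.bindMat (reach_neg hq (kUB.mono (h₆.trans (h₇.trans (h₈.trans h₉)))))
        fun K₁₀ h₁₀ k12 => ?_
      refine Reach.bindMat (reach_neg hq (kBV.mono (h₉.trans h₁₀))) fun K₁₁ h₁₁ k21 => ?_
      exact Reach.of_subset (known_blocks (k11.mono (h₁₀.trans h₁₁)) (k12.mono h₁₁) k21
        (kB₅.mono (h₆.trans (h₇.trans (h₈.trans (h₉.trans (h₁₀.trans h₁₁))))))).subset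
    · rw [pow_succ]
      nlinarith [mul_nonneg (mul_nonneg hμ hqk) (sub_nonneg.2 hq),
        mul_nonneg hqk (sub_nonneg.2 hq), mul_nonneg hμ hqk]

/-- One generalized inverse, one Schur complement and two recursive calls cost `(12 μ + 8) q ^ k = 4
(3 μ + 2) q ^ k`. -/
theorem reach_pivots (hq : 4 ≤ q) (hμ : 0 ≤ μ) (hmul : ∀ k, MulCost (Idx k) (μ * q ^ k)) (k : ℕ) :
    ∀ (Ω : Type) (K : Set (Ω → ℚ)) (G : Ω → SqMat k), Known K G →
      Reach K (Set.range fun i ω => pivots k (G ω) i) ((3 * μ + 2) * q ^ k) := by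
  induction k with
  | zero =>
    intro Ω K G hG
    refine (Reach.range _ 1 fun i => ?_).le (?_ : _ ≤ (3 * μ + 2) * q ^ 0)
    · exact ((hG.reach i i).div (hG.reach i i)).le (by linarith)
    · rw [Idx.card]; simp; linarith
  | succ k ih =>
    intro Ω K G hG
    have hqk : 0 ≤ q ^ k := by positivity
    refine Reach.le (c₁ := (4 * μ + 3) * q ^ k + ((2 * μ + 1) * q ^ k + ((3 * μ + 2) * q ^ k +
      (3 * μ + 2) * q ^ k))) ?_ ?_
    · refine Reach.bindMat (reach_ginv hq hμ hmul k Ω K _ (known_b11 hG)) fun K₁ h₁ kA => ?_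
      have hG₁ := hG.mono h₁
      refine Reach.bindMat (reach_schur hq hmul hG₁ kA) fun K₂ h₂ kS => ?_
      refine ((ih Ω K₂ _ (known_b11 (hG₁.mono h₂))).union (ih Ω K₂ _ kS)).mono subset_rfl ?_
      rintro _ ⟨i | i, rfl⟩
      · exact Or.inl ⟨i, rfl⟩
      · exact Or.inr ⟨i, rfl⟩
    · rw [pow_succ]
      nlinarith [mul_nonneg (mul_nonneg hμ hqk) (sub_nonneg.2 hq),
        mul_nonneg hqk (sub_nonneg.2 hq), mul_nonneg hμ hqk]

lemma reach_pairing (hq : 4 ≤ q) {e : Ω → Idx (k + 1) → ℚ} (he : ∀ i, (fun ω => e ω i) ∈ K) :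
    Reach K (entries fun ω => pairing k (e ω)) (3 * q ^ k) := by
  refine reach_entrywise hq (by norm_num) fun l j => ?_
  exact ((Reach.of_mem (he _)).mul ((Reach.const (cauchy k l j)).mul
    ((Reach.const 1).sub (Reach.of_mem (he _))))).le (by norm_num)

/-- The pivots are those of a matrix with `2 ^ (k + 1)` columns; `q ≤ 8` converts their cost to a
multiple of `q ^ k`. -/
lemma reach_mix (hq : 4 ≤ q) (hq8 : q ≤ 8) (hμ : 0 ≤ μ)
    (hmul : ∀ k, MulCost (Idx k) (μ * q ^ k)) {A : Ω → SqMat (k + 1)} (hA : Known K A) :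
    Reach K (entries fun ω => mix (A ω)) ((28 * μ + 19) * q ^ k) := by
  have hqk : 0 ≤ q ^ k := by positivity
  refine Reach.le (c₁ := μ * q ^ k + (μ * q ^ k + (μ * q ^ k + (μ * q ^ k +
    ((3 * μ + 2) * q ^ (k + 1) + 3 * q ^ k))))) ?_ ?_
  · refine Reach.bindMat (hmul k Ω K _ _ (known_b11 hA).transpose (known_b11 hA))
      fun K₁ h₁ k11 => ?_
    have hA₁ := hA.mono h₁
    refine Reach.bindMat (hmul k Ω K₁ _ _ (known_b11 hA₁).transpose (known_b12 hA₁))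
      fun K₂ h₂ k12 => ?_
    have hA₂ := hA₁.mono h₂
    refine Reach.bindMat (hmul k Ω K₂ _ _ (known_b12 hA₂).transpose (known_b11 hA₂))
      fun K₃ h₃ k21 => ?_
    have hA₃ := hA₂.mono h₃
    refine Reach.bindMat (hmul k Ω K₃ _ _ (known_b12 hA₃).transpose (known_b12 hA₃))
      fun K₄ h₄ k22 => ?_
    have hG := known_blocks (k11.mono (h₂.trans (h₃.trans h₄))) (k12.mono (h₃.trans h₄))
      (k21.mono h₄) k22
    refine (reach_pivots hq hμ hmul (k + 1) Ω K₄ _ hG).bind ?_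
    exact reach_pairing hq fun i => Or.inr ⟨i, rfl⟩
  · rw [pow_succ]
    nlinarith [mul_nonneg (mul_nonneg hμ hqk) (sub_nonneg.2 hq8),
      mul_nonneg hqk (sub_nonneg.2 hq8), mul_nonneg hμ hqk]

lemma reach_gramInv (hq : 4 ≤ q) (hμ : 0 ≤ μ)
    (hmul : ∀ k, MulCost (Idx k) (μ * q ^ k)) {A : Ω → SqMat k} (hA : Known K A) :
    Reach K (entries fun ω => gramInv (A ω)) ((6 * μ + 3) * q ^ k) := by
  refine Reach.le (Reach.bindMat (hmul k Ω K _ _ hA.transpose hA) fun K₁ h₁ k₁ =>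
    Reach.bindMat (reach_ginv hq hμ hmul k Ω K₁ _ k₁) fun K₂ h₂ k₂ =>
    hmul k Ω K₂ _ _ k₂ (hA.transpose.mono (h₁.trans h₂))) (le_of_eq (by ring))

/-- One step costs `(76 μ + 51) q ^ k + 1`, including both recursive calls, and this is at most `4
(19 μ + 13) q ^ k`. -/
theorem reach_det (hq : 4 ≤ q) (hq8 : q ≤ 8) (hμ : 0 ≤ μ)
    (hmul : ∀ k, MulCost (Idx k) (μ * q ^ k)) (k : ℕ) :
    ∀ (Ω : Type) (K : Set (Ω → ℚ)) (A : Ω → SqMat k), Known K A →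
      Reach K {fun ω => (A ω).det} ((19 * μ + 13) * q ^ k) := by
  induction k with
  | zero =>
    intro Ω K A hA
    have : (fun ω => (A ω).det) = fun ω => A ω () () := by
      funext ω
      exact Matrix.det_eq_elem_of_subsingleton (A ω) ()
    rw [this]
    exact (hA.reach _ _).le (by positivity)
  | succ k ih =>
    intro Ω K A hA
    have hqk : 1 ≤ q ^ k := one_le_pow₀ (by linarith)
    simp only [det_succ]
    refine Reach.le (c₁ := (28 * μ + 19) * q ^ k + (μ * q ^ k + (q ^ k + (μ * q ^ k + (q ^ k +
      ((6 * μ + 3) * q ^ k + (μ * q ^ k + (μ * q ^ k + (q ^ k +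
        ((19 * μ + 13) * q ^ k + (19 * μ + 13) * q ^ k + 1)))))))))) ?_ ?_
    · refine Reach.bindMat (reach_mix hq hq8 hμ hmul hA) fun K₁ h₁ kY => ?_
      have hA₁ := hA.mono h₁
      refine Reach.bindMat (hmul k Ω K₁ _ _ (known_b12 hA₁) kY) fun K₂ h₂ k₂ => ?_
      have hA₂ := hA₁.mono h₂
      have kY₂ := kY.mono h₂
      refine Reach.bindMat (reach_add hq (known_b11 hA₂) k₂) fun K₃ h₃ kE => ?_
      have hA₃ := hA₂.mono h₃
      refine Reach.bindMat (hmul k Ω K₃ _ _ (known_b22 hA₃) (kY₂.mono h₃)) fun K₄ h₄ k₄ => ?_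
      have hA₄ := hA₃.mono h₄
      refine Reach.bindMat (reach_add hq (known_b21 hA₄) k₄) fun K₅ h₅ kF => ?_
      have hA₅ := hA₄.mono h₅
      refine Reach.bindMat (reach_gramInv hq hμ hmul (kE.mono (h₄.trans h₅)))
        fun K₆ h₆ kI => ?_
      have hA₆ := hA₅.mono h₆
      refine Reach.bindMat (hmul k Ω K₆ _ _ kI (known_b12 hA₆)) fun K₇ h₇ k₇ => ?_
      have hA₇ := hA₆.mono h₇
      refine Reach.bindMat (hmul k Ω K₇ _ _ (kF.mono (h₆.trans h₇)) k₇) fun K₈ h₈ k₈ => ?_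
      refine Reach.bindMat (reach_sub hq (known_b22 (hA₇.mono h₈)) k₈) fun K₉ h₉ k₉ => ?_
      exact (ih Ω K₉ _ (kE.mono (h₄.trans (h₅.trans (h₆.trans (h₇.trans (h₈.trans h₉))))))).mul
        (ih Ω K₉ _ k₉)
    · rw [pow_succ]
      have hqk' : 0 ≤ q ^ k := by linarith
      nlinarith [mul_nonneg (mul_nonneg hμ hqk') (sub_nonneg.2 hq),
        mul_nonneg hqk' (sub_nonneg.2 hq), mul_nonneg hμ hqk']

end SqMat

/-! ### Evaluation and interpolation on a simplex of grid points -/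

noncomputable instance Mon.instFintype (t D : ℕ) : Fintype (Mon t D) :=
  (Finsupp.finite_of_degree_le D).fintype

/-- A slack variable turns degree at most `D` in `t` variables into degree exactly `D` in `t + 1`
variables. -/
lemma card_mon (t D : ℕ) : Fintype.card (Mon t D) = (t + D).choose t := by
  classical
  have e : Mon t D ≃ {x // x ∈ (Finset.univ : Finset (Option (Fin t))).finsuppAntidiag D} :=
    { toFun := fun a => ⟨a.1.optionElim (D - a.1.degree), by
        rw [Finset.mem_finsuppAntidiag]
        refine ⟨?_, Finset.subset_univ _⟩
        rw [Fintype.sum_option]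
        simp only [Finsupp.optionElim_apply_none, Finsupp.optionElim_apply_some]
        rw [← Finsupp.degree_eq_sum]
        have := a.2
        omega⟩
      invFun := fun x => ⟨x.1.some, by
        have := (Finset.mem_finsuppAntidiag.1 x.2).1
        rw [Fintype.sum_option] at this
        rw [Finsupp.degree_eq_sum]
        simp only [Finsupp.some_apply]
        omega⟩
      left_inv := fun a => by ext i; simp
      right_inv := fun x => by
        ext i
        have := (Finset.mem_finsuppAntidiag.1 x.2).1
        rw [Fintype.sum_option] at this
        cases i with
        | none =>
          simp only [Finsupp.optionElim_apply_none, Finsupp.degree_eq_sum, Finsupp.some_apply]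
          omega
        | some i => simp }
  rw [Fintype.card_congr e, Fintype.card_coe, Finset.card_finsuppAntidiag_nat_eq_choose,
    Finset.card_univ, Fintype.card_option, Fintype.card_fin]
  rw [show t + 1 + D - 1 = t + D by omega]
  exact (Nat.choose_symm_add (a := t) (b := D)).symm

section Grid

variable {t D : ℕ}

/-- Applies the matrix `Y` in the directions from `Z` and `X` in the other ones. -/
noncomputable def mixed (X Y : ℕ → ℕ → ℚ) (c : Mon t D → ℚ) (Z : Finset (Fin t))
    (a : Fin t → ℕ) : ℚ :=
  ∑ m : Mon t D, c m * ∏ i, if i ∈ Z then Y (a i) (m.1 i) else X (a i) (m.1 i)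

lemma degree_update (a : Fin t →₀ ℕ) (i : Fin t) (j : ℕ) :
    (a.update i j).degree + a i = a.degree + j := by
  rw [Finsupp.degree_eq_sum, Finsupp.degree_eq_sum, Finsupp.coe_update,
    Finset.sum_update_of_mem (Finset.mem_univ i), ← Finset.add_sum_erase _ a (Finset.mem_univ i),
    Finset.sdiff_singleton_eq_erase]
  omega

/-- Since `Y = M X` on the range in question, one direction is changed by applying `M` in that
variable. Terms whose index leaves the simplex may be dropped: there `j > a i`, so a lower
triangular `M` vanishes, or else some index exceeds the exponent in each monomial, so upper
triangular `X` and `Y` give zero. The first case serves divided differences, the second the change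
of basis. -/
lemma mixed_insert {X Y M : ℕ → ℕ → ℚ}
    (hM : ∀ a ≤ D, ∀ m ≤ D, ∑ j ∈ Finset.range (D + 1), M a j * X j m = Y a m)
    (h : (∀ a j, a < j → M a j = 0) ∨ ∀ a m, m < a → X a m = 0 ∧ Y a m = 0)
    (c : Mon t D → ℚ) (Z : Finset (Fin t)) (i : Fin t) (hi : i ∉ Z) (a : Mon t D) :
    mixed X Y c (insert i Z) a.1 =
      ∑ j ∈ (Finset.range (D + 1)).filter (fun j => (a.1.update i j).degree ≤ D),
        M (a.1 i) j * mixed X Y c Z (a.1.update i j) := by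
  classical
  have hle : ∀ (m : Mon t D) l, m.1 l ≤ D := fun m l => (Finsupp.le_degree l m.1).trans m.2
  rw [Finset.sum_filter]
  have h1 : ∀ j ∈ Finset.range (D + 1), (if (a.1.update i j).degree ≤ D then
      M (a.1 i) j * mixed X Y c Z (a.1.update i j) else 0) =
      M (a.1 i) j * mixed X Y c Z (a.1.update i j) := by
    intro j _
    split_ifs with hj
    · rfl
    · symm
      rcases h with h | h
      · rw [h _ _ (by have := degree_update a.1 i j; have := a.2; omega), zero_mul]
      · refine mul_eq_zero_of_right _ (Finset.sum_eq_zero fun m _ => mul_eq_zero_of_right _ ?_)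
        obtain ⟨l, hl⟩ : ∃ l, m.1 l < a.1.update i j l := by
          by_contra! hcon
          exact hj ((Finsupp.degree_mono (show a.1.update i j ≤ m.1 from hcon)).trans m.2)
        refine Finset.prod_eq_zero (Finset.mem_univ l) ?_
        split_ifs
        · exact (h _ _ hl).2
        · exact (h _ _ hl).1
  rw [Finset.sum_congr rfl h1]
  simp only [mixed, Finset.mul_sum]
  rw [Finset.sum_comm]
  refine Finset.sum_congr rfl fun m _ => ?_
  rw [← Finset.mul_prod_erase _ _ (Finset.mem_univ i), if_pos (Finset.mem_insert_self i Z),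
    ← hM _ (hle a i) _ (hle m i), Finset.sum_mul, Finset.mul_sum]
  refine Finset.sum_congr rfl fun j _ => ?_
  rw [← Finset.mul_prod_erase _ _ (Finset.mem_univ i), if_neg hi]
  have h2 : ∏ l ∈ Finset.univ.erase i, (if l ∈ insert i Z then Y (a.1 l) (m.1 l)
      else X (a.1 l) (m.1 l)) = ∏ l ∈ Finset.univ.erase i, (if l ∈ Z then
        Y (a.1.update i j l) (m.1 l) else X (a.1.update i j l) (m.1 l)) := by
    refine Finset.prod_congr rfl fun l hl => ?_
    have hli : l ≠ i := (Finset.mem_erase.1 hl).1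
    simp [hli]
  rw [h2, Finsupp.coe_update, Function.update_self]
  ring

/-- Each direction of `Z` costs one linear combination of at most `D + 1` known values for every
point of the simplex. -/
lemma reach_mixed {Ω : Type} {K : Set (Ω → ℚ)} {X Y M : ℕ → ℕ → ℚ}
    (hM : ∀ a ≤ D, ∀ m ≤ D, ∑ j ∈ Finset.range (D + 1), M a j * X j m = Y a m)
    (h : (∀ a j, a < j → M a j = 0) ∨ ∀ a m, m < a → X a m = 0 ∧ Y a m = 0)
    (c : Ω → Mon t D → ℚ) (hK : ∀ a : Mon t D, (fun ω => mixed X Y (c ω) ∅ a.1) ∈ K)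
    (Z : Finset (Fin t)) :
    Reach K (Set.range fun (a : Mon t D) ω => mixed X Y (c ω) Z a.1)
      (Z.card * (Fintype.card (Mon t D) * (2 * (D + 1)))) := by
  classical
  induction Z using Finset.induction_on with
  | empty =>
    refine (Reach.of_subset ?_).le (by simp)
    rintro _ ⟨a, rfl⟩
    exact hK a
  | insert i Z hi ih =>
    refine (ih.bind (Reach.range _ (2 * (D + 1)) fun a => ?_)).le (le_of_eq (by
      rw [Finset.card_insert_of_notMem hi]; push_cast; ring))
    simp only [mixed_insert hM h _ Z i hi]
    refine (Reach.linComb _ _ (fun j ω => mixed X Y (c ω) Z (a.1.update i j)) fun j hj => ?_).le ?_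
    · exact Or.inr ⟨⟨a.1.update i j, (Finset.mem_filter.1 hj).2⟩, rfl⟩
    · have : (((Finset.range (D + 1)).filter
        (fun j => (a.1.update i j).degree ≤ D)).card : ℝ) ≤ D + 1 := by
        have h1 := Finset.card_filter_le (Finset.range (D + 1))
          (fun j => (a.1.update i j).degree ≤ D)
        rw [Finset.card_range] at h1
        exact_mod_cast h1
      linarith

end Grid

/-- The coefficients of the divided differences at `0, 1, 2, …`. -/
noncomputable def divDiff (a j : ℕ) : ℚ := (-1) ^ (a - j) * a.choose j / a.factorial

/-- The divided differences of the powers. -/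
noncomputable def powDiff (a m : ℕ) : ℚ :=
  ∑ j ∈ Finset.range (a + 1), divDiff a j * (j : ℚ) ^ m

lemma powDiff_eq (a m : ℕ) :
    powDiff a m = (fwdDiff (1 : ℚ))^[a] (fun r : ℚ => r ^ m) 0 / a.factorial := by
  rw [fwdDiff_iter_eq_sum_shift, powDiff, Finset.sum_div]
  refine Finset.sum_congr rfl fun j _ => ?_
  simp only [divDiff, zero_add, nsmul_eq_mul, mul_one, zsmul_eq_mul]
  push_cast
  ring

lemma powDiff_of_lt {a m : ℕ} (h : m < a) : powDiff a m = 0 := by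
  rw [powDiff_eq, fwdDiff_iter_pow_eq_zero_of_lt h]; simp

lemma powDiff_self (a : ℕ) : powDiff a a = 1 := by
  rw [powDiff_eq, fwdDiff_iter_eq_factorial]
  have : (a.factorial : ℚ) ≠ 0 := by exact_mod_cast a.factorial_ne_zero
  simpa using div_self this

lemma sum_divDiff {D a : ℕ} (ha : a ≤ D) (m : ℕ) :
    ∑ j ∈ Finset.range (D + 1), divDiff a j * (j : ℚ) ^ m = powDiff a m := by
  symm
  refine Finset.sum_subset (Finset.range_subset_range.2 (by omega)) fun j _ hj => ?_
  rw [Finset.mem_range] at hj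
  rw [divDiff, Nat.choose_eq_zero_of_lt (by omega)]
  simp

/-- The matrix `powDiff` is upper unitriangular, expressing powers in the Newton basis at `0, 1, 2,
…`; its inverse is the change back to monomials. -/
lemma exists_inverse_powDiff (D : ℕ) : ∃ B : ℕ → ℕ → ℚ, ∀ a ≤ D, ∀ m ≤ D,
    ∑ j ∈ Finset.range (D + 1), B a j * powDiff j m = if a = m then 1 else 0 := by
  let W : Matrix (Fin (D + 1)) (Fin (D + 1)) ℚ := fun i j => powDiff i j
  have hW : W.det = 1 := by
    rw [Matrix.det_of_isUpperTriangular (M := W) fun i j hij => powDiff_of_lt hij]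
    exact Finset.prod_eq_one fun i _ => powDiff_self i
  have h1 : W⁻¹ * W = 1 := Matrix.nonsing_inv_mul W (by rw [hW]; exact isUnit_one)
  refine ⟨fun a j => if h : a < D + 1 ∧ j < D + 1 then W⁻¹ ⟨a, h.1⟩ ⟨j, h.2⟩ else 0,
    fun a ha m hm => ?_⟩
  have h2 := congrFun (congrFun h1 ⟨a, by omega⟩) ⟨m, by omega⟩
  rw [Matrix.one_apply, Matrix.mul_apply] at h2
  simp only [Fin.mk.injEq] at h2
  rw [← h2, Finset.sum_range]
  refine Finset.sum_congr rfl fun j _ => ?_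
  exact congrArg (· * powDiff j m) (dif_pos ⟨by omega, j.2⟩)

lemma eval_eq_sum_mon {t D : ℕ} (p : MvPolynomial (Fin t) ℚ) (hp : p.totalDegree ≤ D)
    (x : Fin t → ℚ) : eval x p = ∑ m : Mon t D, p.coeff m.1 * ∏ i, x i ^ m.1 i := by
  classical
  rw [eval_eq']
  have hmem : ∀ m ∈ p.support, m.degree ≤ D := fun m hm => (le_totalDegree hm).trans hp
  have h1 : (∑ m : Mon t D, p.coeff m.1 * ∏ i, x i ^ m.1 i) =
      ∑ m ∈ Finset.univ.map (Function.Embedding.subtype fun a : Fin t →₀ ℕ => a.degree ≤ D),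
        p.coeff m * ∏ i, x i ^ m i := by
    rw [Finset.sum_map]; rfl
  rw [h1]
  refine Finset.sum_subset (fun m hm => ?_) fun m _ hm => ?_
  · simpa using hmem m hm
  · rw [notMem_support_iff.1 hm, zero_mul]

/-- Interpolation: the coefficients of a polynomial are computed from its values at the points
`a ∈ ℕᵗ` with `|a| ≤ D`. -/
theorem reach_interpolate {Ω : Type} {K : Set (Ω → ℚ)} {t D : ℕ}
    (p : Ω → MvPolynomial (Fin t) ℚ) (hp : ∀ ω, (p ω).totalDegree ≤ D)
    (hK : ∀ a : Mon t D, (fun ω => eval (fun i => (a.1 i : ℚ)) (p ω)) ∈ K) :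
    Reach K (Set.range fun (a : Mon t D) ω => densePoly D (p ω) a)
      (4 * (t * (D + 1)) * Fintype.card (Mon t D)) := by
  obtain ⟨B, hB⟩ := exists_inverse_powDiff D
  let c : Ω → Mon t D → ℚ := fun ω => densePoly D (p ω)
  -- From values to coefficients in the Newton basis: `divDiff` is lower triangular.
  have h1 := reach_mixed (K := K) (X := fun a m => (a : ℚ) ^ m) (Y := powDiff) (M := divDiff)
    (fun a ha m _ => sum_divDiff ha m)
    (Or.inl fun a j haj => by rw [divDiff, Nat.choose_eq_zero_of_lt haj]; simp) c
    (fun a => by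
      convert hK a using 2 with ω
      rw [eval_eq_sum_mon _ (hp ω)]
      simp [mixed, c, densePoly]) Finset.univ
  -- From the Newton basis to monomials: here `powDiff` and the identity are upper triangular.
  have h2 := reach_mixed (K := K ∪ Set.range fun (a : Mon t D) ω =>
      mixed (fun a m => (a : ℚ) ^ m) powDiff (c ω) Finset.univ a.1)
    (X := powDiff) (Y := fun a m => if a = m then 1 else 0) (M := B) hB
    (Or.inr fun a m hm => ⟨powDiff_of_lt hm, if_neg (by omega)⟩) c
    (fun a => Or.inr ⟨a, by funext ω; simp [mixed]⟩) Finset.univ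
  refine ((h1.bind h2).mono subset_rfl ?_).le (le_of_eq ?_)
  · rintro _ ⟨a, rfl⟩
    refine ⟨a, ?_⟩
    funext ω
    simp only [mixed, Finset.mem_univ, if_true]
    rw [Finset.sum_eq_single a]
    · simp [c]
    · intro m _ hm
      obtain ⟨i, hi⟩ : ∃ i, a.1 i ≠ m.1 i := by
        by_contra! hcon
        exact hm (Subtype.ext (Finsupp.ext hcon)).symm
      exact mul_eq_zero_of_right _ (Finset.prod_eq_zero (Finset.mem_univ i) (if_neg hi))
    · simp
  · simp only [Finset.card_univ, Fintype.card_fin]; ring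

/-- Evaluation at a fixed point. -/
lemma reach_eval {Ω : Type} {K : Set (Ω → ℚ)} {t D : ℕ}
    (p : Ω → MvPolynomial (Fin t) ℚ) (hp : ∀ ω, (p ω).totalDegree ≤ D)
    (hK : ∀ m : Mon t D, (fun ω => densePoly D (p ω) m) ∈ K) (x : Fin t → ℚ) :
    Reach K {fun ω => eval x (p ω)} (2 * Fintype.card (Mon t D)) := by
  have h : (fun ω => eval x (p ω)) = fun ω => ∑ m : Mon t D,
      (∏ i, x i ^ m.1 i) * densePoly D (p ω) m := by
    funext ω
    rw [eval_eq_sum_mon _ (hp ω)]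
    exact Finset.sum_congr rfl fun m _ => mul_comm _ _
  rw [h]
  exact Reach.linComb Finset.univ (fun m : Mon t D => ∏ i, x i ^ m.1 i) _ fun m _ => hK m

/-! ### Parametric systems over `ℚ[y]` -/

section Parts

variable {n t : ℕ}

/-- The exponents of `x`. -/
noncomputable def xp (s : Fin n ⊕ Fin t →₀ ℕ) : Fin n →₀ ℕ :=
  (Finsupp.sumFinsuppAddEquivProdFinsupp s).1

/-- The exponents of `y`. -/
noncomputable def yp (s : Fin n ⊕ Fin t →₀ ℕ) : Fin t →₀ ℕ :=
  (Finsupp.sumFinsuppAddEquivProdFinsupp s).2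

/-- The exponent vector with given parts. -/
noncomputable def join (a : Fin n →₀ ℕ) (c : Fin t →₀ ℕ) : Fin n ⊕ Fin t →₀ ℕ :=
  Finsupp.sumFinsuppAddEquivProdFinsupp.symm (a, c)

@[simp] lemma xp_join (a : Fin n →₀ ℕ) (c : Fin t →₀ ℕ) : xp (join a c) = a := by
  simp only [xp, join, AddEquiv.apply_symm_apply]

@[simp] lemma yp_join (a : Fin n →₀ ℕ) (c : Fin t →₀ ℕ) : yp (join a c) = c := by
  simp only [yp, join, AddEquiv.apply_symm_apply]

@[simp] lemma join_parts (s : Fin n ⊕ Fin t →₀ ℕ) : join (xp s) (yp s) = s := by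
  simp only [xp, yp, join, Prod.mk.eta, AddEquiv.symm_apply_apply]

lemma xp_add (s s' : Fin n ⊕ Fin t →₀ ℕ) : xp (s + s') = xp s + xp s' := by
  simp only [xp, map_add, Prod.fst_add]

lemma yp_add (s s' : Fin n ⊕ Fin t →₀ ℕ) : yp (s + s') = yp s + yp s' := by
  simp only [yp, map_add, Prod.snd_add]

lemma xp_apply (s : Fin n ⊕ Fin t →₀ ℕ) (i : Fin n) : xp s i = s (Sum.inl i) := by
  simp [xp]

lemma yp_apply (s : Fin n ⊕ Fin t →₀ ℕ) (i : Fin t) : yp s i = s (Sum.inr i) := by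
  simp [yp]

lemma degree_eq_parts (s : Fin n ⊕ Fin t →₀ ℕ) : s.degree = (xp s).degree + (yp s).degree := by
  simp only [Finsupp.degree_eq_sum, Fintype.sum_sum_type, xp_apply, yp_apply]

lemma degree_join (a : Fin n →₀ ℕ) (c : Fin t →₀ ℕ) :
    (join a c).degree = a.degree + c.degree := by
  rw [degree_eq_parts, xp_join, yp_join]

/-- The inclusion of `ℚ[y]` in `𝕂`. -/
noncomputable abbrev toK (t : ℕ) : MvPolynomial (Fin t) ℚ →+* ParamField t :=
  algebraMap (MvPolynomial (Fin t) ℚ) (ParamField t)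

lemma toK_injective (t : ℕ) : Function.Injective (toK t) := IsFractionRing.injective _ _

lemma toKx_eq (p : PolyXY n t) : toKx n t p = map (toK t) (sumAlgEquiv ℚ (Fin n) (Fin t) p) := by
  have : toKx n t = (mapAlgHom (IsScalarTower.toAlgHom ℚ (MvPolynomial (Fin t) ℚ)
      (ParamField t))).comp (sumAlgEquiv ℚ (Fin n) (Fin t)).toAlgHom := by
    apply MvPolynomial.algHom_ext
    rintro (i | i) <;> simp [toKx]
  rw [this]
  rfl

lemma sumAlgEquiv_monomial (s : Fin n ⊕ Fin t →₀ ℕ) (r : ℚ) :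
    sumAlgEquiv ℚ (Fin n) (Fin t) (monomial s r) = monomial (xp s) (monomial (yp s) r) := by
  simp only [sumAlgEquiv, AlgEquiv.trans_apply, ← single_eq_monomial]
  rw [AddMonoidAlgebra.domCongr_single]
  exact AddMonoidAlgebra.curryAlgEquiv_single _ _ _

lemma coeff_sumAlgEquiv (p : PolyXY n t) (a : Fin n →₀ ℕ) (c : Fin t →₀ ℕ) :
    coeff c (coeff a (sumAlgEquiv ℚ (Fin n) (Fin t) p)) = coeff (join a c) p := by
  induction p using MvPolynomial.induction_on' with
  | monomial s r =>
    rw [sumAlgEquiv_monomial, coeff_monomial, coeff_monomial]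
    by_cases h : xp s = a
    · subst h
      rw [if_pos rfl, coeff_monomial]
      refine if_congr ⟨fun h => ?_, fun h => ?_⟩ rfl rfl
      · rw [← h, join_parts]
      · rw [h, yp_join]
    · rw [if_neg h, if_neg, coeff_zero]
      rintro rfl
      exact h (xp_join _ _)
  | add p q hp hq => rw [map_add, coeff_add, coeff_add, coeff_add, hp, hq]

lemma mem_support_toKx (p : PolyXY n t) (a : Fin n →₀ ℕ) :
    a ∈ (toKx n t p).support ↔ ∃ s ∈ p.support, xp s = a := by
  rw [mem_support_iff, toKx_eq, coeff_map, Ne, map_eq_zero_iff _ (toK_injective t)]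
  constructor
  · intro h
    obtain ⟨c, hc⟩ := exists_coeff_ne_zero h
    rw [coeff_sumAlgEquiv] at hc
    exact ⟨_, mem_support_iff.2 hc, xp_join _ _⟩
  · rintro ⟨s, hs, rfl⟩ h
    have h1 := coeff_sumAlgEquiv p (xp s) (yp s)
    rw [h, coeff_zero, join_parts] at h1
    exact mem_support_iff.1 hs h1.symm

lemma toKx_monomial (s : Fin n ⊕ Fin t →₀ ℕ) (r : ℚ) :
    toKx n t (monomial s r) = monomial (xp s) (toK t (monomial (yp s) r)) := by
  rw [toKx_eq, sumAlgEquiv_monomial, map_monomial]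

end Parts

lemma degree_le_of_grevlex_le {n : ℕ} {a b : Fin n →₀ ℕ}
    (h : (grevlex n).toSyn a ≤ (grevlex n).toSyn b) : a.degree ≤ b.degree := by
  rcases h.lt_or_eq with h | h
  · rcases (grevlex_lt_iff a b).1 h with h | h
    · exact h.le
    · exact h.1.le
  · rw [(grevlex n).toSyn.injective h]

/-! ### Leading monomials for the elimination ordering. -/

section Elim

variable {n t : ℕ}

lemma xp_le_of_elim_le {s s' : Fin n ⊕ Fin t →₀ ℕ}
    (h : (elimGrevlex n t).toSyn s ≤ (elimGrevlex n t).toSyn s') :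
    (grevlex n).toSyn (xp s) ≤ (grevlex n).toSyn (xp s') := by
  have h' : toLex ((grevlex n).toSyn (xp s), (grevlex t).toSyn (yp s)) ≤
    toLex ((grevlex n).toSyn (xp s'), (grevlex t).toSyn (yp s')) := h
  rw [Prod.Lex.le_iff] at h'
  rcases h' with h' | h'
  · exact le_of_lt h'
  · exact le_of_eq h'.1

/-- The block ordering compares the `x` parts first, so the leading term over `ℚ` shows the leading
monomial over `𝕂`. -/
lemma lmX_eq {p : PolyXY n t} (hp : p ≠ 0) : lmX p = xp ((elimGrevlex n t).degree p) := by
  apply (grevlex n).toSyn.injective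
  apply le_antisymm
  · rw [lmX, (grevlex n).degree_le_iff]
    intro a ha
    obtain ⟨s, hs, rfl⟩ := (mem_support_toKx p a).1 ha
    exact xp_le_of_elim_le ((elimGrevlex n t).le_degree hs)
  · exact (grevlex n).le_degree
      ((mem_support_toKx p _).2 ⟨_, (elimGrevlex n t).degree_mem_support hp, rfl⟩)

/-- An element with `deg p = deg_x p` has a leading monomial in `x` only, of degree `deg p`. -/
lemma leading_of_degree_eq {p : PolyXY n t} (hp : p ≠ 0) (h : p.totalDegree = degX p) :
    (elimGrevlex n t).degree p = join (lmX p) 0 ∧ p.totalDegree = (lmX p).degree := by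
  have h1 : degX p ≤ (lmX p).degree := by
    refine Finset.sup_le fun s hs => ?_
    have := degree_le_of_grevlex_le (xp_le_of_elim_le ((elimGrevlex n t).le_degree hs))
    rw [← lmX_eq hp, Finsupp.degree_eq_sum] at this
    simpa only [xp_apply] using this
  have h2 : ((elimGrevlex n t).degree p).degree ≤ p.totalDegree :=
    le_totalDegree ((elimGrevlex n t).degree_mem_support hp)
  rw [degree_eq_parts, ← lmX_eq hp] at h2
  -- `deg_x p` is at most the degree of the leading `x` part, while the full leading exponent has
  -- degree at most `deg p = deg_x p`.
  have h3 : (yp ((elimGrevlex n t).degree p)).degree = 0 := by omega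
  refine ⟨?_, by omega⟩
  rw [← join_parts ((elimGrevlex n t).degree p), ← lmX_eq hp, (Finsupp.degree_eq_zero_iff _).1 h3]

end Elim

/-! ### Division by the Gröbner basis with control of degrees. -/

section System

variable {n t e δ d : ℕ} {f : Fin e → PolyXY n t} {G : Set (PolyXY n t)}
  {b : Fin δ → Fin n →₀ ℕ}

/-- The span of the terms `x ^ (b j) y ^ c` of total degree at most `N`. -/
noncomputable def normalForms (t : ℕ) (b : Fin δ → Fin n →₀ ℕ) (N : ℕ) : Submodule ℚ (PolyXY n t) :=
  Submodule.span ℚ {p | ∃ j c, (b j).degree + c.degree ≤ N ∧ p = monomial (join (b j) c) 1}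

/-- A nonstandard monomial is a multiple of the leading monomial of some `p ∈ G`. Subtracting that
multiple of `p` leaves smaller monomials for the ordering, and none of larger total degree because
the leading monomial of `p` has degree `deg p`. -/
lemma monomial_mem_normalForms (h : IsRegularSystem d f G b) (N : ℕ) (s : Fin n ⊕ Fin t →₀ ℕ)
    (hs : s.degree ≤ N) : (monomial s 1 : PolyXY n t) ∈
      (Ideal.span (Set.range f)).restrictScalars ℚ ⊔ normalForms t b N := by
  classical
  suffices H : ∀ (z : (elimGrevlex n t).syn) (s : Fin n ⊕ Fin t →₀ ℕ),
      (elimGrevlex n t).toSyn s = z → s.degree ≤ N → (monomial s 1 : PolyXY n t) ∈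
      (Ideal.span (Set.range f)).restrictScalars ℚ ⊔ normalForms t b N from H _ s rfl hs
  clear hs s
  intro z
  induction z using WellFoundedLT.induction with
  | ind z ih =>
  rintro s rfl hs
  by_cases hb : xp s ∈ Set.range b
  · obtain ⟨j, hj⟩ := hb
    refine Submodule.mem_sup_right (Submodule.subset_span ⟨j, yp s, ?_, ?_⟩)
    · rw [hj, ← degree_eq_parts]; exact hs
    · rw [hj, join_parts]
  · rw [h.range_eq] at hb
    simp only [Set.mem_ofPred_eq, not_forall, not_not] at hb
    obtain ⟨p, hpG, hp⟩ := hb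
    have hlc := h.groebner.monic p hpG
    have hp0 : p ≠ 0 := by
      rintro rfl
      rw [MonomialOrder.leadingCoeff_zero] at hlc
      exact zero_ne_one hlc
    obtain ⟨h1, h2⟩ := leading_of_degree_eq hp0 (h.degree_eq_degX p hpG)
    obtain ⟨u, hu⟩ := exists_add_of_le hp
    set D := (elimGrevlex n t).degree p with hD
    -- The leading exponent `D` of `p` has no `y` part, so the cofactor takes all of `yp s`.
    have hs' : s = join u (yp s) + D := by
      have h3 : xp s = xp (join u (yp s) + D) := by
        rw [xp_add, h1, xp_join, xp_join, hu, add_comm]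
      have h4 : yp s = yp (join u (yp s) + D) := by
        rw [yp_add, h1, yp_join, yp_join, add_zero]
      calc s = join (xp s) (yp s) := (join_parts s).symm
        _ = join (xp (join u (yp s) + D)) (yp (join u (yp s) + D)) := by rw [← h3, ← h4]
        _ = _ := join_parts _
    set v := join u (yp s)
    have hDs : D ∈ p.support := (elimGrevlex n t).degree_mem_support hp0
    have hsum : (monomial v 1 : PolyXY n t) * p = monomial s 1 +
        ∑ s' ∈ p.support.erase D, p.coeff s' • (monomial (v + s') 1 : PolyXY n t) := by
      conv_lhs => rw [p.as_sum, ← Finset.add_sum_erase _ _ hDs, mul_add, Finset.mul_sum]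
      congr 1
      · rw [monomial_mul, ← hs', one_mul]
        exact congrArg (monomial s) hlc
      · refine Finset.sum_congr rfl fun s' _ => ?_
        rw [monomial_mul, smul_monomial, one_mul, smul_eq_mul, mul_one]
    rw [eq_sub_of_add_eq hsum.symm]
    refine Submodule.sub_mem _ (Submodule.mem_sup_left ?_) (Submodule.sum_mem _ fun s' hs'' =>
      Submodule.smul_mem _ _ (ih _ ?_ _ rfl ?_))
    · exact Ideal.mul_mem_left _ _ (h.groebner.subset p hpG)
    · obtain ⟨hne, hmem⟩ := Finset.mem_erase.1 hs''
      have h3 : (elimGrevlex n t).toSyn s' < (elimGrevlex n t).toSyn D :=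
        lt_of_le_of_ne ((elimGrevlex n t).le_degree hmem)
          fun h => hne ((elimGrevlex n t).toSyn.injective h)
      conv_rhs => rw [hs', map_add]
      rw [map_add]
      exact add_lt_add_right h3 _
    · obtain ⟨hne, hmem⟩ := Finset.mem_erase.1 hs''
      have h3 : s'.degree ≤ p.totalDegree := le_totalDegree hmem
      have h4 : D.degree = p.totalDegree := by rw [h1, degree_join, h2]; simp
      have h5 : s.degree = v.degree + D.degree := by
        conv_lhs => rw [hs']
        exact map_add _ _ _
      have h6 : (v + s').degree = v.degree + s'.degree := map_add _ _ _
      omega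

lemma cls_eq_zero {q : PolyXY n t} (hq : q ∈ Ideal.span (Set.range f)) : cls f q = 0 := by
  rw [cls, Ideal.Quotient.eq_zero_iff_mem]
  have h1 := Ideal.mem_map_of_mem (toKx n t) hq
  rw [Ideal.map_span, ← Set.range_comp] at h1
  exact h1

lemma cls_mul (p q : PolyXY n t) : cls f (p * q) = cls f p * cls f q := by
  simp only [cls, map_mul]

lemma cls_monomial (s : Fin n ⊕ Fin t →₀ ℕ) (r : ℚ) :
    cls f (monomial s r) = toK t (monomial (yp s) r) • clsMon f (xp s) := by
  rw [cls, toKx_monomial, clsMon, ← mul_one (toK t _), ← smul_eq_mul, ← smul_monomial, smul_eq_mul,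
    mul_one]
  rfl

lemma clsMon_eq (a : Fin n →₀ ℕ) : clsMon f a = cls f (monomial (join a 0) 1) := by
  rw [cls_monomial, xp_join, yp_join, monomial_zero', C_1, map_one, one_smul]

/-- Normal forms: coefficients and degrees. -/
theorem exists_normalForm (h : IsRegularSystem d f G b) (q : PolyXY n t) :
    ∃ c : Fin δ → MvPolynomial (Fin t) ℚ,
      (∀ j, ∀ u ∈ (c j).support, u.degree + (b j).degree ≤ q.totalDegree) ∧
      cls f q = ∑ j, toK t (c j) • clsMon f (b j) := by
  classical
  set N := q.totalDegree
  have hq : q ∈ (Ideal.span (Set.range f)).restrictScalars ℚ ⊔ normalForms t b N := by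
    rw [q.as_sum]
    refine Submodule.sum_mem _ fun s hs => ?_
    rw [← mul_one (q.coeff s), ← smul_eq_mul, ← smul_monomial]
    exact Submodule.smul_mem _ _ (monomial_mem_normalForms h N s (le_totalDegree hs))
  obtain ⟨r, hr, w, hw, rfl⟩ := Submodule.mem_sup.1 hq
  have h1 : cls f (r + w) = cls f w := by
    have := cls_eq_zero (f := f) (q := r) hr
    rw [cls] at this ⊢
    rw [map_add, map_add, this, zero_add]; rfl
  rw [h1]
  clear h1 hq
  -- The bound stays fixed while the element runs through the span.
  clear_value N
  induction hw using Submodule.span_induction with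
  | mem p hp =>
    obtain ⟨j, c, hjc, rfl⟩ := hp
    refine ⟨Pi.single j (monomial c 1), fun i u hu => ?_, ?_⟩
    · by_cases hij : i = j
      · subst hij
        rw [Pi.single_eq_same] at hu
        rw [Finset.mem_singleton.1 (support_monomial_subset hu)]
        omega
      · rw [Pi.single_eq_of_ne hij] at hu
        simp at hu
    · rw [cls_monomial, xp_join, yp_join, Finset.sum_eq_single j]
      · rw [Pi.single_eq_same]
      · intro i _ hij
        rw [Pi.single_eq_of_ne hij, RingHom.map_zero]
        exact zero_smul (ParamField t) _
      · exact fun h => absurd (Finset.mem_univ j) h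
  | zero =>
    refine ⟨0, by simp, ?_⟩
    rw [cls, map_zero, map_zero]
    refine (Finset.sum_eq_zero fun j _ => ?_).symm
    rw [Pi.zero_apply, RingHom.map_zero]
    exact zero_smul (ParamField t) _
  | add p q _ _ hp hq =>
    obtain ⟨c, hc, hc'⟩ := hp
    obtain ⟨c', hd, hd'⟩ := hq
    refine ⟨c + c', fun j u hu => ?_, ?_⟩
    · rcases Finset.mem_union.1 (support_add hu) with hu | hu
      · exact hc j u hu
      · exact hd j u hu
    · rw [show cls f (p + q) = cls f p + cls f q by simp only [cls, map_add], hc', hd',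
        ← Finset.sum_add_distrib]
      refine Finset.sum_congr rfl fun j _ => ?_
      rw [Pi.add_apply, map_add, add_smul]
  | smul r p _ hp =>
    obtain ⟨c, hc, hc'⟩ := hp
    refine ⟨fun j => C r * c j, fun j u hu => hc j u ?_, ?_⟩
    · have h1 : C r * c j = r • c j := (smul_eq_C_mul _ _).symm
      rw [show (fun j => C r * c j) j = r • c j from h1] at hu
      exact support_smul hu
    · have h1 : cls f (r • p) = toK t (C r) • cls f p := by
        have h2 : (monomial 0 r : PolyXY n t) = C r := rfl
        rw [smul_eq_C_mul, cls_mul, ← h2, cls_monomial]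
        have h3 : xp (0 : Fin n ⊕ Fin t →₀ ℕ) = 0 := by simp [xp]
        have h4 : yp (0 : Fin n ⊕ Fin t →₀ ℕ) = 0 := by simp [yp]
        have h5 : clsMon f (0 : Fin n →₀ ℕ) = 1 := rfl
        rw [h3, h4, h5, smul_mul_assoc, one_mul]; rfl
      rw [h1, hc', Finset.smul_sum]
      refine Finset.sum_congr rfl fun j _ => ?_
      rw [map_mul, mul_smul]

end System

/-! ### The basis of standard monomials and the Hermite matrix of a product. -/

section System

variable {n t e δ d : ℕ} {f : Fin e → PolyXY n t} {G : Set (PolyXY n t)}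
  {b : Fin δ → Fin n →₀ ℕ}

lemma toKx_join (c : MvPolynomial (Fin t) ℚ) :
    ∃ q : PolyXY n t, toKx n t q = C (toK t c) := by
  refine ⟨(sumAlgEquiv ℚ (Fin n) (Fin t)).symm (C c), ?_⟩
  rw [toKx_eq, AlgEquiv.apply_symm_apply, map_C]

/-- Denominators in the parameters can be cleared. -/
lemma exists_clear_denominator (z : MvPolynomial (Fin n) (ParamField t)) :
    ∃ c : MvPolynomial (Fin t) ℚ, c ≠ 0 ∧ ∃ q : PolyXY n t, C (toK t c) * z = toKx n t q := by
  induction z using MvPolynomial.induction_on with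
  | C k =>
    obtain ⟨a, c, hc, rfl⟩ := IsFractionRing.div_surjective (A := MvPolynomial (Fin t) ℚ) k
    have hc0 : c ≠ 0 := nonZeroDivisors.ne_zero hc
    obtain ⟨q, hq⟩ := toKx_join (n := n) a
    refine ⟨c, hc0, q, ?_⟩
    rw [hq, ← C_mul, mul_div_cancel₀]
    rwa [Ne, map_eq_zero_iff _ (toK_injective t)]
  | add z w hz hw =>
    obtain ⟨c, hc, q, hq⟩ := hz
    obtain ⟨c', hc', q', hq'⟩ := hw
    obtain ⟨u, hu⟩ := toKx_join (n := n) c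
    obtain ⟨u', hu'⟩ := toKx_join (n := n) c'
    refine ⟨c * c', mul_ne_zero hc hc', u' * q + u * q', ?_⟩
    rw [map_add, map_mul (toKx n t), map_mul (toKx n t), hu, hu', ← hq, ← hq',
      map_mul (toK t), C_mul]
    ring
  | mul_X z i hz =>
    obtain ⟨c, hc, q, hq⟩ := hz
    refine ⟨c, hc, q * X (Sum.inl i), ?_⟩
    rw [map_mul, ← hq, mul_assoc]
    simp [toKx]

/-- This carries relations over `𝕂` back to the ideal of `ℚ[y][x]`, where the Gröbner basis lives.
-/
lemma exists_clear_of_mem {z : MvPolynomial (Fin n) (ParamField t)}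
    (hz : z ∈ Ideal.span (Set.range fun i => toKx n t (f i))) :
    ∃ c : MvPolynomial (Fin t) ℚ, c ≠ 0 ∧ ∃ q ∈ Ideal.span (Set.range f),
      C (toK t c) * z = toKx n t q := by
  induction hz using Submodule.span_induction with
  | mem x hx =>
    obtain ⟨i, rfl⟩ := hx
    exact ⟨1, one_ne_zero, f i, Ideal.subset_span ⟨i, rfl⟩, by simp⟩
  | zero => exact ⟨1, one_ne_zero, 0, zero_mem _, by simp⟩
  | add z w _ _ hz hw =>
    obtain ⟨c, hc, q, hqI, hq⟩ := hz
    obtain ⟨c', hc', q', hqI', hq'⟩ := hw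
    obtain ⟨u, hu⟩ := toKx_join (n := n) c
    obtain ⟨u', hu'⟩ := toKx_join (n := n) c'
    refine ⟨c * c', mul_ne_zero hc hc', u' * q + u * q',
      add_mem (Ideal.mul_mem_left _ _ hqI) (Ideal.mul_mem_left _ _ hqI'), ?_⟩
    rw [map_add, map_mul (toKx n t), map_mul (toKx n t), hu, hu', ← hq, ← hq',
      map_mul (toK t), C_mul]
    ring
  | smul a z _ hz =>
    obtain ⟨c, hc, q, hqI, hq⟩ := hz
    obtain ⟨c', hc', q', hq'⟩ := exists_clear_denominator a
    refine ⟨c' * c, mul_ne_zero hc' hc, q' * q, Ideal.mul_mem_left _ _ hqI, ?_⟩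
    rw [map_mul (toKx n t), ← hq, ← hq', map_mul (toK t), C_mul, smul_eq_mul]
    ring

/-- The standard monomials are independent modulo `⟨f⟩`. -/
lemma eq_zero_of_mem (h : IsRegularSystem d f G b) {z : MvPolynomial (Fin n) (ParamField t)}
    (hz : z ∈ Ideal.span (Set.range fun i => toKx n t (f i)))
    (hb : ∀ a ∈ z.support, a ∈ Set.range b) : z = 0 := by
  obtain ⟨c, hc, q, hqI, hq⟩ := exists_clear_of_mem hz
  have hc' : toK t c ≠ 0 := by rwa [Ne, map_eq_zero_iff _ (toK_injective t)]
  suffices hq0 : q = 0 by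
    rw [hq0, map_zero, ← smul_eq_C_mul] at hq
    exact (smul_eq_zero.1 hq).resolve_left hc'
  by_contra hq0
  -- The leading `x` monomial of `q` is then divisible by that of `p`, although it occurs in `z` and
  -- so is standard.
  obtain ⟨p, hpG, hp⟩ := h.groebner.exists_degree_le q hqI hq0
  have hp0 : p ≠ 0 := by
    rintro rfl
    have := h.groebner.monic 0 hpG
    rw [MonomialOrder.leadingCoeff_zero] at this
    exact zero_ne_one this
  have h1 : lmX q ∈ (toKx n t q).support :=
    (mem_support_toKx q _).2 ⟨_, (elimGrevlex n t).degree_mem_support hq0, (lmX_eq hq0).symm⟩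
  have h2 : lmX q ∈ Set.range b := by
    apply hb
    rw [← hq, ← smul_eq_C_mul] at h1
    exact support_smul h1
  rw [h.range_eq] at h2
  refine h2 p hpG ?_
  rw [lmX_eq hp0, lmX_eq hq0]
  intro i
  rw [xp_apply, xp_apply]
  exact hp _

lemma smul_clsMon (k : ParamField t) (a : Fin n →₀ ℕ) :
    k • clsMon f a = Ideal.Quotient.mk _ (monomial a k) := by
  rw [clsMon, ← mul_one k, ← smul_eq_mul k 1, ← smul_monomial, smul_eq_mul, mul_one]
  rfl

lemma linearIndependent_clsMon (h : IsRegularSystem d f G b) :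
    LinearIndependent (ParamField t) fun j => clsMon f (b j) := by
  rw [Fintype.linearIndependent_iff]
  intro k hk j
  classical
  simp only [smul_clsMon, ← map_sum] at hk
  have hz := eq_zero_of_mem h (Ideal.Quotient.eq_zero_iff_mem.1 hk) (by
    intro a ha
    obtain ⟨i, -, hi⟩ := Finset.mem_biUnion.1 (support_sum ha)
    rw [Finset.mem_singleton.1 (support_monomial_subset hi)]
    exact ⟨i, rfl⟩)
  have h1 := congrArg (coeff (b j)) hz
  rw [coeff_sum, Finset.sum_eq_single j, coeff_monomial, if_pos rfl, coeff_zero] at h1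
  · exact h1
  · intro i _ hij
    rw [coeff_monomial, if_neg fun h' => hij (h.injective h')]
  · exact fun h' => absurd (Finset.mem_univ j) h'

/-- Beyond spanning, the degree restriction is what allows the affine Hilbert function to be read
off from the standard monomials. -/
lemma clsMon_mem_span (h : IsRegularSystem d f G b) (a : Fin n →₀ ℕ) :
    clsMon f a ∈ Submodule.span (ParamField t)
      ((fun j => clsMon f (b j)) '' {j | (b j).degree ≤ a.degree}) := by
  obtain ⟨c, hc, hc'⟩ := exists_normalForm h (monomial (join a 0) 1)
  rw [clsMon_eq, hc']
  refine Submodule.sum_mem _ fun j _ => ?_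
  by_cases hj : c j = 0
  · rw [hj, RingHom.map_zero]
    exact (zero_smul (ParamField t) (clsMon f (b j))) ▸ Submodule.zero_mem _
  · obtain ⟨u, hu⟩ := exists_coeff_ne_zero hj
    refine Submodule.smul_mem _ _ (Submodule.subset_span ⟨j, ?_, rfl⟩)
    have h1 := hc j u (mem_support_iff.2 hu)
    rw [totalDegree_monomial _ one_ne_zero] at h1
    have h2 : (join a (0 : Fin t →₀ ℕ)).sum (fun _ k => k) = a.degree := by
      have := degree_join a (0 : Fin t →₀ ℕ)
      rw [map_zero, add_zero] at this
      rw [← this]; rfl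
    rw [h2] at h1
    exact (Nat.le_add_left _ _).trans h1

/-- The basis of standard monomials. -/
theorem exists_basis (h : IsRegularSystem d f G b) :
    ∃ β : Module.Basis (Fin δ) (ParamField t) (QuotAlg f), ∀ j, β j = clsMon f (b j) := by
  refine ⟨Module.Basis.mk (linearIndependent_clsMon h) ?_, fun j => Module.Basis.mk_apply _ _ _⟩
  rintro x -
  obtain ⟨z, rfl⟩ := Ideal.Quotient.mk_surjective x
  rw [z.as_sum, map_sum]
  refine Submodule.sum_mem _ fun a _ => ?_
  rw [← smul_clsMon]
  exact Submodule.smul_mem _ _ (Submodule.span_mono (Set.image_subset_range _ _)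
    (clsMon_mem_span h a))

lemma exists_repr (h : IsRegularSystem d f G b)
    (β : Module.Basis (Fin δ) (ParamField t) (QuotAlg f)) (hβ : ∀ j, β j = clsMon f (b j))
    (q : PolyXY n t) : ∃ c : Fin δ → MvPolynomial (Fin t) ℚ, ∀ j,
      toK t (c j) = β.repr (cls f q) j ∧
      ∀ u ∈ (c j).support, u.degree + (b j).degree ≤ q.totalDegree := by
  obtain ⟨c, hc, hc'⟩ := exists_normalForm h q
  refine ⟨c, fun j => ⟨?_, hc j⟩⟩
  simp only [← hβ] at hc'
  rw [hc', Module.Basis.repr_sum_self]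

lemma totalDegree_monomial_join (a : Fin n →₀ ℕ) :
    (monomial (join a 0) 1 : PolyXY n t).totalDegree = a.degree := by
  rw [totalDegree_monomial _ one_ne_zero]
  have := degree_join a (0 : Fin t →₀ ℕ)
  rw [map_zero, add_zero] at this
  rw [← this]; rfl

lemma totalDegree_mul_monomial_join_le (q : PolyXY n t) (a : Fin n →₀ ℕ) :
    (q * monomial (join a 0) 1).totalDegree ≤ q.totalDegree + a.degree :=
  (totalDegree_mul _ _).trans (by rw [totalDegree_monomial_join])

/-- The matrix of a multiplication map has polynomial entries. -/
theorem exists_mulMatrix (h : IsRegularSystem d f G b)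
    (β : Module.Basis (Fin δ) (ParamField t) (QuotAlg f)) (hβ : ∀ j, β j = clsMon f (b j))
    (q : PolyXY n t) : ∃ L : Matrix (Fin δ) (Fin δ) (MvPolynomial (Fin t) ℚ),
      overK L = Algebra.leftMulMatrix β (cls f q) ∧
      ∀ i j, (L i j).totalDegree ≤ q.totalDegree + (b j).degree := by
  choose c hc using fun j => exists_repr h β hβ (q * monomial (join (b j) 0) 1)
  refine ⟨fun i j => c j i, ?_, fun i j => ?_⟩
  · ext i j
    rw [Algebra.leftMulMatrix_eq_repr_mul, hβ, clsMon_eq, ← cls_mul]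
    exact (hc j i).1
  · refine Finset.sup_le fun u hu => ?_
    have h1 := (hc j i).2 u hu
    have h2 := totalDegree_mul_monomial_join_le q (b j)
    have h3 : u.degree = u.sum fun _ k => k := rfl
    omega

/-- The `j`-th diagonal entry is the coefficient of `b j` in the normal form of `q b_j`; the degree
of `b j` gained by multiplying is lost again when the coefficient is taken. -/
lemma exists_trace (h : IsRegularSystem d f G b)
    (β : Module.Basis (Fin δ) (ParamField t) (QuotAlg f)) (hβ : ∀ j, β j = clsMon f (b j))
    (q : PolyXY n t) : ∃ r : MvPolynomial (Fin t) ℚ,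
      toK t r = Algebra.trace (ParamField t) (QuotAlg f) (cls f q) ∧
      r.totalDegree ≤ q.totalDegree := by
  choose c hc using fun j => exists_repr h β hβ (q * monomial (join (b j) 0) 1)
  refine ⟨∑ j, c j j, ?_, ?_⟩
  · rw [Algebra.trace_eq_matrix_trace β, Matrix.trace, map_sum]
    refine Finset.sum_congr rfl fun j _ => ?_
    rw [Matrix.diag_apply, Algebra.leftMulMatrix_eq_repr_mul, hβ, clsMon_eq, ← cls_mul]
    exact (hc j j).1
  · refine totalDegree_finsetSum_le fun j _ => Finset.sup_le fun u hu => ?_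
    have h1 := (hc j j).2 u hu
    have h2 := totalDegree_mul_monomial_join_le q (b j)
    have h3 : u.degree = u.sum fun _ k => k := rfl
    omega

/-- The Hermite matrix has polynomial entries. -/
theorem exists_hermite (h : IsRegularSystem d f G b) (q : PolyXY n t) :
    ∃ H : Matrix (Fin δ) (Fin δ) (MvPolynomial (Fin t) ℚ),
      overK H = hermiteMatrix f b q ∧
      ∀ i j, (H i j).totalDegree ≤ q.totalDegree + (b i).degree + (b j).degree := by
  obtain ⟨β, hβ⟩ := exists_basis h
  choose H hH using fun i j => exists_trace h β hβ
    (q * monomial (join (b i) 0) 1 * monomial (join (b j) 0) 1)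
  refine ⟨Matrix.of H, ?_, fun i j => ?_⟩
  · ext i j
    refine ((hH i j).1).trans ?_
    rw [hermiteMatrix, Matrix.of_apply, clsMon_eq, clsMon_eq, ← cls_mul, ← cls_mul]
  · have h1 := (hH i j).2
    have h2 := totalDegree_mul_monomial_join_le q (b i)
    have h3 := totalDegree_mul_monomial_join_le (q * monomial (join (b i) 0) 1) (b j)
    exact h1.trans (by omega)

/-- The Hermite matrix of a product. -/
theorem hermiteMatrix_mul (β : Module.Basis (Fin δ) (ParamField t) (QuotAlg f))
    (hβ : ∀ j, β j = clsMon f (b j)) (p q : PolyXY n t) :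
    hermiteMatrix f b (p * q) = hermiteMatrix f b p * Algebra.leftMulMatrix β (cls f q) := by
  ext i j
  have h1 : cls f q * clsMon f (b j) =
      ∑ k, Algebra.leftMulMatrix β (cls f q) k j • clsMon f (b k) := by
    simp only [Algebra.leftMulMatrix_eq_repr_mul, ← hβ]
    exact (β.sum_repr _).symm
  rw [Matrix.mul_apply, hermiteMatrix, Matrix.of_apply, cls_mul,
    show cls f p * cls f q * clsMon f (b i) * clsMon f (b j) =
      cls f p * clsMon f (b i) * (cls f q * clsMon f (b j)) by ring, h1, Finset.mul_sum, map_sum]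
  refine Finset.sum_congr rfl fun k _ => ?_
  rw [mul_smul_comm, map_smul, smul_eq_mul, mul_comm]
  rfl

end System

/-! ### Affine Hilbert functions of regular sequences -/

section Hilbert

variable {n : ℕ} {k : Type} [Field k]

/-- The polynomials of degree less than `s`. -/
noncomputable def lowDeg (n : ℕ) (k : Type) [Field k] (s : ℕ) :
    Submodule k (MvPolynomial (Fin n) k) :=
  restrictSupport k {a | a.degree < s}

lemma mem_lowDeg {s : ℕ} {p : MvPolynomial (Fin n) k} :
    p ∈ lowDeg n k s ↔ ∀ a ∈ p.support, a.degree < s := Iff.rfl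

lemma lowDeg_mono {s s' : ℕ} (h : s ≤ s') : lowDeg n k s ≤ lowDeg n k s' :=
  fun _ hp a ha => (hp ha : a.degree < s).trans_le h

lemma eq_zero_of_mem_lowDeg_zero {p : MvPolynomial (Fin n) k} (hp : p ∈ lowDeg n k 0) : p = 0 := by
  rw [← support_eq_empty, Finset.eq_empty_iff_forall_notMem]
  exact fun a ha => absurd (mem_lowDeg.1 hp a ha) (Nat.not_lt_zero _)

lemma homogeneousComponent_eq_zero_of_mem {s i : ℕ} {p : MvPolynomial (Fin n) k}
    (hp : p ∈ lowDeg n k s) (h : s ≤ i) : homogeneousComponent i p = 0 :=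
  homogeneousComponent_eq_zero' i p fun a ha => by have := mem_lowDeg.1 hp a ha; omega

lemma mem_lowDeg_of_succ {s : ℕ} {p : MvPolynomial (Fin n) k} (hp : p ∈ lowDeg n k (s + 1))
    (h : homogeneousComponent s p = 0) : p ∈ lowDeg n k s := by
  refine mem_lowDeg.2 fun a ha => ?_
  have h1 := mem_lowDeg.1 hp a ha
  refine lt_of_le_of_ne (by omega) fun h2 => mem_support_iff.1 ha ?_
  have h3 := congrArg (coeff a) h
  rwa [coeff_homogeneousComponent, if_pos h2, coeff_zero] at h3

lemma mem_lowDeg_totalDegree (p : MvPolynomial (Fin n) k) : p ∈ lowDeg n k (p.totalDegree + 1) :=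
  mem_lowDeg.2 fun _ ha => Nat.lt_succ_of_le (le_totalDegree ha)

lemma homogeneousComponent_mem_lowDeg (s : ℕ) (p : MvPolynomial (Fin n) k) :
    homogeneousComponent s p ∈ lowDeg n k (s + 1) := by
  refine mem_lowDeg.2 fun a ha => ?_
  rw [support_homogeneousComponent, Finset.mem_filter] at ha
  omega

lemma mul_mem_lowDeg {s d s' : ℕ} {h F : MvPolynomial (Fin n) k} (hh : h ∈ lowDeg n k s)
    (hF : F ∈ lowDeg n k d) (hs : s + d ≤ s' + 1) : h * F ∈ lowDeg n k s' := by
  classical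
  refine mem_lowDeg.2 fun a ha => ?_
  obtain ⟨a₁, h₁, a₂, h₂, rfl⟩ := Finset.mem_add.1 (support_mul h F ha)
  have h3 := mem_lowDeg.1 hh _ h₁
  have h4 := mem_lowDeg.1 hF _ h₂
  rw [map_add]
  omega

lemma homogeneousComponent_self_homogeneous (s i : ℕ) (p : MvPolynomial (Fin n) k) :
    homogeneousComponent i (homogeneousComponent s p) =
      if i = s then homogeneousComponent s p else 0 :=
  homogeneousComponent_of_mem (homogeneousComponent_mem s p)

lemma sub_homogeneousComponent_mem {s : ℕ} {p : MvPolynomial (Fin n) k}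
    (hp : p ∈ lowDeg n k (s + 1)) : p - homogeneousComponent s p ∈ lowDeg n k s := by
  refine mem_lowDeg_of_succ (Submodule.sub_mem _ hp (homogeneousComponent_mem_lowDeg s p)) ?_
  rw [map_sub, homogeneousComponent_self_homogeneous, if_pos rfl, sub_self]

lemma homogeneousComponent_mul {s d : ℕ} {h F : MvPolynomial (Fin n) k}
    (hh : h ∈ lowDeg n k (s + 1)) (hF : F ∈ lowDeg n k (d + 1)) :
    homogeneousComponent (s + d) (h * F) = homogeneousComponent s h * homogeneousComponent d F := by
  have h1 : h * F = homogeneousComponent s h * homogeneousComponent d F +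
      (homogeneousComponent s h * (F - homogeneousComponent d F) +
        (h - homogeneousComponent s h) * F) := by ring
  have h2 : homogeneousComponent s h * (F - homogeneousComponent d F) +
      (h - homogeneousComponent s h) * F ∈ lowDeg n k (s + d) :=
    Submodule.add_mem _
      (mul_mem_lowDeg (homogeneousComponent_mem_lowDeg s h) (sub_homogeneousComponent_mem hF)
        (by omega))
      (mul_mem_lowDeg (sub_homogeneousComponent_mem hh) hF (by omega))
  rw [h1, map_add, homogeneousComponent_eq_zero_of_mem h2 le_rfl, add_zero,
    homogeneousComponent_eq_self]
  exact (homogeneousComponent_isHomogeneous s h).mul (homogeneousComponent_isHomogeneous d F)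

lemma homogeneousComponent_mul_homogeneous {d : ℕ} {F : MvPolynomial (Fin n) k}
    (hF : F.IsHomogeneous d) (w : MvPolynomial (Fin n) k) (s : ℕ) :
    homogeneousComponent s (w * F) =
      if d ≤ s then homogeneousComponent (s - d) w * F else 0 := by
  have h1 : ∀ i, homogeneousComponent s (homogeneousComponent i w * F) =
      if i + d = s then homogeneousComponent i w * F else 0 := fun i => by
    have := homogeneousComponent_of_mem (m := s)
      ((homogeneousComponent_isHomogeneous i w).mul hF)
    rw [this]
    exact if_congr eq_comm rfl rfl
  conv_lhs => rw [← sum_homogeneousComponent w, Finset.sum_mul, map_sum]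
  simp only [h1]
  split_ifs with h
  · rw [Finset.sum_eq_single (s - d), if_pos (by omega)]
    · intro i _ hi
      rw [if_neg (by omega)]
    · intro hi
      rw [if_pos (by omega), homogeneousComponent_eq_zero _ _ (by
        simp only [Finset.mem_range] at hi; omega), zero_mul]
  · exact Finset.sum_eq_zero fun i _ => if_neg (by omega)

/-- The leading forms of the elements of `I` are the homogeneous elements of `J`. -/
structure IsTopIdeal (I J : Ideal (MvPolynomial (Fin n) k)) : Prop where
  mem : ∀ s, ∀ p ∈ I, p ∈ lowDeg n k (s + 1) → homogeneousComponent s p ∈ J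
  lift : ∀ u ∈ J, ∀ s, ∃ p ∈ I, p ∈ lowDeg n k (s + 1) ∧
    homogeneousComponent s p = homogeneousComponent s u

lemma isTopIdeal_bot : IsTopIdeal (⊥ : Ideal (MvPolynomial (Fin n) k)) ⊥ where
  mem s p hp _ := by rw [(Submodule.mem_bot _).1 hp, map_zero]; exact zero_mem _
  lift u hu s := ⟨0, zero_mem _, zero_mem _, by rw [(Submodule.mem_bot _).1 hu]⟩

variable {I J : Ideal (MvPolynomial (Fin n) k)} {F : MvPolynomial (Fin n) k} {d : ℕ}

/-- If `g F ∈ I`, the product of the leading forms is in `J`, hence so is that of `g` by regularity.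
Subtracting an element of `I` with the same leading form lowers the degree of `g`. -/
lemma IsTopIdeal.mem_of_mul_mem (h : IsTopIdeal I J) (hF : F ∈ lowDeg n k (d + 1))
    (hreg : ∀ u, u * homogeneousComponent d F ∈ J → u ∈ J) (g : MvPolynomial (Fin n) k)
    (hg : g * F ∈ I) : g ∈ I := by
  suffices H : ∀ m, ∀ g ∈ lowDeg n k m, g * F ∈ I → g ∈ I from
    H _ g (mem_lowDeg_totalDegree g) hg
  intro m
  induction m with
  | zero =>
    intro g hg _
    rw [eq_zero_of_mem_lowDeg_zero hg]
    exact zero_mem _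
  | succ m ih =>
    intro g hg hgF
    have h1 := h.mem (m + d) _ hgF (mul_mem_lowDeg hg hF (by omega))
    rw [homogeneousComponent_mul hg hF] at h1
    obtain ⟨p, hpI, hp, hpg⟩ := h.lift _ (hreg _ h1) m
    rw [homogeneousComponent_self_homogeneous, if_pos rfl] at hpg
    have h2 : g - p ∈ I := ih (g - p) (mem_lowDeg_of_succ (Submodule.sub_mem _ hg hp)
      (by rw [map_sub, hpg, sub_self])) (by
        rw [sub_mul]; exact Submodule.sub_mem _ hgF (Ideal.mul_mem_right _ _ hpI))
    exact (Submodule.sub_mem_iff_left _ hpI).1 h2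

/-- If `g` has too large a degree, the leading form of `g F` cancels against `q`, so it is in `J`,
and so is that of `g`. Lifting the latter to `u ∈ I` and moving `u F` into `q` lowers the degree of
`g`. -/
lemma IsTopIdeal.exists_decomposition (h : IsTopIdeal I J) (hF : F ∈ lowDeg n k (d + 1))
    (hreg : ∀ u, u * homogeneousComponent d F ∈ J → u ∈ J) {s : ℕ} {p : MvPolynomial (Fin n) k}
    (hp : p ∈ lowDeg n k s) (hpI : p ∈ I ⊔ Ideal.span {F}) :
    ∃ q ∈ I, ∃ g ∈ lowDeg n k (s - d), p = q + g * F := by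
  suffices H : ∀ m, ∀ q ∈ I, ∀ g ∈ lowDeg n k m, p = q + g * F →
      ∃ q ∈ I, ∃ g ∈ lowDeg n k (s - d), p = q + g * F by
    obtain ⟨q, hq, r, hr, rfl⟩ := Submodule.mem_sup.1 hpI
    obtain ⟨g, rfl⟩ := Ideal.mem_span_singleton'.1 hr
    exact H _ q hq g (mem_lowDeg_totalDegree g) rfl
  intro m
  induction m with
  | zero => exact fun q hq g hg he => ⟨q, hq, g, lowDeg_mono (Nat.zero_le _) hg, he⟩
  | succ m ih =>
    intro q hq g hg he
    by_cases hm : m + 1 ≤ s - d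
    · exact ⟨q, hq, g, lowDeg_mono hm hg, he⟩
    have hgF : g * F ∈ lowDeg n k (m + d + 1) := mul_mem_lowDeg hg hF (by omega)
    have hqe : q = p - g * F := eq_sub_of_add_eq he.symm
    have h1 := h.mem (m + d) q hq (by
      rw [hqe]; exact Submodule.sub_mem _ (lowDeg_mono (by omega) hp) hgF)
    rw [hqe, map_sub, homogeneousComponent_eq_zero_of_mem hp (by omega), zero_sub,
      homogeneousComponent_mul hg hF] at h1
    obtain ⟨u, huI, hu, hug⟩ := h.lift _ (hreg _ ((Submodule.neg_mem_iff _).1 h1)) m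
    rw [homogeneousComponent_self_homogeneous, if_pos rfl] at hug
    refine ih (q + u * F) (Submodule.add_mem _ hq (Ideal.mul_mem_right _ _ huI)) (g - u)
      (mem_lowDeg_of_succ (Submodule.sub_mem _ hg hu) (by rw [map_sub, hug, sub_self])) ?_
    rw [he]; ring

/-- By the preceding decomposition, leading forms of `I + ⟨F⟩` arise without cancellation in higher
degrees. -/
lemma IsTopIdeal.sup (h : IsTopIdeal I J) (hF : F ∈ lowDeg n k (d + 1))
    (hreg : ∀ u, u * homogeneousComponent d F ∈ J → u ∈ J) :
    IsTopIdeal (I ⊔ Ideal.span {F}) (J ⊔ Ideal.span {homogeneousComponent d F}) where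
  mem s p hpI hp := by
    obtain ⟨q, hq, g, hg, rfl⟩ := h.exists_decomposition hF hreg hp hpI
    by_cases hs : d ≤ s
    · obtain ⟨m, rfl⟩ := Nat.exists_eq_add_of_le' hs
      rw [show m + d + 1 - d = m + 1 by omega] at hg
      have h1 : g * F ∈ lowDeg n k (m + d + 1) := mul_mem_lowDeg hg hF (by omega)
      have h2 : q ∈ lowDeg n k (m + d + 1) := (Submodule.add_mem_iff_left _ h1).1 hp
      rw [map_add, homogeneousComponent_mul hg hF]
      exact Submodule.add_mem _ (Submodule.mem_sup_left (h.mem _ q hq h2))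
        (Submodule.mem_sup_right (Ideal.mul_mem_left _ _ (Ideal.mem_span_singleton_self _)))
    · rw [show s + 1 - d = 0 by omega] at hg
      rw [eq_zero_of_mem_lowDeg_zero hg, zero_mul, add_zero] at hp ⊢
      exact Submodule.mem_sup_left (h.mem _ q hq hp)
  lift u hu s := by
    obtain ⟨u₁, hu₁, r, hr, rfl⟩ := Submodule.mem_sup.1 hu
    obtain ⟨w, rfl⟩ := Ideal.mem_span_singleton'.1 hr
    obtain ⟨p, hpI, hp, hpu⟩ := h.lift u₁ hu₁ s
    rw [map_add, homogeneousComponent_mul_homogeneous (homogeneousComponent_isHomogeneous d F)]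
    by_cases hs : d ≤ s
    · obtain ⟨m, rfl⟩ := Nat.exists_eq_add_of_le' hs
      have h1 := homogeneousComponent_mem_lowDeg m w
      refine ⟨p + homogeneousComponent m w * F, Submodule.add_mem _ (Submodule.mem_sup_left hpI)
        (Submodule.mem_sup_right (Ideal.mul_mem_left _ _ (Ideal.mem_span_singleton_self _))),
        Submodule.add_mem _ hp (mul_mem_lowDeg h1 hF (by omega)), ?_⟩
      rw [if_pos hs, map_add, homogeneousComponent_mul h1 hF, hpu,
        homogeneousComponent_self_homogeneous, if_pos rfl, Nat.add_sub_cancel]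
    · exact ⟨p, Submodule.mem_sup_left hpI, hp, by rw [if_neg hs, hpu, add_zero]⟩

lemma finite_setOf_degree_lt (n s : ℕ) : {a : Fin n →₀ ℕ | a.degree < s}.Finite :=
  (Finsupp.finite_of_degree_le s).subset fun a (h : a.degree < s) => le_of_lt h

instance (s : ℕ) : FiniteDimensional k (lowDeg n k s) := by
  have : Finite {a : Fin n →₀ ℕ | a.degree < s} := (finite_setOf_degree_lt n s).to_subtype
  exact Module.Finite.of_basis (basisRestrictSupport k {a : Fin n →₀ ℕ | a.degree < s})

/-- The elements of `I` of degree less than `s`. -/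
noncomputable def lowPart (I : Ideal (MvPolynomial (Fin n) k)) (s : ℕ) :
    Submodule k (MvPolynomial (Fin n) k) := I.restrictScalars k ⊓ lowDeg n k s

instance (I : Ideal (MvPolynomial (Fin n) k)) (s : ℕ) : FiniteDimensional k (lowPart I s) :=
  Submodule.finiteDimensional_of_le (inf_le_right : lowPart I s ≤ lowDeg n k s)

/-- The affine Hilbert function. -/
noncomputable def hilb (I : Ideal (MvPolynomial (Fin n) k)) (s : ℕ) : ℤ :=
  Module.finrank k (lowDeg n k s) - Module.finrank k (lowPart I s)

/-- Counting degrees strictly below `s` makes the truncated difference `s - d` harmless in the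
recursion. -/
lemma hilb_zero (I : Ideal (MvPolynomial (Fin n) k)) : hilb I 0 = 0 := by
  have h1 : lowDeg n k 0 = ⊥ := (Submodule.eq_bot_iff _).2 fun p hp =>
    eq_zero_of_mem_lowDeg_zero hp
  rw [hilb, lowPart, h1, inf_bot_eq, sub_self]

lemma mul_mem_lowDeg_sub {s : ℕ} {g : MvPolynomial (Fin n) k} (hg : g ∈ lowDeg n k (s - d))
    (hF : F ∈ lowDeg n k (d + 1)) : g * F ∈ lowDeg n k s := by
  by_cases hs : d ≤ s
  · exact mul_mem_lowDeg hg hF (by omega)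
  · rw [show s - d = 0 by omega] at hg
    rw [eq_zero_of_mem_lowDeg_zero hg, zero_mul]
    exact zero_mem _

/-- Dimension count in `0 → I_{<s-d} → I_{<s} × P_{<s-d} → (I + ⟨F⟩)_{<s} → 0`, with maps `g ↦ (-g
F, g)` and `(q, g) ↦ q + g F`. Surjectivity is the decomposition lemma; exactness in the middle says
that `F` is a nonzerodivisor modulo `I`. -/
theorem IsTopIdeal.hilb_sup (h : IsTopIdeal I J) (hF : F ∈ lowDeg n k (d + 1))
    (hreg : ∀ u, u * homogeneousComponent d F ∈ J → u ∈ J) (s : ℕ) :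
    hilb (I ⊔ Ideal.span {F}) s = hilb I s - hilb I (s - d) := by
  let φ : (lowPart I s × lowDeg n k (s - d)) →ₗ[k] lowPart (I ⊔ Ideal.span {F}) s :=
    LinearMap.codRestrict _
      (LinearMap.coprod (lowPart I s).subtype
        (LinearMap.mulRight k F ∘ₗ (lowDeg n k (s - d)).subtype))
      (by
        rintro ⟨⟨q, hq⟩, ⟨g, hg⟩⟩
        simp only [LinearMap.coprod_apply, Submodule.subtype_apply, LinearMap.comp_apply,
          LinearMap.mulRight_apply]
        exact ⟨Submodule.add_mem _ (Submodule.mem_sup_left hq.1)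
          (Submodule.mem_sup_right (Ideal.mul_mem_left _ _ (Ideal.mem_span_singleton_self _))),
          Submodule.add_mem _ hq.2 (mul_mem_lowDeg_sub hg hF)⟩)
  have hφ : ∀ x, (φ x : MvPolynomial (Fin n) k) = x.1.1 + x.2.1 * F := fun x => rfl
  have hsurj : LinearMap.range φ = ⊤ := by
    rw [LinearMap.range_eq_top]
    rintro ⟨p, hpI, hp⟩
    obtain ⟨q, hq, g, hg, rfl⟩ := h.exists_decomposition hF hreg hp hpI
    exact ⟨(⟨q, hq, (Submodule.add_mem_iff_left _ (mul_mem_lowDeg_sub hg hF)).1 hp⟩, ⟨g, hg⟩), rfl⟩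
  let ψ : lowPart I (s - d) →ₗ[k] (lowPart I s × lowDeg n k (s - d)) :=
    LinearMap.prod
      (LinearMap.codRestrict _ (-(LinearMap.mulRight k F ∘ₗ (lowPart I (s - d)).subtype)) (by
        rintro ⟨g, hgI, hg⟩
        refine Submodule.neg_mem _ ?_
        exact ⟨Ideal.mul_mem_right _ _ hgI, mul_mem_lowDeg_sub hg hF⟩))
      (Submodule.inclusion inf_le_right)
  have hψ1 : ∀ x, ((ψ x).1 : MvPolynomial (Fin n) k) = -(x.1 * F) := fun x => rfl
  have hψ2 : ∀ x, ((ψ x).2 : MvPolynomial (Fin n) k) = x.1 := fun x => rfl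
  have hinj : Function.Injective ψ := by
    intro x y hxy
    have := congrArg (fun z => (z.2 : MvPolynomial (Fin n) k)) hxy
    exact Subtype.ext this
  have hker : LinearMap.ker φ = LinearMap.range ψ := by
    ext x
    rw [LinearMap.mem_ker, LinearMap.mem_range]
    constructor
    · intro hx
      have h1 : x.1.1 + x.2.1 * F = 0 := by rw [← hφ, hx]; rfl
      have h2 : x.1.1 = -(x.2.1 * F) := eq_neg_of_add_eq_zero_left h1
      have h3 : x.2.1 * F ∈ I := by
        have := x.1.2.1
        rw [h2] at this
        exact (Submodule.neg_mem_iff _).1 this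
      refine ⟨⟨x.2.1, h.mem_of_mul_mem hF hreg _ h3, x.2.2⟩, ?_⟩
      exact Prod.ext (Subtype.ext h2.symm) (Subtype.ext rfl)
    · rintro ⟨y, rfl⟩
      apply Subtype.ext
      rw [hφ, hψ1, hψ2, neg_add_cancel]; rfl
  have h1 := LinearMap.finrank_range_add_finrank_ker φ
  rw [hsurj, finrank_top, hker, LinearMap.finrank_range_of_inj hinj, Module.finrank_prod] at h1
  rw [hilb, hilb, hilb]
  omega

/-- The equations are added one at a time; each contributes a factor `1 - X ^ deg`. Both assertions
go together because the next step needs regularity modulo the ideal of leading forms. -/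
lemma isTopIdeal_span {e : ℕ} (f : Fin e → MvPolynomial (Fin n) k) (hf : IsAffineRegular f) :
    ∀ i, (hi : i ≤ e) →
      IsTopIdeal (Ideal.span (f '' {j | j.1 < i})) (Ideal.span ((fun j => topForm (f j)) ''
        {j | j.1 < i})) ∧
      PowerSeries.mk (hilb (Ideal.span (f '' {j | j.1 < i}))) =
        (∏ j ∈ Finset.univ.filter (fun j : Fin e => j.1 < i),
          (1 - (PowerSeries.X : PowerSeries ℤ) ^ (f j).totalDegree)) *
        PowerSeries.mk (hilb (⊥ : Ideal (MvPolynomial (Fin n) k))) := by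
  intro i
  induction i with
  | zero =>
    intro _
    have h0 : {j : Fin e | j.1 < 0} = ∅ := by ext; simp
    rw [h0, Set.image_empty, Set.image_empty, Ideal.span_empty]
    refine ⟨isTopIdeal_bot, ?_⟩
    simp
  | succ i ih =>
    intro hi
    obtain ⟨h1, h2⟩ := ih (by omega)
    let a : Fin e := ⟨i, hi⟩
    have hset : {j : Fin e | j.1 < i + 1} = insert a {j | j.1 < i} := by
      ext j
      simp only [Set.mem_ofPred_eq, Set.mem_insert_iff, Fin.ext_iff, a]
      omega
    have hfin : Finset.univ.filter (fun j : Fin e => j.1 < i + 1) =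
        insert a (Finset.univ.filter fun j : Fin e => j.1 < i) := by
      ext j
      simp only [Finset.mem_filter, Finset.mem_univ, true_and, Finset.mem_insert, Fin.ext_iff, a]
      omega
    have hI : ∀ g : Fin e → MvPolynomial (Fin n) k, Ideal.span (g '' {j | j.1 < i + 1}) =
        Ideal.span (g '' {j | j.1 < i}) ⊔ Ideal.span {g a} := by
      intro g
      rw [hset, Set.image_insert_eq, Ideal.span_insert, sup_comm]
    have hreg : ∀ u, u * homogeneousComponent (f a).totalDegree (f a) ∈
        Ideal.span ((fun j => topForm (f j)) '' {j | j.1 < i}) →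
        u ∈ Ideal.span ((fun j => topForm (f j)) '' {j | j.1 < i}) := by
      intro u hu
      have h3 := hf.regular_mod_prev i (by simpa using hi)
      have h4 : (Ideal.ofList ((List.ofFn fun j => topForm (f j)).take i) •
          (⊤ : Submodule (MvPolynomial (Fin n) k) (MvPolynomial (Fin n) k))) =
          Ideal.span ((fun j => topForm (f j)) '' {j | j.1 < i}) := by
        rw [smul_eq_mul, Ideal.mul_top, Ideal.ofList]
        congr 1
        ext p
        simp only [Set.mem_ofPred_eq, List.mem_take_iff_getElem, List.length_ofFn,
          List.getElem_ofFn, Set.mem_image]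
        constructor
        · rintro ⟨j, hj, rfl⟩
          exact ⟨⟨j, by omega⟩, by show j < i; omega, rfl⟩
        · rintro ⟨j, hj, rfl⟩
          exact ⟨j.1, by omega, rfl⟩
      rw [h4] at h3
      rw [← Ideal.Quotient.eq_zero_iff_mem]
      apply h3
      beta_reduce
      rw [smul_zero, ← Ideal.Quotient.mk_eq_mk, ← Submodule.Quotient.mk_smul,
        Submodule.Quotient.mk_eq_zero]
      rw [List.getElem_ofFn, smul_eq_mul, mul_comm]
      exact hu
    have hF := mem_lowDeg_totalDegree (f a)
    refine ⟨?_, ?_⟩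
    · rw [hI f, hI fun j => topForm (f j)]
      exact h1.sup hF hreg
    · rw [hfin, Finset.prod_insert (by simp [a]), mul_assoc, ← h2, hI f]
      ext s
      rw [PowerSeries.coeff_mk, h1.hilb_sup hF hreg, sub_mul, one_mul, map_sub,
        PowerSeries.coeff_mk, PowerSeries.coeff_X_pow_mul']
      split_ifs with hs
      · rw [PowerSeries.coeff_mk]
      · rw [show s - (f a).totalDegree = 0 by omega, hilb_zero]

end Hilbert

/-! ### The Hilbert series in terms of standard monomials. -/

section HilbertSeries

variable {n : ℕ} {k : Type} [Field k]

/-- Rank and nullity of the map from polynomials of degree below `s` to the quotient, whose image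
has the `b j` of degree below `s` as a basis. -/
lemma hilb_eq_card {I : Ideal (MvPolynomial (Fin n) k)} {δ : ℕ} {b : Fin δ → Fin n →₀ ℕ}
    (hli : LinearIndependent k fun j => Ideal.Quotient.mk I (monomial (b j) (1 : k)))
    (hspan : ∀ a, Ideal.Quotient.mk I (monomial a (1 : k)) ∈
      Submodule.span k ((fun j => Ideal.Quotient.mk I (monomial (b j) (1 : k))) ''
        {j | (b j).degree ≤ a.degree})) (s : ℕ) :
    hilb I s = (Finset.univ.filter fun j => (b j).degree < s).card := by
  let π : lowDeg n k s →ₗ[k] (MvPolynomial (Fin n) k ⧸ I) :=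
    (Ideal.Quotient.mkₐ k I).toLinearMap ∘ₗ (lowDeg n k s).subtype
  have hπ : ∀ p, π p = Ideal.Quotient.mk I p.1 := fun p => rfl
  have hker : LinearMap.ker π =
      LinearMap.range (Submodule.inclusion (inf_le_right : lowPart I s ≤ lowDeg n k s)) := by
    ext p
    rw [LinearMap.mem_ker, hπ, Ideal.Quotient.eq_zero_iff_mem, LinearMap.mem_range]
    exact ⟨fun hp => ⟨⟨p.1, hp, p.2⟩, rfl⟩, by rintro ⟨q, rfl⟩; exact q.2.1⟩
  have hrange : LinearMap.range π = Submodule.span k (Set.range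
      fun j : {j // (b j).degree < s} => Ideal.Quotient.mk I (monomial (b j) (1 : k))) := by
    apply le_antisymm
    · rintro _ ⟨⟨p, hp⟩, rfl⟩
      rw [hπ]
      change Ideal.Quotient.mk I p ∈ _
      rw [p.as_sum, map_sum]
      refine Submodule.sum_mem _ fun a ha => ?_
      have h1 : Ideal.Quotient.mk I (monomial a (coeff a p)) =
          coeff a p • Ideal.Quotient.mk I (monomial a (1 : k)) := by
        rw [← mul_one (coeff a p), ← smul_eq_mul, ← smul_monomial]
        simp only [smul_eq_mul, mul_one]
        exact map_smul (Ideal.Quotient.mkₐ k I) _ _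
      rw [h1]
      refine Submodule.smul_mem _ _ (Submodule.span_mono ?_ (hspan a))
      rintro _ ⟨j, hj, rfl⟩
      exact ⟨⟨j, lt_of_le_of_lt hj (mem_lowDeg.1 hp a ha)⟩, rfl⟩
    · rw [Submodule.span_le]
      rintro _ ⟨⟨j, hj⟩, rfl⟩
      refine ⟨⟨monomial (b j) 1, mem_lowDeg.2 fun a ha => ?_⟩, rfl⟩
      rw [Finset.mem_singleton.1 (support_monomial_subset ha)]
      exact hj
  have hcard := finrank_span_eq_card (hli.comp
    (fun j : {j // (b j).degree < s} => j.1) Subtype.val_injective)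
  have h1 := LinearMap.finrank_range_add_finrank_ker π
  rw [hker, hrange, LinearMap.finrank_range_of_inj (Submodule.inclusion_injective _)] at h1
  rw [Fintype.card_subtype] at hcard
  simp only [Function.comp_def] at hcard
  rw [hcard] at h1
  rw [hilb, lowPart]
  omega

lemma hilb_bot_succ (s : ℕ) :
    hilb (⊥ : Ideal (MvPolynomial (Fin n) k)) (s + 1) = (n + s).choose n := by
  have h1 : lowPart (⊥ : Ideal (MvPolynomial (Fin n) k)) (s + 1) = ⊥ := by
    rw [lowPart, Submodule.restrictScalars_bot, bot_inf_eq]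
  have h2 : Module.finrank k (lowDeg n k (s + 1)) = Fintype.card (Mon n s) := by
    let e : Mon n s ≃ {a : Fin n →₀ ℕ | a.degree < s + 1} :=
      Equiv.subtypeEquivRight fun a => Nat.lt_succ_iff.symm
    exact Module.finrank_eq_card_basis
      ((basisRestrictSupport k {a : Fin n →₀ ℕ | a.degree < s + 1}).reindex e.symm)
  rw [hilb, h1, h2, finrank_bot, card_mon, Nat.choose_symm_add]
  simp

/-- The exponent is `n + 1` because degrees are cumulated; the factor `X` reflects the strict
inequality `deg < s`. -/
lemma hilb_bot_series : PowerSeries.mk (hilb (⊥ : Ideal (MvPolynomial (Fin n) k))) *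
    (1 - PowerSeries.X) ^ (n + 1) = PowerSeries.X := by
  have h1 : PowerSeries.mk (hilb (⊥ : Ideal (MvPolynomial (Fin n) k))) =
      PowerSeries.X * PowerSeries.mk fun s => ((n + s).choose n : ℤ) := by
    ext s
    cases s with
    | zero => simp [hilb_zero]
    | succ s => rw [PowerSeries.coeff_succ_X_mul, PowerSeries.coeff_mk, PowerSeries.coeff_mk,
        hilb_bot_succ]
  rw [h1, mul_assoc, PowerSeries.mk_add_choose_mul_one_sub_pow_eq_one, mul_one]

lemma one_sub_X_mul_step (m : ℕ) :
    (1 - PowerSeries.X) * PowerSeries.mk (fun s => if m < s then (1 : ℤ) else 0) =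
      PowerSeries.X ^ (m + 1) := by
  ext s
  rw [sub_mul, one_mul, map_sub, PowerSeries.coeff_mk, PowerSeries.coeff_X_pow]
  cases s with
  | zero => simp
  | succ s =>
    rw [PowerSeries.coeff_succ_X_mul, PowerSeries.coeff_mk]
    split_ifs <;> omega

lemma one_sub_X_mul_card {δ : ℕ} (m : Fin δ → ℕ) :
    (1 - PowerSeries.X) *
      PowerSeries.mk (fun s => ((Finset.univ.filter fun j => m j < s).card : ℤ)) =
      ∑ j, PowerSeries.X ^ (m j + 1) := by
  have h1 : PowerSeries.mk (fun s => ((Finset.univ.filter fun j => m j < s).card : ℤ)) =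
      ∑ j, PowerSeries.mk (fun s => if m j < s then (1 : ℤ) else 0) := by
    ext s
    rw [map_sum, PowerSeries.coeff_mk]
    simp only [PowerSeries.coeff_mk, Finset.sum_boole]
  rw [h1, Finset.mul_sum]
  exact Finset.sum_congr rfl fun j _ => one_sub_X_mul_step (m j)

/-- Both computations of the cumulative series carry the factor `X / (1 - X)`; cancelling it leaves
an identity of polynomials. -/
theorem IsAffineRegular.hilbert_series {e δ : ℕ} {f : Fin e → MvPolynomial (Fin n) k}
    (hf : IsAffineRegular f) {b : Fin δ → Fin n →₀ ℕ}
    (hli : LinearIndependent k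
      fun j => Ideal.Quotient.mk (Ideal.span (Set.range f)) (monomial (b j) (1 : k)))
    (hspan : ∀ a, Ideal.Quotient.mk (Ideal.span (Set.range f)) (monomial a (1 : k)) ∈
      Submodule.span k ((fun j => Ideal.Quotient.mk (Ideal.span (Set.range f))
        (monomial (b j) (1 : k))) '' {j | (b j).degree ≤ a.degree})) :
    ∏ i, (1 - (Polynomial.X : Polynomial ℤ) ^ (f i).totalDegree) =
      (1 - Polynomial.X) ^ n * ∑ j, Polynomial.X ^ (b j).degree := by
  have h1 := (isTopIdeal_span f hf e le_rfl).2
  have h2 : {j : Fin e | j.1 < e} = Set.univ := Set.eq_univ_of_forall fun j => j.2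
  have h3 : Finset.univ.filter (fun j : Fin e => j.1 < e) = Finset.univ :=
    Finset.filter_true_of_mem fun j _ => j.2
  rw [h2, h3, Set.image_univ, show hilb (Ideal.span (Set.range f)) = _ from
    funext (hilb_eq_card hli hspan)] at h1
  have h4 := congrArg (fun q => q * (1 - PowerSeries.X) ^ (n + 1)) h1
  simp only [mul_assoc, hilb_bot_series] at h4
  rw [pow_succ, ← mul_assoc, mul_comm, ← mul_assoc, mul_assoc, mul_comm, mul_assoc] at h4
  apply Polynomial.coe_injective
  have h5 : (PowerSeries.X : PowerSeries ℤ) ≠ 0 := PowerSeries.X_ne_zero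
  apply mul_right_cancel₀ h5
  rw [← Polynomial.coeToPowerSeries.ringHom_apply, ← Polynomial.coeToPowerSeries.ringHom_apply]
  simp only [map_prod, map_mul, map_pow, map_sub, map_one, map_sum,
    Polynomial.coeToPowerSeries.ringHom_apply, Polynomial.coe_X]
  have h6 := one_sub_X_mul_card fun j => (b j).degree
  have h7 : ∑ j, (PowerSeries.X : PowerSeries ℤ) ^ ((b j).degree + 1) =
      (∑ j, PowerSeries.X ^ (b j).degree) * PowerSeries.X := by
    simp only [pow_succ, Finset.sum_mul]
  rw [mul_assoc, ← h7, ← h6, ← h4]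
  ring

end HilbertSeries

end ParamHermite

namespace ParamHermite

/-! ### Numerical consequences of the Hilbert series. -/

section Numerics

open Polynomial

lemma eval_one_geom (d : ℕ) : (∑ i ∈ Finset.range d, (X : ℤ[X]) ^ i).eval 1 = d := by
  simp [eval_finsetSum]

lemma derivative_geom_eval_one (d : ℕ) :
    2 * (derivative (∑ i ∈ Finset.range d, (X : ℤ[X]) ^ i)).eval 1 = d * ((d - 1 : ℕ) : ℤ) := by
  rw [derivative_sum, eval_finsetSum]
  simp only [derivative_X_pow, eval_mul, eval_pow, eval_X, one_pow, mul_one, eval_C]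
  rw [← Nat.cast_mul, ← Finset.sum_range_id_mul_two]
  push_cast
  ring

lemma natDegree_geom_le (d : ℕ) :
    (∑ i ∈ Finset.range d, (X : ℤ[X]) ^ i).natDegree ≤ d - 1 :=
  natDegree_sum_le_of_forall_le _ _ fun i hi => by
    rw [natDegree_X_pow]
    have := Finset.mem_range.1 hi
    omega

/-- Numerical consequences of the formula for the Hilbert series of a regular sequence whose
quotient is finite dimensional. -/
theorem numerics_of_hilbert_series {e n δ : ℕ} {d : Fin e → ℕ} {m : Fin δ → ℕ} (hδ : 0 < δ)
    (h : ∏ i, (1 - (X : ℤ[X]) ^ d i) = (1 - X) ^ n * ∑ j, X ^ m j) :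
    e = n ∧ δ = ∏ i, d i ∧ (∀ j, m j ≤ ∑ i, (d i - 1)) ∧
      2 * ∑ j, m j = δ * ∑ i, (d i - 1) := by
  have hgeom : ∀ i, 1 - (X : ℤ[X]) ^ d i = (1 - X) * ∑ l ∈ Finset.range (d i), X ^ l := fun i =>
    (mul_neg_geom_sum _ _).symm
  have hX : (1 - X : ℤ[X]) ≠ 0 := by
    intro h0
    have := congrArg (eval 0) h0
    simp at this
  have hB : (∑ j, (X : ℤ[X]) ^ m j).eval 1 = δ := by simp [eval_finsetSum]
  have hδ' : (δ : ℤ) ≠ 0 := by exact_mod_cast hδ.ne'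
  simp only [hgeom, Finset.prod_mul_distrib, Finset.prod_const, Finset.card_univ,
    Fintype.card_fin] at h
  set Φ := ∏ i, ∑ l ∈ Finset.range (d i), (X : ℤ[X]) ^ l with hΦdef
  have hΦ : Φ.eval 1 = ∏ i, (d i : ℤ) := by
    rw [hΦdef, eval_prod]
    exact Finset.prod_congr rfl fun i _ => eval_one_geom (d i)
  have hΦ0 : Φ ≠ 0 := by
    intro h0
    rw [h0, mul_zero] at h
    rcases mul_eq_zero.1 h.symm with h1 | h1
    · exact pow_ne_zero _ hX h1
    · rw [h1, eval_zero] at hB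
      exact hδ' hB.symm
  have hd : ∀ i, d i ≠ 0 := fun i hi => hΦ0 (Finset.prod_eq_zero (Finset.mem_univ i) (by simp [hi]))
  have hΦ1 : Φ.eval 1 ≠ 0 := by
    rw [hΦ]
    exact Finset.prod_ne_zero_iff.2 fun i _ => by exact_mod_cast hd i
  -- Compare the orders of vanishing at `1`: neither remaining factor vanishes there.
  have hen : e = n := by
    rcases lt_trichotomy e n with h1 | h1 | h1
    · obtain ⟨r, rfl⟩ := Nat.exists_eq_add_of_lt h1
      rw [show e + r + 1 = e + (r + 1) by ring, pow_add, mul_assoc] at h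
      have h2 := mul_left_cancel₀ (pow_ne_zero _ hX) h
      exact absurd (by rw [h2]; simp) hΦ1
    · exact h1
    · obtain ⟨r, rfl⟩ := Nat.exists_eq_add_of_lt h1
      rw [show n + r + 1 = n + (r + 1) by ring, pow_add, mul_assoc] at h
      have h2 := mul_left_cancel₀ (pow_ne_zero _ hX) h
      rw [← h2] at hB
      exact absurd (by rw [← hB]; simp) hδ'
  subst hen
  have hΦB := mul_left_cancel₀ (pow_ne_zero _ hX) h
  have hδd : (δ : ℤ) = ∏ i, (d i : ℤ) := by rw [← hB, ← hΦB, hΦ]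
  refine ⟨rfl, by exact_mod_cast hδd, fun j => ?_, ?_⟩
  · have h1 : Φ.natDegree ≤ ∑ i, (d i - 1) :=
      (natDegree_prod_le _ _).trans (Finset.sum_le_sum fun i _ => natDegree_geom_le (d i))
    refine (le_natDegree_of_ne_zero ?_).trans h1
    rw [hΦB, finsetSum_coeff]
    simp only [Polynomial.coeff_X_pow, Finset.sum_boole]
    exact_mod_cast (Finset.card_pos.2 ⟨j, by simp⟩).ne'
  -- The derivative at `1` is the sum of the exponents; the product rule evaluates it from the
  -- geometric factors.
  · have h1 : (derivative Φ).eval 1 = ∑ j, (m j : ℤ) := by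
      rw [hΦB, derivative_sum, eval_finsetSum]
      refine Finset.sum_congr rfl fun j _ => ?_
      rw [derivative_X_pow, eval_mul, eval_C, eval_pow, eval_X, one_pow, mul_one]
    have h2 : 2 * (derivative Φ).eval 1 = (∏ i, (d i : ℤ)) * ∑ i, ((d i - 1 : ℕ) : ℤ) := by
      classical
      rw [hΦdef, derivative_prod_finset, eval_finsetSum, Finset.mul_sum, Finset.mul_sum]
      refine Finset.sum_congr rfl fun i _ => ?_
      rw [eval_mul, eval_prod, mul_left_comm, derivative_geom_eval_one]
      simp only [eval_one_geom]
      rw [← mul_assoc, Finset.prod_erase_mul _ _ (Finset.mem_univ i)]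
    rw [h1, ← hδd] at h2
    exact_mod_cast h2

end Numerics

end ParamHermite

namespace ParamHermite
open MvPolynomial

/-! ### Number and degrees of the standard monomials. -/

section System

variable {n t e δ d : ℕ} {f : Fin e → PolyXY n t} {G : Set (PolyXY n t)}
  {b : Fin δ → Fin n →₀ ℕ}

lemma totalDegree_toKx_le (p : PolyXY n t) : (toKx n t p).totalDegree ≤ p.totalDegree := by
  refine Finset.sup_le fun a ha => ?_
  obtain ⟨s, hs, rfl⟩ := (mem_support_toKx p a).1 ha
  exact (Nat.le_add_right _ _).trans ((degree_eq_parts s).symm.trans_le (le_totalDegree hs))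

/-- The case `δ = 0` is separate: both sides of the Hilbert series identity are then zero and do not
determine `e`. -/
theorem IsRegularSystem.numerics (h : IsRegularSystem d f G b) (hd : 1 ≤ d) :
    δ ≤ d ^ n ∧ (∀ j, (b j).degree ≤ lam n d) ∧ 2 * ∑ j, (b j).degree ≤ d ^ n * lam n d := by
  rcases Nat.eq_zero_or_pos δ with rfl | hδ
  · exact ⟨Nat.zero_le _, fun j => j.elim0, by simp⟩
  obtain ⟨rfl, h1, h2, h3⟩ := numerics_of_hilbert_series hδ
    (h.regular.hilbert_series (linearIndependent_clsMon h) (clsMon_mem_span h))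
  have hdeg : ∀ i, (toKx e t (f i)).totalDegree ≤ d := fun i =>
    (totalDegree_toKx_le _).trans (h.degree_le i)
  have h4 : δ ≤ d ^ e := by
    rw [h1]
    exact (Finset.prod_le_pow_card _ _ _ fun i _ => hdeg i).trans_eq (by simp)
  have h5 : ∑ i, ((toKx e t (f i)).totalDegree - 1) ≤ lam e d := by
    refine (Finset.sum_le_card_nsmul _ _ (d - 1) fun i _ => ?_).trans_eq (by simp [lam])
    have := hdeg i
    omega
  exact ⟨h4, fun j => (h2 j).trans h5, h3.trans_le (Nat.mul_le_mul h4 h5)⟩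

end System

/-! ### Products of matrices of polynomials and their minors -/

section MatrixPrograms

variable {Ω : Type} {K : Set (Ω → ℚ)} {δ t : ℕ} {c : ℝ}

/-- The dense representation of a family of matrices of polynomials is known. -/
def KnownCoeffs (K : Set (Ω → ℚ)) (D : ℕ)
    (M : Ω → Matrix (Fin δ) (Fin δ) (MvPolynomial (Fin t) ℚ)) : Prop :=
  (∀ ω i j, (M ω i j).totalDegree ≤ D) ∧ ∀ i j m, (fun ω => densePoly D (M ω i j) m) ∈ K

lemma KnownCoeffs.mono {K' : Set (Ω → ℚ)} {D : ℕ}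
    {M : Ω → Matrix (Fin δ) (Fin δ) (MvPolynomial (Fin t) ℚ)} (h : KnownCoeffs K D M)
    (hK : K ⊆ K') : KnownCoeffs K' D M :=
  ⟨h.1, fun i j m => hK (h.2 i j m)⟩

lemma KnownCoeffs.reach_eval {D : ℕ} {M : Ω → Matrix (Fin δ) (Fin δ) (MvPolynomial (Fin t) ℚ)}
    (h : KnownCoeffs K D M) (x : Fin t → ℚ) :
    Reach K (entries fun ω => (M ω).map (eval x)) (δ * δ * (2 * Fintype.card (Mon t D))) := by
  have := Reach.matrix (K := K) (A := fun ω => (M ω).map (eval x)) fun i j =>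
    ParamHermite.reach_eval (fun ω => M ω i j) (fun ω => h.1 ω i j) (fun m => h.2 i j m) x
  rwa [Fintype.card_fin] at this

variable {D₁ D₂ : ℕ} {M N : Ω → Matrix (Fin δ) (Fin δ) (MvPolynomial (Fin t) ℚ)}

/-- The cost of the values of a product at a point. -/
noncomputable def evalCost (δ t D₁ D₂ : ℕ) (c : ℝ) : ℝ :=
  δ * δ * (2 * Fintype.card (Mon t D₁)) + (δ * δ * (2 * Fintype.card (Mon t D₂)) + c)

lemma reach_eval_mul (hM : KnownCoeffs K D₁ M) (hN : KnownCoeffs K D₂ N)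
    (hc : MulCost (Fin δ) c) (x : Fin t → ℚ) :
    Reach K (entries fun ω => (M ω * N ω).map (eval x)) (evalCost δ t D₁ D₂ c) := by
  simp only [Matrix.map_mul]
  exact Reach.bindMat (hM.reach_eval x) fun K₁ h₁ k₁ =>
    Reach.bindMat ((hN.mono h₁).reach_eval x) fun K₂ h₂ k₂ => hc Ω K₂ _ _ (k₁.mono h₂) k₂

/-- The coefficients of a product of matrices of polynomials. -/
theorem reach_coeffs_mul (hM : KnownCoeffs K D₁ M) (hN : KnownCoeffs K D₂ N)
    (hc : MulCost (Fin δ) c) {D : ℕ} (hD : ∀ ω i j, ((M ω * N ω) i j).totalDegree ≤ D) :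
    Reach K (Set.range fun x ω => denseMat D (M ω * N ω) x)
      (Fintype.card (Mon t D) * (evalCost δ t D₁ D₂ c + δ * δ * (4 * (t * (D + 1))))) := by
  have h1 := Reach.iUnion (K := K)
    (fun a : Mon t D => entries fun ω => (M ω * N ω).map (eval fun i => (a.1 i : ℚ))) _
    fun a => reach_eval_mul hM hN hc _
  have h2 := Reach.iUnion (K := K ∪ ⋃ a : Mon t D,
      entries fun ω => (M ω * N ω).map (eval fun i => (a.1 i : ℚ)))
    (fun x : Fin δ × Fin δ =>
      Set.range fun (a : Mon t D) ω => densePoly D ((M ω * N ω) x.1 x.2) a) _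
    fun x => reach_interpolate (fun ω => (M ω * N ω) x.1 x.2) (fun ω => hD ω _ _) fun a =>
      Or.inr (Set.mem_iUnion.2 ⟨a, x, rfl⟩)
  refine ((h1.bind h2).mono subset_rfl ?_).le (le_of_eq ?_)
  · rintro _ ⟨x, rfl⟩
    exact Set.mem_iUnion.2 ⟨(x.1, x.2.1), x.2.2, rfl⟩
  · rw [Fintype.card_prod, Fintype.card_fin]
    push_cast
    ring

/-- Matrices of size at most `2 ^ m` can be padded to that size. -/
lemma exists_padding {m k : ℕ} (h : k ≤ 2 ^ m) :
    ∃ (s : Type) (_ : Fintype s) (_ : DecidableEq s), Nonempty (Fin k ⊕ s ≃ Idx m) :=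
  ⟨Fin (2 ^ m - k), inferInstance, inferInstance, ⟨finSumFinEquiv.trans
    ((finCongr (by omega)).trans (Fintype.equivFinOfCardEq (Idx.card m)).symm)⟩⟩

/-- Padding with an identity block keeps the determinant and is free, since its entries are
constants. -/
lemma reach_det_of_le {q μ : ℝ} (hq : 4 ≤ q) (hq8 : q ≤ 8) (hμ : 0 ≤ μ)
    (hmul : ∀ k, MulCost (Idx k) (μ * q ^ k)) {m k : ℕ} (h : k ≤ 2 ^ m)
    {A : Ω → Matrix (Fin k) (Fin k) ℚ} (hA : Known K A) :
    Reach K {fun ω => (A ω).det} ((19 * μ + 13) * q ^ m) := by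
  obtain ⟨s, _, _, ⟨e⟩⟩ := exists_padding h
  let B : Ω → SqMat m := fun ω => (Matrix.fromBlocks (A ω) 0 0 (1 : Matrix s s ℚ)).submatrix
    e.symm e.symm
  have hB : ∀ ω, (B ω).det = (A ω).det := fun ω => by
    rw [Matrix.det_submatrix_equiv_self, Matrix.det_fromBlocks_zero₂₁, Matrix.det_one, mul_one]
  simp only [← hB]
  have hent : Reach K (entries B) 0 := by
    have : Reach (K ∪ {fun _ => (0 : ℚ)} ∪ {fun _ => (1 : ℚ)}) (entries B) 0 := by
      refine Reach.of_subset ?_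
      rintro _ ⟨⟨i, j⟩, rfl⟩
      rcases hi : e.symm i with i' | i' <;> rcases hj : e.symm j with j' | j'
      · left; left; simpa [B, hi, hj] using hA i' j'
      · left; right; simp [B, hi, hj]
      · left; right; simp [B, hi, hj]
      · by_cases hij : i' = j'
        · right; simp [B, hi, hj, hij]
        · left; right; simp [B, hi, hj, hij]
    have h2 := (Reach.const (K := K ∪ {fun _ => (0 : ℚ)}) 1).bind this
    simpa using (Reach.const (K := K) 0).bind h2
  refine (hent.bindMat fun K' _ hK' => SqMat.reach_det hq hq8 hμ hmul m Ω K' B hK').le (by simp)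

/-- The coefficients of a minor of a product of matrices of polynomials. -/
theorem reach_coeffs_minor {q μ : ℝ} (hq : 4 ≤ q) (hq8 : q ≤ 8) (hμ : 0 ≤ μ)
    (hmul : ∀ k, MulCost (Idx k) (μ * q ^ k)) (hM : KnownCoeffs K D₁ M) (hN : KnownCoeffs K D₂ N)
    (hc : MulCost (Fin δ) c) {m k : ℕ} (h : k ≤ 2 ^ m) (r s : Fin k → Fin δ) {D : ℕ}
    (hD : ∀ ω, ((M ω * N ω).submatrix r s).det.totalDegree ≤ D) :
    Reach K (Set.range fun x ω => densePoly D ((M ω * N ω).submatrix r s).det x)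
      (Fintype.card (Mon t D) *
        (evalCost δ t D₁ D₂ c + (19 * μ + 13) * q ^ m + 4 * (t * (D + 1)))) := by
  have h1 := Reach.range (K := K)
    (fun (a : Mon t D) ω => eval (fun i => (a.1 i : ℚ)) ((M ω * N ω).submatrix r s).det)
    (evalCost δ t D₁ D₂ c + (19 * μ + 13) * q ^ m) fun a => by
      refine (reach_eval_mul hM hN hc fun i => (a.1 i : ℚ)).bindMat fun K' _ hK' => ?_
      have h2 : ∀ ω, eval (fun i => (a.1 i : ℚ)) ((M ω * N ω).submatrix r s).det =
          (((M ω * N ω).map (eval fun i => (a.1 i : ℚ))).submatrix r s).det := fun ω => by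
        rw [RingHom.map_det]; rfl
      simp only [h2]
      exact reach_det_of_le hq hq8 hμ hmul h fun i j => hK' (r i) (s j)
  have h2 := reach_interpolate (K := K ∪ Set.range
      fun (a : Mon t D) ω => eval (fun i => (a.1 i : ℚ)) ((M ω * N ω).submatrix r s).det)
    (fun ω => ((M ω * N ω).submatrix r s).det) hD fun a => Or.inr ⟨a, rfl⟩
  exact (h1.bind h2).le (le_of_eq (by ring))

end MatrixPrograms

/-! ### Degree bounds and programs for Hermite matrices -/

/-- Every term of the Leibniz formula uses each row weight and each column weight exactly once. -/
lemma totalDegree_det_le {t k : ℕ} {A : Matrix (Fin k) (Fin k) (MvPolynomial (Fin t) ℚ)} {a : ℕ}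
    {u v : Fin k → ℕ} (h : ∀ i j, (A i j).totalDegree ≤ a + u i + v j) :
    A.det.totalDegree ≤ k * a + ∑ i, u i + ∑ i, v i := by
  rw [Matrix.det_apply]
  refine totalDegree_finsetSum_le fun σ _ => ?_
  have h1 : (Equiv.Perm.sign σ • ∏ i, A (σ i) i).totalDegree ≤ (∏ i, A (σ i) i).totalDegree := by
    rcases Int.units_eq_one_or (Equiv.Perm.sign σ) with h | h <;> simp [h]
  refine h1.trans ((totalDegree_finsetProd _ _).trans ?_)
  refine (Finset.sum_le_sum fun i _ => h (σ i) i).trans (le_of_eq ?_)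
  rw [Finset.sum_add_distrib, Finset.sum_add_distrib, Equiv.sum_comp σ u]
  simp

lemma sum_comp_embedding_le {δ k : ℕ} (r : Fin k ↪ Fin δ) (u : Fin δ → ℕ) :
    ∑ i, u (r i) ≤ ∑ j, u j := by
  rw [← Finset.sum_map Finset.univ r u]
  exact Finset.sum_le_sum_of_subset (Finset.subset_univ _)

/-- Used to absorb the `t (D + 1)` operations per interpolation node into the number of monomials.
-/
lemma one_add_mul_le_choose (t D : ℕ) : 1 + t * D ≤ (t + D).choose t := by
  induction t generalizing D with
  | zero => simp
  | succ t iht =>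
    induction D with
    | zero => simp
    | succ D ihD =>
      have h1 := iht (D + 1)
      have h2 : (t + 1 + (D + 1)).choose (t + 1) =
          (t + (D + 1)).choose t + (t + 1 + D).choose (t + 1) := by
        rw [show t + 1 + (D + 1) = (t + (D + 1)) + 1 by ring, Nat.choose_succ_succ,
          show t + (D + 1) = t + 1 + D by ring]
      rw [h2]
      nlinarith

section System

variable {n t e δ d dg : ℕ} {f : Fin e → PolyXY n t} {G : Set (PolyXY n t)}
  {b : Fin δ → Fin n →₀ ℕ}

lemma overK_injective : Function.Injective
    (overK : Matrix (Fin δ) (Fin δ) (MvPolynomial (Fin t) ℚ) → _) := fun _ _ h =>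
  Matrix.map_injective (toK_injective t) h

/-- Hence `d + λ ≤ d_g + 2 λ`, and an entry of `L_h` is no dearer to evaluate than one of `H_{g'}`.
-/
lemma d_le_lam (hn : 2 ≤ n) (hd : 2 ≤ d) : d ≤ lam n d := by
  have : 2 * (d - 1) ≤ n * (d - 1) := Nat.mul_le_mul_right _ hn
  rw [lam]
  omega

/-- Hermite matrices and multiplication matrices of a regular system. -/
theorem IsRegularSystem.exists_matrices (hS : IsRegularSystem d f G b) (hd : 1 ≤ d)
    {g g' h : PolyXY n t} (hg : g = g' * h) (hg0 : g ≠ 0) (hgd : g.totalDegree ≤ dg)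
    (hh : h.totalDegree ≤ d) :
    ∃ (β : Module.Basis (Fin δ) (ParamField t) (QuotAlg f))
      (H' L : Matrix (Fin δ) (Fin δ) (MvPolynomial (Fin t) ℚ)),
      (∀ i, β i = clsMon f (b i)) ∧
      overK (H' * L) = hermiteMatrix f b g ∧
      overK H' = hermiteMatrix f b g' ∧
      overK L = Algebra.leftMulMatrix β (cls f h) ∧
      (∀ i j, ((H' * L) i j).totalDegree ≤ dg + 2 * lam n d) ∧
      (∀ i j, (H' i j).totalDegree ≤ dg + 2 * lam n d) ∧
      (∀ i j, (L i j).totalDegree ≤ d + lam n d) ∧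
      ∀ k (r c : Fin k ↪ Fin δ),
        (((H' * L).submatrix r c).det).totalDegree ≤ (dg + lam n d) * d ^ n := by
  obtain ⟨β, hβ⟩ := exists_basis hS
  obtain ⟨H, hH, hHd⟩ := exists_hermite hS g
  obtain ⟨H', hH', hHd'⟩ := exists_hermite hS g'
  obtain ⟨L, hL, hLd⟩ := exists_mulMatrix hS β hβ h
  obtain ⟨hδ, hb, hsum⟩ := hS.numerics hd
  have hHL : H = H' * L := by
    apply overK_injective
    rw [hH, hg, hermiteMatrix_mul β hβ, ← hH', ← hL, overK, overK, overK, Matrix.map_mul]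
  -- Degrees add in a domain, and `g ≠ 0` makes both factors nonzero.
  have hgd' : g'.totalDegree ≤ dg := by
    rw [hg] at hg0 hgd
    rw [totalDegree_mul_of_isDomain (left_ne_zero_of_mul hg0) (right_ne_zero_of_mul hg0)] at hgd
    omega
  rw [hHL] at hH hHd
  refine ⟨β, H', L, hβ, hH, hH', hL, fun i j => ?_, fun i j => ?_, fun i j => ?_, fun k r c => ?_⟩
  · have := hHd i j; have := hb i; have := hb j; omega
  · have := hHd' i j; have := hb i; have := hb j; omega
  · have := hLd i j; have := hb j; omega
  · have h1 := totalDegree_det_le (A := (H' * L).submatrix r c) (a := dg)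
      (u := fun i => (b (r i)).degree) (v := fun i => (b (c i)).degree) fun i j => by
        have := hHd (r i) (c j)
        rw [Matrix.submatrix_apply]
        omega
    have h2 := sum_comp_embedding_le r fun j => (b j).degree
    have h3 := sum_comp_embedding_le c fun j => (b j).degree
    have hk : k ≤ d ^ n := (by simpa using Fintype.card_le_of_embedding r : k ≤ δ).trans hδ
    have h4 : k * dg ≤ d ^ n * dg := Nat.mul_le_mul_right _ hk
    have h5 : (dg + lam n d) * d ^ n = d ^ n * dg + d ^ n * lam n d := by ring
    omega

end System

/-! ### Uniform programs and their cost in terms of `n`, `t`, `d`, `d_g`. -/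

section Programs

variable {ω μ : ℝ}

lemma IsAdmissibleExponent.exists_mulCost (hω : IsAdmissibleExponent ω) :
    ∃ μ : ℝ, 0 ≤ μ ∧ ∀ m : ℕ, MulCost (Fin m) (μ * (m : ℝ) ^ ω) := by
  obtain ⟨C, hC⟩ := hω
  refine ⟨max C 0, le_max_right _ _, fun m => ?_⟩
  obtain ⟨P, hP, hP'⟩ := hC m
  exact mulCost_fin P (hP.trans (mul_le_mul_of_nonneg_right (le_max_left _ _)
    (Real.rpow_nonneg (Nat.cast_nonneg _) _))) hP'

lemma two_pow_rpow (ω : ℝ) (k : ℕ) : ((2 : ℝ) ^ k) ^ ω = ((2 : ℝ) ^ ω) ^ k := by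
  rw [← Real.rpow_natCast, ← Real.rpow_natCast, ← Real.rpow_mul zero_le_two,
    ← Real.rpow_mul zero_le_two, mul_comm]

lemma mulCost_idx (hμ : ∀ m : ℕ, MulCost (Fin m) (μ * (m : ℝ) ^ ω)) (k : ℕ) :
    MulCost (Idx k) (μ * ((2 : ℝ) ^ ω) ^ k) := by
  have := (hμ (2 ^ k)).equiv (Fintype.equivFinOfCardEq (Idx.card k))
  rwa [Nat.cast_pow, Nat.cast_ofNat, two_pow_rpow] at this

/-- Pairs of matrices of polynomials with bounded degrees. -/
def BoundedPair (δ t D₁ D₂ D : ℕ) : Type :=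
  {M : Matrix (Fin δ) (Fin δ) (MvPolynomial (Fin t) ℚ) ×
      Matrix (Fin δ) (Fin δ) (MvPolynomial (Fin t) ℚ) //
    (∀ i j, (M.1 i j).totalDegree ≤ D₁) ∧ (∀ i j, (M.2 i j).totalDegree ≤ D₂) ∧
    (∀ i j, ((M.1 * M.2) i j).totalDegree ≤ D₁) ∧
    ∀ k (r c : Fin k ↪ Fin δ), (((M.1 * M.2).submatrix r c).det).totalDegree ≤ D}

variable {δ t D₁ D₂ D : ℕ}

/-- The dense representation of a pair of matrices. -/
noncomputable def BoundedPair.dense :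
    MatIdx δ t D₁ ⊕ MatIdx δ t D₂ → BoundedPair δ t D₁ D₂ D → ℚ :=
  Sum.elim (fun x M => denseMat D₁ M.1.1 x) (fun x M => denseMat D₂ M.1.2 x)

lemma BoundedPair.dense_eq (M : BoundedPair δ t D₁ D₂ D) :
    (fun x => dense x M) = Sum.elim (denseMat D₁ M.1.1) (denseMat D₂ M.1.2) := by
  funext x
  rcases x with x | x <;> rfl

lemma BoundedPair.known_fst :
    KnownCoeffs (Set.range dense) D₁ fun M : BoundedPair δ t D₁ D₂ D => M.1.1 :=
  ⟨fun M => M.2.1, fun i j m => ⟨Sum.inl (i, j, m), rfl⟩⟩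

lemma BoundedPair.known_snd :
    KnownCoeffs (Set.range dense) D₂ fun M : BoundedPair δ t D₁ D₂ D => M.1.2 :=
  ⟨fun M => M.2.2.1, fun i j m => ⟨Sum.inr (i, j, m), rfl⟩⟩

variable {n d dg : ℕ}

lemma evalCost_le (hn : 2 ≤ n) (hd : 2 ≤ d) (hω : 0 ≤ ω) (hμ : 0 ≤ μ) (hδ : δ ≤ d ^ n) :
    evalCost δ t (dg + 2 * lam n d) (d + lam n d) (μ * (δ : ℝ) ^ ω) ≤
      4 * ((d : ℝ) ^ (2 * n) * trinom t dg (2 * lam n d)) + μ * (d : ℝ) ^ (ω * n) := by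
  have h1 : (Fintype.card (Mon t (dg + 2 * lam n d)) : ℝ) = trinom t dg (2 * lam n d) := by
    rw [card_mon, trinom, add_assoc]
  have h2 : (Fintype.card (Mon t (d + lam n d)) : ℝ) ≤ trinom t dg (2 * lam n d) := by
    rw [card_mon, trinom, add_assoc]
    have := d_le_lam hn hd
    exact_mod_cast Nat.choose_le_choose t (by omega)
  have h3 : (δ : ℝ) ≤ (d : ℝ) ^ n := by exact_mod_cast hδ
  have h4 : (δ : ℝ) * δ ≤ (d : ℝ) ^ (2 * n) := by
    rw [two_mul, pow_add]
    exact mul_le_mul h3 h3 (Nat.cast_nonneg _) (by positivity)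
  have h5 : (δ : ℝ) ^ ω ≤ (d : ℝ) ^ (ω * n) := by
    rw [mul_comm, Real.rpow_mul (Nat.cast_nonneg _), Real.rpow_natCast]
    exact Real.rpow_le_rpow (Nat.cast_nonneg _) h3 hω
  have h6 := mul_le_mul h4 h2 (Nat.cast_nonneg _) (by positivity)
  have h7 := mul_le_mul_of_nonneg_right h4 (Nat.cast_nonneg (trinom t dg (2 * lam n d)) : (0 : ℝ) ≤ _)
  have h8 := mul_le_mul_of_nonneg_left h5 hμ
  rw [evalCost, h1]
  linarith

/-- Rounding up to a power of two at most doubles the size, which costs a factor `2 ^ ω ≤ 8`. -/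
lemma exists_padding_exponent (ω : ℝ) (hω₀ : 0 ≤ ω) (hω₃ : ω ≤ 3) {d : ℕ} (hd : 1 ≤ d) (n : ℕ) :
    ∃ m : ℕ, d ^ n ≤ 2 ^ m ∧ ((2 : ℝ) ^ ω) ^ m ≤ 8 * (d : ℝ) ^ (ω * n) := by
  refine ⟨Nat.log 2 (d ^ n) + 1, (Nat.lt_pow_succ_log_self one_lt_two _).le, ?_⟩
  have h1 : 2 ^ (Nat.log 2 (d ^ n)) ≤ d ^ n := Nat.pow_log_le_self 2 (by positivity)
  have h2 : ((2 : ℝ) ^ Nat.log 2 (d ^ n)) ^ ω ≤ (d : ℝ) ^ (ω * n) := by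
    rw [mul_comm, Real.rpow_mul (Nat.cast_nonneg _), Real.rpow_natCast]
    exact Real.rpow_le_rpow (by positivity) (by exact_mod_cast h1) hω₀
  have h3 : (2 : ℝ) ^ ω ≤ 8 := by
    refine (Real.rpow_le_rpow_of_exponent_le one_le_two hω₃).trans_eq ?_
    norm_num
  rw [pow_succ, mul_comm, ← two_pow_rpow]
  exact mul_le_mul h3 h2 (by positivity) (by norm_num)

lemma mul_succ_le_two_mul {t D T : ℕ} (hD : 1 ≤ D) (hT : t * D ≤ T) : t * (D + 1) ≤ 2 * T := by
  nlinarith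

lemma mul_le_trinom : t * (dg + 2 * lam n d) ≤ trinom t dg (2 * lam n d) := by
  have := one_add_mul_le_choose t (dg + 2 * lam n d)
  rw [trinom, add_assoc]
  omega

/-- The program for the product. -/
theorem exists_matrix_program (hn : 2 ≤ n) (hd : 2 ≤ d) (hω : 0 ≤ ω) (hμ : 0 ≤ μ)
    (hmul : ∀ m : ℕ, MulCost (Fin m) (μ * (m : ℝ) ^ ω)) (hδ : δ ≤ d ^ n) (D : ℕ) :
    ∃ P : CompTree (MatIdx δ t (dg + 2 * lam n d) ⊕ MatIdx δ t (d + lam n d))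
        (MatIdx δ t (dg + 2 * lam n d)),
      (P.cost : ℝ) ≤ (12 + μ) * matrixBound ω n t d dg ∧
      ∀ M : BoundedPair δ t (dg + 2 * lam n d) (d + lam n d) D,
        P.run (Sum.elim (denseMat _ M.1.1) (denseMat _ M.1.2)) = denseMat _ (M.1.1 * M.1.2) := by
  obtain ⟨P, hP, hP'⟩ := (reach_coeffs_mul
    (BoundedPair.known_fst (δ := δ) (t := t) (D₁ := dg + 2 * lam n d) (D₂ := d + lam n d) (D := D))
    BoundedPair.known_snd (hmul δ) fun M => M.2.2.2.1).exists_tree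
  refine ⟨P, hP.trans ?_, fun M => ?_⟩
  · have hlam := d_le_lam hn hd
    have h1 : (Fintype.card (Mon t (dg + 2 * lam n d)) : ℝ) = trinom t dg (2 * lam n d) := by
      rw [card_mon, trinom, add_assoc]
    have h2 : (t : ℝ) * (((dg + 2 * lam n d : ℕ) : ℝ) + 1) ≤ 2 * trinom t dg (2 * lam n d) := by
      exact_mod_cast mul_succ_le_two_mul (by omega) (mul_le_trinom (t := t))
    have h3 : (δ : ℝ) ≤ (d : ℝ) ^ n := by exact_mod_cast hδ
    have h4 : (δ : ℝ) * δ ≤ (d : ℝ) ^ (2 * n) := by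
      rw [two_mul, pow_add]
      exact mul_le_mul h3 h3 (Nat.cast_nonneg _) (by positivity)
    have h5 := evalCost_le (t := t) (dg := dg) hn hd hω hμ hδ
    have h6 := mul_le_mul h4 h2 (by positivity) (by positivity)
    -- Of the constant `12`, evaluation accounts for `4` and interpolation for `8`; `μ` is the
    -- matrix product.
    rw [h1, matrixBound, mul_left_comm (12 + μ)]
    refine mul_le_mul_of_nonneg_left ?_ (Nat.cast_nonneg (α := ℝ) _)
    have h7 : 0 ≤ (d : ℝ) ^ (2 * n) * trinom t dg (2 * lam n d) := by positivity
    have h8 : 0 ≤ (d : ℝ) ^ (ω * n) := by positivity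
    nlinarith [mul_nonneg hμ h7]
  · have := hP' M
    rwa [BoundedPair.dense_eq] at this

/-- The program for a minor of the product. -/
theorem exists_minor_program (hn : 2 ≤ n) (hd : 2 ≤ d) (hω₂ : 2 ≤ ω) (hω₃ : ω ≤ 3) (hμ : 0 ≤ μ)
    (hmul : ∀ m : ℕ, MulCost (Fin m) (μ * (m : ℝ) ^ ω)) (hδ : δ ≤ d ^ n) {k : ℕ}
    (r c : Fin k ↪ Fin δ) :
    ∃ P : CompTree (MatIdx δ t (dg + 2 * lam n d) ⊕ MatIdx δ t (d + lam n d))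
        (Mon t ((dg + lam n d) * d ^ n)),
      (P.cost : ℝ) ≤ (153 * μ + 116) * minorBound ω n t d dg ∧
      ∀ M : BoundedPair δ t (dg + 2 * lam n d) (d + lam n d) ((dg + lam n d) * d ^ n),
        P.run (Sum.elim (denseMat _ M.1.1) (denseMat _ M.1.2)) =
          densePoly _ ((M.1.1 * M.1.2).submatrix r c).det := by
  have hω₀ : 0 ≤ ω := by linarith
  obtain ⟨m, hm, hm'⟩ := exists_padding_exponent ω hω₀ hω₃ (by omega : 1 ≤ d) n
  have hk : k ≤ 2 ^ m := ((by simpa using Fintype.card_le_of_embedding r : k ≤ δ).trans hδ).trans hm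
  have hq : (4 : ℝ) ≤ 2 ^ ω :=
    le_trans (by norm_num) (Real.rpow_le_rpow_of_exponent_le one_le_two hω₂)
  have hq8 : (2 : ℝ) ^ ω ≤ 8 :=
    (Real.rpow_le_rpow_of_exponent_le one_le_two hω₃).trans_eq (by norm_num)
  obtain ⟨P, hP, hP'⟩ := (reach_coeffs_minor hq hq8 hμ (mulCost_idx hmul)
    (BoundedPair.known_fst (δ := δ) (t := t) (D₁ := dg + 2 * lam n d) (D₂ := d + lam n d)
      (D := (dg + lam n d) * d ^ n))
    BoundedPair.known_snd (hmul δ) hk r c fun M => M.2.2.2.2 k r c).exists_tree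
  refine ⟨P, hP.trans ?_, fun M => ?_⟩
  · have hlam := d_le_lam hn hd
    have h1 : (Fintype.card (Mon t ((dg + lam n d) * d ^ n)) : ℝ) =
        binom t ((dg + lam n d) * d ^ n) := by
      rw [card_mon, binom]
    have h2 : (t : ℝ) * (((((dg + lam n d) * d ^ n : ℕ)) : ℝ) + 1) ≤
        2 * ((d : ℝ) ^ (2 * n) * trinom t dg (2 * lam n d)) := by
      have h3 := mul_le_trinom (t := t) (n := n) (d := d) (dg := dg)
      have h4 : d ^ n ≤ d ^ (2 * n) := Nat.pow_le_pow_right (by omega) (by omega)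
      have h5 : 1 ≤ (dg + lam n d) * d ^ n :=
        Nat.mul_pos (by omega) (Nat.pow_pos (by omega))
      have h6 : t * ((dg + lam n d) * d ^ n) ≤ d ^ (2 * n) * trinom t dg (2 * lam n d) := by
        rw [← mul_assoc, mul_comm]
        exact Nat.mul_le_mul h4 ((Nat.mul_le_mul_left t (by omega)).trans h3)
      exact_mod_cast mul_succ_le_two_mul h5 h6
    have h5 := evalCost_le (t := t) (dg := dg) hn hd hω₀ hμ hδ
    have h6 := mul_le_mul_of_nonneg_left hm' (by positivity : 0 ≤ 19 * μ + 13)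
    -- The product contributes `μ`, the padded determinant `8 (19 μ + 13)`, evaluation `4` and
    -- interpolation `8`.
    rw [h1, minorBound, mul_left_comm (153 * μ + 116)]
    refine mul_le_mul_of_nonneg_left ?_ (Nat.cast_nonneg (α := ℝ) _)
    have h7 : 0 ≤ (d : ℝ) ^ (2 * n) * trinom t dg (2 * lam n d) := by positivity
    have h8 : 0 ≤ (d : ℝ) ^ (ω * n) := by positivity
    nlinarith [mul_nonneg hμ h7]
  · have := hP' M
    rwa [BoundedPair.dense_eq] at this

end Programs

end ParamHermite

theorem mainTheorem9 (ω : ℝ) (hω₂ : 2 < ω) (hω₃ : ω ≤ 3) (hω : IsAdmissibleExponent ω) :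
    ∃ (C : ℝ) (κ : ℕ), ∀ n t d dg δ : ℕ, 2 ≤ n → 2 ≤ t → 2 ≤ d →
      -- one program for `H_g`, and one for each of its minors
      ∃ (P : CompTree (MatIdx δ t (dg + 2 * lam n d) ⊕ MatIdx δ t (d + lam n d))
            (MatIdx δ t (dg + 2 * lam n d)))
        (Q : ∀ k : ℕ, (Fin k ↪ Fin δ) → (Fin k ↪ Fin δ) →
          CompTree (MatIdx δ t (dg + 2 * lam n d) ⊕ MatIdx δ t (d + lam n d))
            (Mon t ((dg + lam n d) * d ^ n))),
        (P.cost : ℝ) ≤ C * (matrixBound ω n t d dg * Real.log (matrixBound ω n t d dg) ^ κ) ∧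
        (∀ k (r c : Fin k ↪ Fin δ), ((Q k r c).cost : ℝ) ≤
          C * (minorBound ω n t d dg * Real.log (minorBound ω n t d dg) ^ κ)) ∧
        ∀ (e : ℕ) (f : Fin e → PolyXY n t) (G : Set (PolyXY n t)) (b : Fin δ → Fin n →₀ ℕ),
          IsRegularSystem d f G b →
          -- `g = g' * h`, where `H_{g'}` and `L_h` are the known matrices
          ∀ g g' h : PolyXY n t, g = g' * h → g ≠ 0 → g.totalDegree ≤ dg → h.totalDegree ≤ d →
            ∃ (β : Module.Basis (Fin δ) (ParamField t) (QuotAlg f))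
              (H H' L : Matrix (Fin δ) (Fin δ) (MvPolynomial (Fin t) ℚ)),
              (∀ i, β i = clsMon f (b i)) ∧
              overK H = hermiteMatrix f b g ∧
              overK H' = hermiteMatrix f b g' ∧
              overK L = Algebra.leftMulMatrix β (cls f h) ∧
              (∀ i j, (H i j).totalDegree ≤ dg + 2 * lam n d) ∧
              (∀ i j, (H' i j).totalDegree ≤ dg + 2 * lam n d) ∧
              (∀ i j, (L i j).totalDegree ≤ d + lam n d) ∧
              P.run (Sum.elim (denseMat (dg + 2 * lam n d) H') (denseMat (d + lam n d) L)) =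
                denseMat (dg + 2 * lam n d) H ∧
              ∀ k (r c : Fin k ↪ Fin δ),
                ((H.submatrix r c).det).totalDegree ≤ (dg + lam n d) * d ^ n ∧
                (Q k r c).run
                    (Sum.elim (denseMat (dg + 2 * lam n d) H') (denseMat (d + lam n d) L)) =
                  densePoly ((dg + lam n d) * d ^ n) (H.submatrix r c).det := by
  obtain ⟨μ, hμ, hmul⟩ := hω.exists_mulCost
  -- No logarithmic factor is needed.
  refine ⟨153 * μ + 116, 0, fun n t d dg δ hn _ hd => ?_⟩
  have hmat : 0 ≤ matrixBound ω n t d dg := by unfold matrixBound; positivity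
  have hmin : 0 ≤ minorBound ω n t d dg := by unfold minorBound; positivity
  simp only [pow_zero, mul_one]
  -- For larger `δ` no regular system exists, so programs of cost zero suffice.
  by_cases hδ : δ ≤ d ^ n
  · obtain ⟨P, hP, hP'⟩ := exists_matrix_program (t := t) (dg := dg) hn hd (by linarith) hμ hmul hδ
      ((dg + lam n d) * d ^ n)
    choose Q hQ hQ' using fun (k : ℕ) (r c : Fin k ↪ Fin δ) =>
      exists_minor_program (t := t) (dg := dg) hn hd hω₂.le hω₃ hμ hmul hδ r c
    refine ⟨P, Q, hP.trans (mul_le_mul_of_nonneg_right (by linarith) hmat), hQ, ?_⟩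
    intro e f G b hS g g' h hg hg0 hgd hh
    obtain ⟨β, H', L, hβ, hH, hH', hL, h1, h2, h3, h4⟩ :=
      hS.exists_matrices (by omega) hg hg0 hgd hh
    exact ⟨β, H' * L, H', L, hβ, hH, hH', hL, h1, h2, h3, hP' ⟨(H', L), h2, h3, h1, h4⟩,
      fun k r c => ⟨h4 k r c, hQ' k r c ⟨(H', L), h2, h3, h1, h4⟩⟩⟩
  · refine ⟨.output fun _ => .const 0, fun _ _ _ => .output fun _ => .const 0, ?_, fun _ _ _ => ?_,
      fun e f G b hS => absurd (hS.numerics (by omega)).1 hδ⟩ <;>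
    · rw [CompTree.cost, Nat.cast_zero]
      positivity
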